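/- **Setting.** An instance of $\mathrm{CI}(\mathrm{DFA},\mathrm{DFA})$ is a tuple $\mathcal C=(\mathcal H,\mathcal S,m,n,\epsilon,\lambda,\rho)$ where $\mathcal H$ and $\mathcal S$ are (complete) deterministic finite automata over a common finite alphabet $\Sigma=\{0,\dots,k-1\}$ (both $\Sigma$ and the automata are part of the instance), $m,n\in\mathbb N$, and $\epsilon,\lambda,\rho\in[0,1]\cap\mathbb Q$. Its size $|\mathcal C|$ is the length of its representation, in which automata are given by their transition table, initial state and accepting bits, $m$ and $n$ are written in unary, and all other numbers in binary. Put $$I=\{w\in L(\mathcal H): m\le |w|\le n\},\qquad A=I\cap L(\mathcal S).$$ A probability distribution $D$ on $\Sigma^*$ is an *improvising distribution* for $\mathcal C$ if $\Pr_{w\leftarrow D}[w\in I]=1$, $\Pr_{w\leftarrow D}[w\in A]\ge 1-\epsilon$, and $\lambda\le D(w)\le\rho$ for all $w\in I$. The instance $\mathcal C$ is *feasible* if it has an improvising distribution. An *improviser* for $\mathcal C$ is a probabilistic algorithm with finite expected running time whose output distribution on empty input is an improvising distribution for $\mathcal C$. Algorithms are programs of a WHILE language whose values are binary trees with natural numbers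 at the leaves; expressions are built from variables, constants, pairing, the two projections, and addition, truncated subtraction and multiplication of numbers; commands are assignment, tossing a fair coin, sequencing, branching and while-loops. Every expression is charged the sum of the sizes (bit lengths) of the values of its subexpressions, and every executed command one further unit (logarithmic cost). A program is itself written down as a value, its text, so that one program can output another. **Theorem.** There is a polynomial-time improvisation scheme for $\mathrm{CI}(\mathrm{DFA},\mathrm{DFA})$, that is, a single deterministic algorithm $S$ (a program that tosses no coins) such that: 1. *Correctness:* for every instance $\mathcal C$ of $\mathrm{CI}(\mathrm{DFA},\mathrm{DFA})$, if $\mathcal C$ is feasible then $S$ on input $\mathcal C$ halts and outputs (the text of) an improviser for $\mathcal C$, and otherwise it halts and outputs $\bot$. 2. *Scheme efficiency:* there is a real polynomial $p$ such that for every such $\mathcal C$ the running time of $S$ on $\mathcal C$ is at most $p(|\mathcal C|)$. 3. *Improviser efficiency:* there is a real polynomial $q$ such that for every such $\mathcal C$, if $S(\mathcal C)=G\ne\bot$ then $G$ has expected running time at most $q(|\mathcal C|)$. -/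

import Mathlib

namespace CtrlImprov

/-! ### Data, and a small imperative language with coin tossing and an explicit running time

Algorithms are programs of a WHILE language in the style of Jones, whose values are binary trees with
natural numbers at the leaves.  Running time is charged by the *logarithmic* cost criterion:
evaluating an expression costs, for every node of the expression, the size (bit length) of the value
computed there, and every executed command costs one more unit.  Up to a polynomial this is the
running time of a (probabilistic) multitape Turing machine. -/

/-- Values: binary trees whose leaves are natural numbers. -/
inductive Data : Type
  | num : ℕ → Data
  | pair : Data → Data → Data

/-- The size of a value: the number of symbols needed to write it down in prefix notation, where a
leaf is a marker followed by the binary expansion of the number (so `num i` has size `1` plus the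
bit length of `i`), and an inner node is a single symbol. -/
def Data.size : Data → ℕ
  | .num i => Nat.size i + 1
  | .pair a b => a.size + b.size + 1

/-- The left component (`num 0` for a leaf). -/
def Data.fst : Data → Data
  | .num _ => .num 0
  | .pair a _ => a

/-- The right component (`num 0` for a leaf). -/
def Data.snd : Data → Data
  | .num _ => .num 0
  | .pair _ b => b

/-- The number at a leaf (`0` for an inner node). -/
def Data.toNat : Data → ℕ
  | .num i => i
  | .pair _ _ => 0

/-- Every value except `num 0` counts as true in tests. -/
def Data.IsTrue (d : Data) : Prop := d ≠ .num 0

/-- Expressions over variables `x₀, x₁, …`. Subtraction is truncated. -/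
inductive Term : Type
  | var : ℕ → Term
  | quote : Data → Term
  | pair : Term → Term → Term
  | fst : Term → Term
  | snd : Term → Term
  | add : Term → Term → Term
  | sub : Term → Term → Term
  | mul : Term → Term → Term

/-- Commands (programs). -/
inductive Prog : Type
  /-- `x := e` -/
  | assign : ℕ → Term → Prog
  /-- toss a fair coin and store the outcome, `num 0` or `num 1`, in a variable -/
  | flip : ℕ → Prog
  | seq : Prog → Prog → Prog
  /-- `if e then p else q` -/
  | branch : Term → Prog → Prog → Prog
  /-- `while e do p` -/
  | loop : Term → Prog → Prog

/-- A store assigns a value to each variable. -/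
abbrev Store : Type := ℕ → Data

/-- The value of an expression. -/
def Term.eval (s : Store) : Term → Data
  | .var x => s x
  | .quote d => d
  | .pair e f => .pair (e.eval s) (f.eval s)
  | .fst e => (e.eval s).fst
  | .snd e => (e.eval s).snd
  | .add e f => .num ((e.eval s).toNat + (f.eval s).toNat)
  | .sub e f => .num ((e.eval s).toNat - (f.eval s).toNat)
  | .mul e f => .num ((e.eval s).toNat * (f.eval s).toNat)

/-- The cost of evaluating an expression: the sum of the sizes of the values of all its
subexpressions. -/
def Term.cost (s : Store) : Term → ℕ
  | .var x => (s x).size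
  | .quote d => d.size
  | .pair e f => e.cost s + f.cost s + (Term.eval s (.pair e f)).size
  | .fst e => e.cost s + (Term.eval s (.fst e)).size
  | .snd e => e.cost s + (Term.eval s (.snd e)).size
  | .add e f => e.cost s + f.cost s + (Term.eval s (.add e f)).size
  | .sub e f => e.cost s + f.cost s + (Term.eval s (.sub e f)).size
  | .mul e f => e.cost s + f.cost s + (Term.eval s (.mul e f)).size

/-- `Exec p s r s' t`: started in the store `s`, the program `p` halts in the store `s'` after time
`t`, having tossed exactly `r.length` coins, whose outcomes were, in this order, the list `r`. -/
inductive Exec : Prog → Store → List Bool → Store → ℕ → Prop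
  | assign (x : ℕ) (e : Term) (s : Store) :
      Exec (.assign x e) s [] (Function.update s x (e.eval s)) (1 + e.cost s)
  | flip (x : ℕ) (b : Bool) (s : Store) :
      Exec (.flip x) s [b] (Function.update s x (.num b.toNat)) 1
  | seq {p q : Prog} {s s' s'' : Store} {r r' : List Bool} {t t' : ℕ} :
      Exec p s r s' t → Exec q s' r' s'' t' → Exec (.seq p q) s (r ++ r') s'' (1 + t + t')
  | branch_true {e : Term} {p q : Prog} {s s' : Store} {r : List Bool} {t : ℕ} :
      (e.eval s).IsTrue → Exec p s r s' t → Exec (.branch e p q) s r s' (1 + e.cost s + t)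
  | branch_false {e : Term} {p q : Prog} {s s' : Store} {r : List Bool} {t : ℕ} :
      ¬ (e.eval s).IsTrue → Exec q s r s' t → Exec (.branch e p q) s r s' (1 + e.cost s + t)
  | loop_true {e : Term} {p : Prog} {s s' s'' : Store} {r r' : List Bool} {t t' : ℕ} :
      (e.eval s).IsTrue → Exec p s r s' t → Exec (.loop e p) s' r' s'' t' →
      Exec (.loop e p) s (r ++ r') s'' (1 + e.cost s + t + t')
  | loop_false {e : Term} {p : Prog} {s : Store} :
      ¬ (e.eval s).IsTrue → Exec (.loop e p) s [] s (1 + e.cost s)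

/-- Execution is deterministic once the coins are fixed: of all the finite prefixes of a given
sequence of coin tosses at most one leads to a halting run, with one final store and one running
time. -/
theorem Exec.unique {p : Prog} {s s₁ s₂ : Store} {r₁ r₂ z₁ z₂ : List Bool} {t₁ t₂ : ℕ}
    (h₁ : Exec p s r₁ s₁ t₁) (h₂ : Exec p s r₂ s₂ t₂) (hz : r₁ ++ z₁ = r₂ ++ z₂) :
    r₁ = r₂ ∧ s₁ = s₂ ∧ t₁ = t₂ := by
  induction h₁ generalizing r₂ s₂ t₂ z₁ z₂ with
  | assign x e s => cases h₂; simp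
  | flip x b s => cases h₂; simp_all
  | seq _ _ ih ih' =>
    cases h₂ with
    | seq k k' =>
      rw [List.append_assoc, List.append_assoc] at hz
      obtain ⟨rfl, rfl, rfl⟩ := ih k hz
      obtain ⟨rfl, rfl, rfl⟩ := ih' k' (List.append_cancel_left hz)
      simp
  | branch_true hc _ ih =>
    cases h₂ with
    | branch_true _ k => obtain ⟨rfl, rfl, rfl⟩ := ih k hz; simp
    | branch_false hn _ => exact absurd hc hn
  | branch_false hc _ ih =>
    cases h₂ with
    | branch_true hn _ => exact absurd hn hc
    | branch_false _ k => obtain ⟨rfl, rfl, rfl⟩ := ih k hz; simp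
  | loop_true hc _ _ ih ih' =>
    cases h₂ with
    | loop_true _ k k' =>
      rw [List.append_assoc, List.append_assoc] at hz
      obtain ⟨rfl, rfl, rfl⟩ := ih k hz
      obtain ⟨rfl, rfl, rfl⟩ := ih' k' (List.append_cancel_left hz)
      simp
    | loop_false hn => exact absurd hc hn
  | loop_false hc =>
    cases h₂ with
    | loop_true hn _ _ => exact absurd hn hc
    | loop_false _ => simp

/-- The initial store: the input is in variable `0`, all other variables hold `num 0`. -/
def initStore (input : Data) : Store := Function.update (fun _ => .num 0) 0 input

/-- `Run p input r out t`: on the given input, tossing exactly the coins `r`, the program halts after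
time `t` with the value `out` in variable `0`. -/
def Run (p : Prog) (input : Data) (r : List Bool) (out : Data) (t : ℕ) : Prop :=
  ∃ s : Store, Exec p (initStore input) r s t ∧ s 0 = out

open Classical in
/-- The probability that the program, on empty input and with independent fair coins, halts with
output `d`. A list `r` of coin tosses occurs with probability `2⁻¹ ^ r.length`. -/
noncomputable def outputProb (p : Prog) (d : Data) : ENNReal :=
  ∑' r : List Bool, if ∃ t, Run p (.num 0) r d t then (2⁻¹ : ENNReal) ^ r.length else 0

open Classical in
/-- The probability that the program halts on empty input. -/
noncomputable def haltProb (p : Prog) : ENNReal :=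
  ∑' r : List Bool, if ∃ d t, Run p (.num 0) r d t then (2⁻¹ : ENNReal) ^ r.length else 0

open Classical in
/-- The expected running time on empty input (infinite if the program diverges with positive
probability). -/
noncomputable def expectedTime (p : Prog) : ENNReal :=
  if haltProb p = 1 then
    ∑' (r : List Bool) (t : ℕ),
      if ∃ d, Run p (.num 0) r d t then (2⁻¹ : ENNReal) ^ r.length * (t : ENNReal) else 0
  else ⊤

/-! ### Encoding of lists and of programs -/

/-- Lists of values: `[]` is `num 0`, and `a :: l` is the pair of `a` and the code of `l`. -/
def codeList : List Data → Data
  | [] => .num 0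
  | a :: l => .pair a (codeList l)

/-- The text of an expression, as a value. -/
def Term.code : Term → Data
  | .var x => .pair (.num 0) (.num x)
  | .quote d => .pair (.num 1) d
  | .pair e f => .pair (.num 2) (.pair e.code f.code)
  | .fst e => .pair (.num 3) e.code
  | .snd e => .pair (.num 4) e.code
  | .add e f => .pair (.num 5) (.pair e.code f.code)
  | .sub e f => .pair (.num 6) (.pair e.code f.code)
  | .mul e f => .pair (.num 7) (.pair e.code f.code)

/-- The text of a program, as a value. -/
def Prog.code : Prog → Data
  | .assign x e => .pair (.num 0) (.pair (.num x) e.code)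
  | .flip x => .pair (.num 1) (.num x)
  | .seq p q => .pair (.num 2) (.pair p.code q.code)
  | .branch e p q => .pair (.num 3) (.pair e.code (.pair p.code q.code))
  | .loop e p => .pair (.num 4) (.pair e.code p.code)

theorem Term.code_injective : Function.Injective Term.code := by
  intro e
  induction e <;> intro f h <;> cases f <;> simp_all [Term.code] <;> grind

/-- A program is determined by its text. -/
theorem Prog.code_injective : Function.Injective Prog.code := by
  intro p
  induction p <;> intro q h <;> cases q <;> simp_all [Prog.code] <;>
    grind [Term.code_injective.eq_iff]

/-- The answer of a scheme: `⊥`, or a program. -/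
def codeAnswer : Option Prog → Data
  | none => .num 0
  | some p => .pair (.num 1) p.code

/-! ### Control improvisation -/

/-- A class of specifications: for each finite alphabet `Fin k` a set of specifications, each of which
denotes a language and is written down as a finite value. -/
structure SpecClass where
  Spec : ℕ → Type
  lang : {k : ℕ} → Spec k → Language (Fin k)
  code : {k : ℕ} → Spec k → Data

/-- The instances of the class `CI(𝒜, ℬ)`: a finite alphabet, a hard specification in `𝒜` and a soft
specification in `ℬ` over it, length bounds `m`, `n`, an error probability `ε`, and probability bounds
`lam`, `rho`. -/
structure CI (𝒜 ℬ : SpecClass) where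
  k : ℕ
  hard : 𝒜.Spec k
  soft : ℬ.Spec k
  m : ℕ
  n : ℕ
  ε : ℚ
  lam : ℚ
  rho : ℚ
  ε_mem : ε ∈ Set.Icc (0 : ℚ) 1
  lam_mem : lam ∈ Set.Icc (0 : ℚ) 1
  rho_mem : rho ∈ Set.Icc (0 : ℚ) 1

/-- A natural number in unary. -/
def codeUnary (i : ℕ) : Data := codeList (List.replicate i (.num 0))

/-- A nonnegative rational number, as numerator and denominator in binary. -/
def codeRat (q : ℚ) : Data := .pair (.num q.num.toNat) (.num q.den)

/-- A word over the alphabet `Fin k`, as the list of its letters in binary. -/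
def codeWord {k : ℕ} (w : List (Fin k)) : Data := codeList (w.map fun a => .num a)

namespace CI

variable {𝒜 ℬ : SpecClass}

/-- The set `I` of improvisations. -/
def improvisations (C : CI 𝒜 ℬ) : Set (List (Fin C.k)) :=
  {w | w ∈ 𝒜.lang C.hard ∧ C.m ≤ w.length ∧ w.length ≤ C.n}

/-- The set `A` of admissible improvisations. -/
def admissible (C : CI 𝒜 ℬ) : Set (List (Fin C.k)) :=
  {w | w ∈ C.improvisations ∧ w ∈ ℬ.lang C.soft}

/-- Improvising distributions: the hard constraint, the soft constraint and the randomness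
requirement. -/
def IsImprovisingDistribution (C : CI 𝒜 ℬ) (D : PMF (List (Fin C.k))) : Prop :=
  D.toOuterMeasure C.improvisations = 1 ∧
  1 - (C.ε : ℝ) ≤ (D.toOuterMeasure C.admissible).toReal ∧
  ∀ w ∈ C.improvisations, (C.lam : ℝ) ≤ (D w).toReal ∧ (D w).toReal ≤ (C.rho : ℝ)

def Feasible (C : CI 𝒜 ℬ) : Prop :=
  ∃ D : PMF (List (Fin C.k)), C.IsImprovisingDistribution D

/-- An improviser: a probabilistic program of finite expected running time whose output distribution
on empty input is an improvising distribution. -/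
def IsImproviser (C : CI 𝒜 ℬ) (G : Prog) : Prop :=
  expectedTime G < ⊤ ∧
  ∃ D : PMF (List (Fin C.k)),
    (∀ w, outputProb G (codeWord w) = D w) ∧ C.IsImprovisingDistribution D

/-- The representation of an instance given to a scheme: `m` and `n` in unary, all other numbers in
binary. -/
def code (C : CI 𝒜 ℬ) : Data :=
  codeList [𝒜.code C.hard, ℬ.code C.soft, codeUnary C.m, codeUnary C.n,
    codeRat C.ε, codeRat C.lam, codeRat C.rho]

/-- The size of an instance is the length of its representation. -/
def size (C : CI 𝒜 ℬ) : ℕ := C.code.size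

end CI

/-- Polynomial-time improvisation schemes for the class `CI(𝒜, ℬ)`. The scheme is a deterministic
algorithm: its runs toss no coins. -/
structure IsPolyTimeImprovisationScheme (𝒜 ℬ : SpecClass) (S : Prog) : Prop where
  correctness : ∀ C : CI 𝒜 ℬ,
    (C.Feasible → ∃ (G : Prog) (t : ℕ), Run S C.code [] (codeAnswer (some G)) t ∧ C.IsImproviser G) ∧
    (¬ C.Feasible → ∃ t : ℕ, Run S C.code [] (codeAnswer none) t)
  scheme_efficiency : ∃ p : Polynomial ℝ, ∀ C : CI 𝒜 ℬ,
    ∃ (d : Data) (t : ℕ), Run S C.code [] d t ∧ (t : ℝ) ≤ p.eval (C.size : ℝ)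
  improviser_efficiency : ∃ q : Polynomial ℝ, ∀ (C : CI 𝒜 ℬ) (G : Prog) (t : ℕ),
    Run S C.code [] (codeAnswer (some G)) t →
      expectedTime G ≤ ENNReal.ofReal (q.eval (C.size : ℝ))

/-! ### Deterministic finite automata -/

open Classical in
/-- The representation of a DFA with `a` states over `Fin k`: its transition table (for each state the
list of the successors under the letters `0, …, k - 1`), its initial state, and for each state a bit
that tells whether the state is accepting. -/
noncomputable def codeDFA {k a : ℕ} (M : DFA (Fin k) (Fin a)) : Data :=
  .pair (codeList (List.ofFn fun q : Fin a => codeList (List.ofFn fun x : Fin k => .num (M.step q x))))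
    (.pair (.num M.start)
      (codeList (List.ofFn fun q : Fin a => .num (if q ∈ M.accept then 1 else 0))))

/-- The class of DFAs. -/
noncomputable def dfaClass : SpecClass where
  Spec k := Σ a : ℕ, DFA (Fin k) (Fin a)
  lang M := M.2.accepts
  code M := codeDFA M.2

end CtrlImprov

/-!
The scheme counts words and the improviser samples by unranking.

*Feasibility.* Let `NA` and `NB` be the numbers of admissible and of inadmissible improvisations. An
improvising distribution exists if and only if `lam * (NA + NB) ≤ 1 ≤ rho * (NA + NB)`,
`1 - ε ≤ rho * NA` and `lam * NB ≤ ε`. These conditions are necessary by summing the bounds on the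
single probabilities (`CI.Feasible.violation_eq_zero`). They are sufficient, because one may give the
admissible improvisations as much probability as possible: each of them `rho`, or, if that leaves too
little for the others, the others `lam` each (`CI.weights_spec`). After clearing denominators the
probability of a word is a natural number, `CI.goodWeight` or `CI.badWeight`, divided by the total
`CI.mass`.

*Counting.* The words of length `j` that lead from a state of the product automaton to acceptance,
counted with such weights, obey a recursion in `j` (`CI.count`), so that the tables for all lengths up
to `n` are computed in polynomial time: the numbers may be exponential, but their bit lengths are
polynomial (`CI.count_le`). `NA`, `NB` and the total weight are instances.

*Sampling.* Lay out all words of admitted length as consecutive intervals whose lengths are their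
weights (`Unrank`). A uniformly distributed number below the total weight then falls into the interval
of a word with the right probability (`Unrank.sum_indicator`), and the word is found from the tables,
first its length and then letter by letter (`Unrank.of_flatMap`, `PolyTime.word`). The uniform number is
drawn by rejection: as many coins as the binary expansion needs are tossed until the number is small
enough. A round succeeds with probability more than `1 / 2`, so the expected number of rounds is
bounded by a constant (`outputProb_sampler`, `expectedTime_sampler_le`). The improviser is a fixed
program that has the tables written into its text.

*Programs.* Apart from the sampling loop, programs are not written out as a whole. `PolyTime x y`
says that some program computes `y i` from `x i` in polynomial time, for all indices `i` of an
arbitrary family. This relation is closed under composition, arithmetic, branching, while-loops with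
polynomially many rounds and polynomially bounded states, and the usual operations on lists, and the
algorithms above are obtained from these closure properties.
-/

namespace CtrlImprov

/-! ### Sizes of values -/

theorem Data.size_pos (d : Data) : 1 ≤ d.size := by
  cases d <;> simp [Data.size]

theorem Data.size_fst_le (d : Data) : d.fst.size ≤ d.size := by
  cases d
  · simp [Data.fst, Data.size]
  · simp only [Data.fst, Data.size]; omega

theorem Data.size_snd_le (d : Data) : d.snd.size ≤ d.size := by
  cases d
  · simp [Data.snd, Data.size]
  · simp only [Data.snd, Data.size]; omega

theorem Data.size_toNat_le (d : Data) : Nat.size d.toNat + 1 ≤ d.size := by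
  cases d
  · simp [Data.toNat, Data.size]
  · simp [Data.toNat, Data.size]

theorem natSize_add_le (a b : ℕ) : Nat.size (a + b) ≤ Nat.size a + Nat.size b := by
  rcases Nat.eq_zero_or_pos a with rfl | ha
  · simp
  rcases Nat.eq_zero_or_pos b with rfl | hb
  · simp
  rw [Nat.size_le, pow_add]
  have h1 := Nat.lt_size_self a
  have h2 := Nat.lt_size_self b
  nlinarith

theorem natSize_mul_le (a b : ℕ) : Nat.size (a * b) ≤ Nat.size a + Nat.size b := by
  rw [Nat.size_le, pow_add]
  exact Nat.mul_lt_mul'' (Nat.lt_size_self a) (Nat.lt_size_self b)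

theorem natSize_sub_le (a b : ℕ) : Nat.size (a - b) ≤ Nat.size a :=
  Nat.size_le_size (Nat.sub_le a b)

theorem length_le_size_codeList (l : List Data) : l.length ≤ (codeList l).size := by
  induction l with
  | nil => simp
  | cons a l ih => simp only [List.length_cons, codeList, Data.size]; omega

theorem size_le_size_codeList {l : List Data} {d : Data} (h : d ∈ l) :
    d.size ≤ (codeList l).size := by
  induction l with
  | nil => simp at h
  | cons a l ih =>
    simp only [codeList, Data.size]
    rcases List.mem_cons.1 h with rfl | h
    · omega
    · have := ih h; omega

theorem size_codeList_le {l : List Data} {B : ℕ} (h : ∀ d ∈ l, d.size ≤ B) :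
    (codeList l).size ≤ l.length * (B + 1) + 1 := by
  induction l with
  | nil => simp [codeList, Data.size]
  | cons a l ih =>
    have h1 := h a (by simp)
    have h2 := ih fun d hd => h d (by simp [hd])
    simp only [codeList, Data.size, List.length_cons, add_mul]
    omega

theorem size_sum_lt_size_codeList (l : List ℕ) : Nat.size l.sum < (codeList (l.map .num)).size := by
  induction l with
  | nil => simp [codeList, Data.size]
  | cons a l ih =>
    have := natSize_add_le a l.sum
    simp only [List.sum_cons, List.map_cons, codeList, Data.size]; omega

theorem codeList_isTrue (l : List Data) : (codeList l).IsTrue ↔ l ≠ [] := by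
  cases l <;> simp [codeList, Data.IsTrue]

theorem num_isTrue (a : ℕ) : (Data.num a).IsTrue ↔ a ≠ 0 := by
  simp [Data.IsTrue]

/-! ### Polynomially bounded quantities -/

theorem polynomial_eval_mono (p : Polynomial ℕ) {a b : ℕ} (h : a ≤ b) : p.eval a ≤ p.eval b := by
  simp only [Polynomial.eval_eq_sum_range]
  gcongr

section Bounds

variable {ι κ : Type}

/-- The quantity `f` is bounded by a polynomial in the size of the value `x`. -/
def PolyBounded (x : ι → Data) (f : ι → ℕ) : Prop :=
  ∃ p : Polynomial ℕ, ∀ i, f i ≤ p.eval (x i).size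

namespace PolyBounded

variable {x y : ι → Data} {f g : ι → ℕ}

theorem const (x : ι → Data) (c : ℕ) : PolyBounded x fun _ => c :=
  ⟨Polynomial.C c, fun i => by simp⟩

theorem size (x : ι → Data) : PolyBounded x fun i => (x i).size :=
  ⟨Polynomial.X, fun i => by simp⟩

theorem add (hf : PolyBounded x f) (hg : PolyBounded x g) : PolyBounded x fun i => f i + g i := by
  obtain ⟨p, hp⟩ := hf
  obtain ⟨q, hq⟩ := hg
  exact ⟨p + q, fun i => by rw [Polynomial.eval_add]; exact add_le_add (hp i) (hq i)⟩

theorem mul (hf : PolyBounded x f) (hg : PolyBounded x g) : PolyBounded x fun i => f i * g i := by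
  obtain ⟨p, hp⟩ := hf
  obtain ⟨q, hq⟩ := hg
  exact ⟨p * q, fun i => by rw [Polynomial.eval_mul]; exact Nat.mul_le_mul (hp i) (hq i)⟩

theorem mono (hg : PolyBounded x g) (h : ∀ i, f i ≤ g i) : PolyBounded x f := by
  obtain ⟨q, hq⟩ := hg
  exact ⟨q, fun i => (h i).trans (hq i)⟩

theorem trans (hy : PolyBounded x fun i => (y i).size) (hf : PolyBounded y f) :
    PolyBounded x f := by
  obtain ⟨p, hp⟩ := hy
  obtain ⟨q, hq⟩ := hf
  refine ⟨q.comp p, fun i => (hq i).trans ?_⟩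
  rw [Polynomial.eval_comp]
  exact polynomial_eval_mono q (hp i)

theorem reindex (hf : PolyBounded x f) (r : κ → ι) :
    PolyBounded (fun j => x (r j)) fun j => f (r j) := by
  obtain ⟨p, hp⟩ := hf
  exact ⟨p, fun j => hp (r j)⟩

/-- A polynomial in a polynomially bounded quantity is polynomially bounded. -/
theorem eval (hf : PolyBounded x f) (q : Polynomial ℕ) : PolyBounded x fun i => q.eval (f i) := by
  obtain ⟨p, hp⟩ := hf
  refine ⟨q.comp p, fun i => ?_⟩
  rw [Polynomial.eval_comp]
  exact polynomial_eval_mono q (hp i)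

end PolyBounded

/-! ### Polynomial-time computability -/

/-- The value `y i` is computable in polynomial time from the value `x i`, uniformly in the index `i`:
a single program that tosses no coins takes every store with `x i` in variable `0` to one with `y i`
there, within a time polynomial in the size of `x i`. It may be started with arbitrary contents of
the other variables, and it leaves all but finitely many variables alone, so that programs compose.
The index carries whatever is presupposed of the input. -/
def PolyTime (x y : ι → Data) : Prop :=
  ∃ (P : Prog) (N : ℕ) (T : ι → ℕ), PolyBounded x T ∧
    ∀ i s, s 0 = x i → ∃ s' t, Exec P s [] s' t ∧ s' 0 = y i ∧ (∀ v, N < v → s' v = s v) ∧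
      t ≤ T i ∧ (y i).size ≤ T i

end Bounds

/-- Sequential composition of runs that toss no coins. -/
theorem Exec.seq_nil {p q : Prog} {s s' s'' : Store} {t t' : ℕ} (h : Exec p s [] s' t)
    (h' : Exec q s' [] s'' t') : Exec (.seq p q) s [] s'' (1 + t + t') :=
  Exec.seq h h'

theorem Exec.seq_nil' {p q : Prog} {s s' s'' : Store} {r : List Bool} {t t' : ℕ}
    (h : Exec p s [] s' t) (h' : Exec q s' r s'' t') : Exec (.seq p q) s r s'' (1 + t + t') :=
  Exec.seq h h'

theorem Exec.seq_nil_right {p q : Prog} {s s' s'' : Store} {r : List Bool} {t t' : ℕ}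
    (h : Exec p s r s' t) (h' : Exec q s' [] s'' t') :
    Exec (.seq p q) s r s'' (1 + t + t') := by
  simpa using Exec.seq h h'

namespace PolyTime

variable {ι κ : Type} {x y z : ι → Data}

theorem size (h : PolyTime x y) : PolyBounded x fun i => (y i).size := by
  obtain ⟨P, N, T, hT, h⟩ := h
  refine hT.mono fun i => ?_
  obtain ⟨_, _, _, _, _, _, h⟩ := h i (fun _ => x i) rfl
  exact h

theorem reindex (h : PolyTime x y) (r : κ → ι) :
    PolyTime (fun j => x (r j)) fun j => y (r j) := by
  obtain ⟨P, N, T, hT, h⟩ := h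
  exact ⟨P, N, fun j => T (r j), hT.reindex r, fun j s hs => h (r j) s hs⟩

/-- An expression in the variable `0` is computable in polynomial time if it is of polynomial cost. -/
theorem of_term (e : Term) (f : Data → Data) (c : ℕ)
    (he : ∀ s : Store, e.eval s = f (s 0)) (hc : ∀ s : Store, e.cost s ≤ c * ((s 0).size + 1))
    (hf : ∀ d : Data, (f d).size ≤ c * (d.size + 1)) :
    PolyTime x fun i => f (x i) := by
  refine ⟨.assign 0 e, 0, fun i => c * ((x i).size + 1) + 1,
    ((PolyBounded.const x c).mul ((PolyBounded.size x).add (.const x 1))).add (.const x 1),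
    fun i s hs => ⟨_, _, Exec.assign 0 e s, ?_, fun v hv => ?_, ?_, ?_⟩⟩
  · simp [he, hs]
  · exact Function.update_of_ne (by omega) _ _
  · have := hc s; rw [hs] at this; dsimp only; omega
  · have := hf (x i); dsimp only; omega

theorem id : PolyTime x x :=
  of_term (.var 0) (fun d => d) 1 (fun _ => rfl) (fun s => by simp [Term.cost]) (fun d => by simp)

theorem const (d : Data) : PolyTime x fun _ => d :=
  of_term (.quote d) (fun _ => d) d.size (fun _ => rfl)
    (fun s => by simp only [Term.cost]; nlinarith) (fun d => by nlinarith)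

theorem trans (h : PolyTime x y) (h' : PolyTime y z) : PolyTime x z := by
  have hy := h.size
  obtain ⟨P, N, T, hT, h⟩ := h
  obtain ⟨P', N', T', hT', h'⟩ := h'
  refine ⟨.seq P P', max N N', fun i => 1 + T i + T' i,
    ((PolyBounded.const x 1).add hT).add (hy.trans hT'), fun i s hs => ?_⟩
  obtain ⟨s₁, t₁, e₁, a₁, b₁, c₁, d₁⟩ := h i s hs
  obtain ⟨s₂, t₂, e₂, a₂, b₂, c₂, d₂⟩ := h' i s₁ a₁
  refine ⟨s₂, _, e₁.seq_nil e₂, a₂, fun v hv => ?_, by dsimp only; omega, by dsimp only; omega⟩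
  rw [b₂ v (by omega), b₁ v (by omega)]

theorem fst (h : PolyTime x y) : PolyTime x fun i => (y i).fst :=
  h.trans <| of_term (.fst (.var 0)) Data.fst 2 (fun _ => rfl)
    (fun s => by
      have := (s 0).size_fst_le
      simp only [Term.cost, Term.eval]; omega)
    (fun d => by have := d.size_fst_le; omega)

theorem snd (h : PolyTime x y) : PolyTime x fun i => (y i).snd :=
  h.trans <| of_term (.snd (.var 0)) Data.snd 2 (fun _ => rfl)
    (fun s => by
      have := (s 0).size_snd_le
      simp only [Term.cost, Term.eval]; omega)
    (fun d => by have := d.size_snd_le; omega)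

/-- The second computation is run while the input and the first result are kept in variables that it
does not touch. -/
theorem pair (h : PolyTime x y) (h' : PolyTime x z) : PolyTime x fun i => .pair (y i) (z i) := by
  have hy := h.size
  have hz := h'.size
  obtain ⟨P, N, T, hT, h⟩ := h
  obtain ⟨P', N', T', hT', h'⟩ := h'
  set M := max N N' + 1 with hM
  refine ⟨.seq (.assign M (.var 0)) (.seq P (.seq (.assign (M + 1) (.var 0))
      (.seq (.assign 0 (.var M)) (.seq P' (.assign 0 (.pair (.var (M + 1)) (.var 0))))))), M + 1,
    fun i => 20 + 4 * (x i).size + T i + T' i + 4 * (y i).size + 4 * (z i).size, ?_, fun i s hs => ?_⟩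
  · exact (((((PolyBounded.const x 20).add ((PolyBounded.const x 4).mul (.size x))).add hT).add
      hT').add ((PolyBounded.const x 4).mul hy)).add ((PolyBounded.const x 4).mul hz)
  obtain ⟨s₁, t₁, e₁, a₁, b₁, c₁, d₁⟩ := h i (Function.update s M (s 0))
    (by rw [Function.update_of_ne (by omega), hs])
  set s₂ := Function.update s₁ (M + 1) (s₁ 0) with hs₂
  set s₃ := Function.update s₂ 0 (s₂ M) with hs₃
  have h2M : s₂ M = x i := by
    rw [hs₂, Function.update_of_ne (by omega), b₁ M (by omega), Function.update_self, hs]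
  obtain ⟨s₄, t₄, e₄, a₄, b₄, c₄, d₄⟩ := h' i s₃ (by rw [hs₃, Function.update_self, h2M])
  have h4 : s₄ (M + 1) = y i := by
    rw [b₄ (M + 1) (by omega), hs₃, Function.update_of_ne (by omega), hs₂, Function.update_self, a₁]
  refine ⟨_, _, (Exec.assign M (.var 0) s).seq_nil <| e₁.seq_nil <|
    (Exec.assign (M + 1) (.var 0) s₁).seq_nil <| (Exec.assign 0 (.var M) s₂).seq_nil <|
    e₄.seq_nil <| Exec.assign 0 (.pair (.var (M + 1)) (.var 0)) s₄, ?_, fun v hv => ?_, ?_, ?_⟩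
  · simp [Term.eval, a₄, h4]
  · rw [Function.update_of_ne (by omega), b₄ v (by omega), hs₃, Function.update_of_ne (by omega),
      hs₂, Function.update_of_ne (by omega), b₁ v (by omega), Function.update_of_ne (by omega)]
  · simp only [Term.cost, Term.eval, hs, a₁, h2M, h4, a₄, Data.size]
    omega
  · simp only [Data.size]; omega

/-- A pair of the input with anything computes whatever the input does. -/
theorem weaken {r : κ → ι} {w : κ → Data} (h : PolyTime x y) :
    PolyTime (fun j => .pair (x (r j)) (w j)) fun j => y (r j) :=
  (PolyTime.id (x := fun j => Data.pair (x (r j)) (w j))).fst.trans (h.reindex r)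

theorem weaken₂ {r : κ → ι} {w w' : κ → Data} (h : PolyTime x y) :
    PolyTime (fun j => .pair (.pair (x (r j)) (w j)) (w' j)) fun j => y (r j) :=
  (PolyTime.id (x := fun j => Data.pair (.pair (x (r j)) (w j)) (w' j))).fst.trans h.weaken

section Arith

variable {a b : ι → ℕ}

theorem add (h : PolyTime x fun i => .num (a i)) (h' : PolyTime x fun i => .num (b i)) :
    PolyTime x fun i => .num (a i + b i) :=
  (h.pair h').trans <| of_term (.add (.fst (.var 0)) (.snd (.var 0)))
    (fun d => .num (d.fst.toNat + d.snd.toNat)) 7 (fun _ => rfl)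
    (fun s => by
      have h1 := natSize_add_le (s 0).fst.toNat (s 0).snd.toNat
      have h2 := (s 0).size_fst_le
      have h3 := (s 0).size_snd_le
      have h4 := (s 0).fst.size_toNat_le
      have h5 := (s 0).snd.size_toNat_le
      simp only [Term.cost, Term.eval, Data.size]; omega)
    (fun d => by
      have h1 := natSize_add_le d.fst.toNat d.snd.toNat
      have h2 := d.size_fst_le
      have h3 := d.size_snd_le
      have h4 := d.fst.size_toNat_le
      have h5 := d.snd.size_toNat_le
      simp only [Data.size]; omega)

theorem mul (h : PolyTime x fun i => .num (a i)) (h' : PolyTime x fun i => .num (b i)) :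
    PolyTime x fun i => .num (a i * b i) :=
  (h.pair h').trans <| of_term (.mul (.fst (.var 0)) (.snd (.var 0)))
    (fun d => .num (d.fst.toNat * d.snd.toNat)) 7 (fun _ => rfl)
    (fun s => by
      have h1 := natSize_mul_le (s 0).fst.toNat (s 0).snd.toNat
      have h2 := (s 0).size_fst_le
      have h3 := (s 0).size_snd_le
      have h4 := (s 0).fst.size_toNat_le
      have h5 := (s 0).snd.size_toNat_le
      simp only [Term.cost, Term.eval, Data.size]; omega)
    (fun d => by
      have h1 := natSize_mul_le d.fst.toNat d.snd.toNat
      have h2 := d.size_fst_le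
      have h3 := d.size_snd_le
      have h4 := d.fst.size_toNat_le
      have h5 := d.snd.size_toNat_le
      simp only [Data.size]; omega)

theorem sub (h : PolyTime x fun i => .num (a i)) (h' : PolyTime x fun i => .num (b i)) :
    PolyTime x fun i => .num (a i - b i) :=
  (h.pair h').trans <| of_term (.sub (.fst (.var 0)) (.snd (.var 0)))
    (fun d => .num (d.fst.toNat - d.snd.toNat)) 7 (fun _ => rfl)
    (fun s => by
      have h1 := natSize_sub_le (s 0).fst.toNat (s 0).snd.toNat
      have h2 := (s 0).size_fst_le
      have h3 := (s 0).size_snd_le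
      have h4 := (s 0).fst.size_toNat_le
      have h5 := (s 0).snd.size_toNat_le
      simp only [Term.cost, Term.eval, Data.size]; omega)
    (fun d => by
      have h1 := natSize_sub_le d.fst.toNat d.snd.toNat
      have h2 := d.size_fst_le
      have h3 := d.size_snd_le
      have h4 := d.fst.size_toNat_le
      have h5 := d.snd.size_toNat_le
      simp only [Data.size]; omega)

end Arith

/-- Branching. Each branch need only work where it is taken. -/
theorem branch {c : ι → Data} (p : ι → Prop) (hc : PolyTime x c) (hp : ∀ i, (c i).IsTrue ↔ p i)
    (h : PolyTime (fun i : {i // p i} => x i) fun i => y i)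
    (h' : PolyTime (fun i : {i // ¬ p i} => x i) fun i => y i) : PolyTime x y := by
  classical
  have hcs := hc.size
  obtain ⟨P₀, N₀, T₀, hT₀, h₀⟩ := hc
  obtain ⟨P, N, T, ⟨π, hπ⟩, h⟩ := h
  obtain ⟨P', N', T', ⟨π', hπ'⟩, h'⟩ := h'
  set M := max N₀ (max N N') + 1 with hM
  refine ⟨.seq (.assign M (.var 0)) (.seq P₀ (.branch (.var 0)
      (.seq (.assign 0 (.var M)) P) (.seq (.assign 0 (.var M)) P'))), M,
    fun i => 20 + 4 * (x i).size + T₀ i + (c i).size +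
      (π.eval (x i).size + π'.eval (x i).size), ?_, fun i s hs => ?_⟩
  · exact ((((PolyBounded.const x 20).add ((PolyBounded.const x 4).mul (.size x))).add hT₀).add
      hcs).add (((PolyBounded.size x).eval π).add ((PolyBounded.size x).eval π'))
  obtain ⟨s₁, t₁, e₁, a₁, b₁, c₁, d₁⟩ := h₀ i (Function.update s M (s 0))
    (by rw [Function.update_of_ne (by omega), hs])
  have h1M : s₁ M = x i := by rw [b₁ M (by omega), Function.update_self, hs]
  set s₂ := Function.update s₁ 0 (s₁ M) with hs₂
  have h20 : s₂ 0 = x i := by rw [hs₂, Function.update_self, h1M]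
  have h2v : ∀ v, M < v → s₂ v = s v := fun v hv => by
    rw [hs₂, Function.update_of_ne (by omega), b₁ v (by omega), Function.update_of_ne (by omega)]
  by_cases hi : p i
  · obtain ⟨s₃, t₃, e₃, a₃, b₃, c₃, d₃⟩ := h ⟨i, hi⟩ s₂ h20
    have := hπ ⟨i, hi⟩
    refine ⟨s₃, _, (Exec.assign M (.var 0) s).seq_nil <| e₁.seq_nil <|
      Exec.branch_true (by rw [Term.eval, a₁, hp]; exact hi) <|
        (Exec.assign 0 (.var M) s₁).seq_nil e₃, a₃, fun v hv => ?_, ?_, ?_⟩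
    · rw [b₃ v (by omega), h2v v hv]
    · simp only [Term.cost, hs, a₁, h1M] at *; omega
    · simp only at *; omega
  · obtain ⟨s₃, t₃, e₃, a₃, b₃, c₃, d₃⟩ := h' ⟨i, hi⟩ s₂ h20
    have := hπ' ⟨i, hi⟩
    refine ⟨s₃, _, (Exec.assign M (.var 0) s).seq_nil <| e₁.seq_nil <|
      Exec.branch_false (by rw [Term.eval, a₁, hp]; exact hi) <|
        (Exec.assign 0 (.var M) s₁).seq_nil e₃, a₃, fun v hv => ?_, ?_, ?_⟩
    · rw [b₃ v (by omega), h2v v hv]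
    · simp only [Term.cost, hs, a₁, h1M] at *; omega
    · simp only at *; omega

/-- Branching between two values that are computable throughout. -/
theorem ite {c : ι → Data} (p : ι → Prop) [DecidablePred p] (hc : PolyTime x c)
    (hp : ∀ i, (c i).IsTrue ↔ p i) (h : PolyTime x y) (h' : PolyTime x z) :
    PolyTime x fun i => if p i then y i else z i := by
  refine branch p hc hp ?_ ?_
  · simpa [Subtype.prop] using h.reindex (Subtype.val : {i // p i} → ι)
  · have := h'.reindex (Subtype.val : {i // ¬ p i} → ι)
    have e : (fun i : {i // ¬ p i} => if p i then y i else z i) = fun i => z i.1 := by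
      funext i; rw [if_neg i.2]
    rwa [e]

/-- While-loops: iteration as long as the first component of the state is true. The number of rounds
and the sizes of all intermediate states have to be polynomially bounded. -/
theorem while_loop (n : ι → ℕ) (st : ι → ℕ → Data)
    (htest : ∀ i j, j ≤ n i → ((st i j).fst.IsTrue ↔ j < n i))
    (body : PolyTime (fun p : Σ i, Fin (n i) => st p.1 p.2) fun p => st p.1 (p.2 + 1))
    (hn : PolyBounded (fun i => st i 0) n) {B : ι → ℕ} (hB : PolyBounded (fun i => st i 0) B)
    (hst : ∀ i j, j ≤ n i → (st i j).size ≤ B i) :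
    PolyTime (fun i => st i 0) fun i => st i (n i) := by
  obtain ⟨P, N, T, ⟨π, hπ⟩, h⟩ := body
  let K : ι → ℕ := fun i => 2 + 2 * B i + π.eval (B i)
  refine ⟨.loop (.fst (.var 0)) P, N, fun i => (n i + 1) * K i,
    (hn.add (.const _ 1)).mul (((PolyBounded.const _ 2).add ((PolyBounded.const _ 2).mul hB)).add
      (hB.eval π)), fun i s hs => ?_⟩
  have hcost : ∀ s j, s 0 = st i j → j ≤ n i →
      (Term.fst (.var 0)).cost s ≤ 2 * B i := fun s j hs hj => by
    have h1 := hst i j hj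
    have h2 := (st i j).size_fst_le
    simp only [Term.cost, Term.eval, hs]; omega
  have key : ∀ m j s, j + m = n i → s 0 = st i j →
      ∃ s' t, Exec (.loop (.fst (.var 0)) P) s [] s' t ∧ s' 0 = st i (n i) ∧
        (∀ v, N < v → s' v = s v) ∧ t ≤ (m + 1) * K i := by
    intro m
    induction m with
    | zero =>
      intro j s hj hs
      obtain rfl : j = n i := by omega
      have hf : ¬ ((Term.fst (.var 0)).eval s).IsTrue := by
        rw [Term.eval, Term.eval, hs, htest i _ le_rfl]; omega
      refine ⟨s, _, Exec.loop_false hf, hs, fun _ _ => rfl, ?_⟩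
      have := hcost s _ hs le_rfl
      simp only [K]; omega
    | succ m ih =>
      intro j s hj hs
      have hjn : j < n i := by omega
      have ht : ((Term.fst (.var 0)).eval s).IsTrue := by
        rw [Term.eval, Term.eval, hs, htest i _ hjn.le]; exact hjn
      obtain ⟨s₁, t₁, e₁, a₁, b₁, c₁, -⟩ := h ⟨i, j, hjn⟩ s hs
      obtain ⟨s₂, t₂, e₂, a₂, b₂, c₂⟩ := ih (j + 1) s₁ (by omega) a₁
      refine ⟨s₂, _, Exec.loop_true ht e₁ e₂, a₂, fun v hv => by rw [b₂ v hv, b₁ v hv], ?_⟩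
      have h1 := hcost s _ hs hjn.le
      have h2 : T ⟨i, j, hjn⟩ ≤ π.eval (B i) :=
        (hπ _).trans (polynomial_eval_mono π (hst i j hjn.le))
      have h3 : (m + 1 + 1) * K i = (m + 1) * K i + K i := by ring
      rw [h3]
      simp only [K] at *
      omega
  obtain ⟨s', t, e, a, b, c⟩ := key (n i) 0 s (by omega) hs
  refine ⟨s', t, e, a, b, c, ?_⟩
  have h1 := hst i (n i) le_rfl
  have h2 : (n i + 1) * K i = n i * K i + K i := by ring
  simp only [K] at *
  omega

end PolyTime

namespace PolyTime

variable {ι κ : Type} {x y z : ι → Data}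

/-! ### Lists -/

/-- Traversal of a list. The value `st i j` is the state of the traversal after the first `j` entries
of the list `l i`. -/
theorem fold (l : ι → List Data) (st : ι → ℕ → Data) (hl : PolyTime x fun i => codeList (l i))
    (h0 : PolyTime x fun i => st i 0)
    (body : PolyTime (fun p : Σ i, Fin (l i).length =>
      .pair (x p.1) (.pair ((l p.1).get p.2) (st p.1 p.2))) fun p => st p.1 (p.2 + 1))
    {B : ι → ℕ} (hB : PolyBounded x B) (hst : ∀ i j, j ≤ (l i).length → (st i j).size ≤ B i) :
    PolyTime x fun i => st i (l i).length := by
  let S : ι → ℕ → Data := fun i j => .pair (codeList ((l i).drop j)) (.pair (x i) (st i j))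
  have hS0 : PolyTime x fun i => S i 0 := by simpa [S] using hl.pair (id.pair h0)
  have hxS : PolyBounded (fun i => S i 0) fun i => (x i).size := (id.snd.fst :
    PolyTime (fun i => S i 0) x).size
  have hlS : PolyBounded (fun i => S i 0) fun i => (codeList (l i)).size := by
    have : PolyTime (fun i => S i 0) fun i => codeList ((l i).drop 0) := id.fst
    simpa using this.size
  have hloop : PolyTime (fun i => S i 0) fun i => S i (l i).length := by
    refine while_loop (fun i => (l i).length) S (fun i j _ => ?_) ?_
      (hlS.mono fun i => length_le_size_codeList _)
      (B := fun i => (codeList (l i)).size + (x i).size + B i + 2)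
      (((hlS.add hxS).add (hxS.trans hB)).add (.const _ 2)) (fun i j hj => ?_)
    · simp only [S, Data.fst, codeList_isTrue, ne_eq, List.drop_eq_nil_iff]; omega
    · have e : ∀ p : Σ i, Fin (l i).length, (l p.1).drop p.2 =
          (l p.1).get p.2 :: (l p.1).drop (p.2 + 1) := fun p => by simp
      have hst : PolyTime (fun p : Σ i, Fin (l i).length => S p.1 p.2)
          fun p => .pair ((l p.1).get p.2) (codeList ((l p.1).drop (p.2 + 1))) := by
        have := (id : PolyTime (fun p : Σ i, Fin (l i).length => S p.1 p.2) _).fst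
        simpa only [S, Data.fst, e, codeList] using this
      refine hst.snd.pair (pair (id.snd.fst) ?_)
      exact (pair id.snd.fst (hst.fst.pair id.snd.snd)).trans body
    · have h1 := hst i j hj
      have h2 : (codeList ((l i).drop j)).size ≤ (codeList (l i)).size := by
        clear hj h1
        generalize l i = l
        induction j generalizing l with
        | zero => simp
        | succ j ih =>
          cases l with
          | nil => simp
          | cons a l =>
            refine (ih l).trans ?_
            simp only [codeList, Data.size]; omega
      simp only [S, Data.size]; omega
  exact (hS0.trans hloop).snd.snd

/-- Traversal of a list with a step function that preserves an invariant. -/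
theorem foldl {α σ : ι → Type} (l : ∀ i, List (α i)) (e : ∀ i, α i → Data) (enc : ∀ i, σ i → Data)
    (f : ∀ i, σ i → α i → σ i) (s₀ : ∀ i, σ i) (Inv : ∀ i, σ i → Prop)
    (hl : PolyTime x fun i => codeList ((l i).map (e i))) (h0 : PolyTime x fun i => enc i (s₀ i))
    (hI0 : ∀ i, Inv i (s₀ i)) (hI : ∀ i s, ∀ a ∈ l i, Inv i s → Inv i (f i s a))
    (body : PolyTime (fun p : {p : Σ i, α i × σ i // p.2.1 ∈ l p.1 ∧ Inv p.1 p.2.2} =>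
      .pair (x p.1.1) (.pair (e _ p.1.2.1) (enc _ p.1.2.2))) fun p => enc _ (f _ p.1.2.2 p.1.2.1))
    {B : ι → ℕ} (hB : PolyBounded x B) (hs : ∀ i s, Inv i s → (enc i s).size ≤ B i) :
    PolyTime x fun i => enc i ((l i).foldl (f i) (s₀ i)) := by
  have hInv : ∀ i j, Inv i (((l i).take j).foldl (f i) (s₀ i)) := by
    intro i j
    have : ∀ (t : List (α i)) s, (∀ a ∈ t, a ∈ l i) → Inv i s → Inv i (t.foldl (f i) s) := by
      intro t
      induction t with
      | nil => simp
      | cons a t ih =>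
        intro s ht h
        exact ih _ (fun b hb => ht b (by simp [hb])) (hI i s a (ht a (by simp)) h)
    exact this _ _ (fun a ha => List.mem_of_mem_take ha) (hI0 i)
  have := fold (x := x) (fun i => (l i).map (e i))
    (fun i j => enc i (((l i).take j).foldl (f i) (s₀ i))) hl (by simpa using h0) ?_ hB
    (fun i j _ => hs i _ (hInv i j))
  · simpa using this
  · let r : (Σ i, Fin ((l i).map (e i)).length) →
        {p : Σ i, α i × σ i // p.2.1 ∈ l p.1 ∧ Inv p.1 p.2.2} := fun p =>
      ⟨⟨p.1, (l p.1)[p.2.1]'(by simpa using p.2.2), ((l p.1).take p.2).foldl (f p.1) (s₀ p.1)⟩,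
        by simp, hInv _ _⟩
    have h := body.reindex r
    have e1 : ∀ p : Σ i, Fin ((l i).map (e i)).length,
        enc p.1 (((l p.1).take (p.2 + 1)).foldl (f p.1) (s₀ p.1)) =
        enc p.1 (f p.1 (((l p.1).take p.2).foldl (f p.1) (s₀ p.1))
          ((l p.1)[p.2.1]'(by simpa using p.2.2))) := fun p => by
      rw [← List.take_concat_get' (l p.1) p.2.1 (by simpa using p.2.2), List.foldl_append]
      rfl
    simp only [e1]
    simpa [r] using h

theorem reverse {l : ι → List Data} (h : PolyTime x fun i => codeList (l i)) :
    PolyTime x fun i => codeList (l i).reverse := by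
  have := fold (x := x) l (fun i j => codeList ((l i).take j).reverse) h
    (by simpa [codeList] using const (x := x) (.num 0)) ?_
    (B := fun i => (codeList (l i)).size * ((codeList (l i)).size + 1) + 1)
    ((h.size.mul (h.size.add (.const x 1))).add (.const x 1)) (fun i j _ => ?_)
  · simpa using this
  · have e : ∀ p : Σ i, Fin (l i).length, codeList ((l p.1).take (p.2 + 1)).reverse =
        .pair ((l p.1).get p.2) (codeList ((l p.1).take p.2).reverse) := fun p => by
      rw [← List.take_concat_get' (l p.1) p.2.1 p.2.2, List.reverse_append]
      rfl
    simp only [e]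
    exact id.snd
  · refine (size_codeList_le (B := (codeList (l i)).size) fun d hd => ?_).trans ?_
    · exact size_le_size_codeList (List.mem_of_mem_take (List.mem_reverse.1 hd))
    · gcongr
      refine le_trans ?_ (length_le_size_codeList (l i))
      simp

theorem map {α : ι → Type} (l : ∀ i, List (α i)) (e g : ∀ i, α i → Data)
    (hl : PolyTime x fun i => codeList ((l i).map (e i)))
    (hg : PolyTime (fun p : Σ i, α i => .pair (x p.1) (e p.1 p.2)) fun p => g p.1 p.2) :
    PolyTime x fun i => codeList ((l i).map (g i)) := by
  obtain ⟨π, hπ⟩ := hg.size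
  have hB : PolyBounded x fun i => π.eval ((x i).size + (codeList ((l i).map (e i))).size + 1) :=
    (((PolyBounded.size x).add hl.size).add (.const x 1)).eval π
  have hlen : ∀ i, (l i).length ≤ (codeList ((l i).map (e i))).size := fun i => by
    simpa using length_le_size_codeList ((l i).map (e i))
  have := fold (x := x) _ (fun i j => codeList (((l i).map (g i)).take j).reverse) hl
    (by simpa [codeList] using const (x := x) (.num 0)) ?_
    (B := fun i => (codeList ((l i).map (e i))).size *
      (π.eval ((x i).size + (codeList ((l i).map (e i))).size + 1) + 1) + 1)
    ((hl.size.mul (hB.add (.const x 1))).add (.const x 1)) (fun i j _ => ?_)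
  · simpa [List.take_of_length_le] using this.reverse
  · let r : (Σ i, Fin ((l i).map (e i)).length) → Σ i, α i := fun p =>
      ⟨p.1, (l p.1)[p.2.1]'(by simpa using p.2.2)⟩
    have e1 : ∀ p : Σ i, Fin ((l i).map (e i)).length,
        codeList (((l p.1).map (g p.1)).take (p.2 + 1)).reverse =
        .pair (g (r p).1 (r p).2) (codeList (((l p.1).map (g p.1)).take p.2).reverse) :=
      fun p => by
        have := List.take_concat_get' ((l p.1).map (g p.1)) p.2.1 (by simpa using p.2.2)
        rw [← this, List.reverse_append]
        simp [r, codeList]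
    simp only [e1]
    refine PolyTime.pair ?_ id.snd.snd
    have h2 := hg.reindex r
    refine (PolyTime.pair id.fst ?_).trans h2
    have : ∀ p : Σ i, Fin ((l i).map (e i)).length,
        e (r p).1 (r p).2 = ((l p.1).map (e p.1)).get p.2 := fun p => by simp [r]
    simp only [this]
    exact id.snd.fst
  · refine (size_codeList_le
      (B := π.eval ((x i).size + (codeList ((l i).map (e i))).size + 1)) fun d hd => ?_).trans ?_
    · obtain ⟨a, ha, rfl⟩ := List.mem_map.1 (List.mem_of_mem_take (List.mem_reverse.1 hd))
      refine (hπ ⟨i, a⟩).trans (polynomial_eval_mono π ?_)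
      have := size_le_size_codeList (List.mem_map_of_mem (f := e i) ha)
      simp only [Data.size]; omega
    · gcongr
      refine le_trans ?_ (hlen i)
      simp

theorem zip {α : ι → Type} (l : ∀ i, List (α i)) (e g : ∀ i, α i → Data)
    (he : PolyTime x fun i => codeList ((l i).map (e i)))
    (hg : PolyTime x fun i => codeList ((l i).map (g i))) :
    PolyTime x fun i => codeList ((l i).map fun a => .pair (e i a) (g i a)) := by
  have hlen : ∀ i, (l i).length ≤ (codeList ((l i).map (e i))).size := fun i => by
    simpa using length_le_size_codeList ((l i).map (e i))
  let w : ∀ i, α i → Data := fun i a => .pair (e i a) (g i a)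
  let E : ι → ℕ := fun i => (codeList ((l i).map (e i))).size
  let G : ι → ℕ := fun i => (codeList ((l i).map (g i))).size
  have := fold (x := x) _ (fun i j => .pair (codeList (((l i).map (g i)).drop j))
      (codeList (((l i).map (w i)).take j).reverse)) he
    (by simpa [codeList] using hg.pair (const (x := x) (.num 0))) ?_
    (B := fun i => (G i * (G i + 1) + 1) + (E i * ((E i + G i + 1) + 1) + 1) + 1)
    (((((hg.size).mul ((hg.size).add (.const x 1))).add (.const x 1)).add
      ((he.size.mul (((he.size.add hg.size).add (.const x 1)).add (.const x 1))).add
        (.const x 1))).add (.const x 1)) (fun i j _ => ?_)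
  · simpa [Data.snd, List.take_of_length_le] using this.snd.reverse
  · let r : ∀ p : (Σ i, Fin ((l i).map (e i)).length), α p.1 := fun p =>
      (l p.1)[p.2.1]'(by simpa using p.2.2)
    have e1 : ∀ p : Σ i, Fin ((l i).map (e i)).length,
        codeList (((l p.1).map (w p.1)).take (p.2 + 1)).reverse =
        .pair (.pair (((l p.1).map (e p.1)).get p.2) (g p.1 (r p)))
          (codeList (((l p.1).map (w p.1)).take p.2).reverse) :=
      fun p => by
        have := List.take_concat_get' ((l p.1).map (w p.1)) p.2.1 (by simpa using p.2.2)
        rw [← this, List.reverse_append]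
        simp [r, codeList, w]
    have e2 : ∀ p : Σ i, Fin ((l i).map (e i)).length,
        codeList (((l p.1).map (g p.1)).drop p.2) = .pair (g p.1 (r p))
          (codeList (((l p.1).map (g p.1)).drop (p.2 + 1))) := fun p => by
      have h := List.cons_getElem_drop_succ (l := (l p.1).map (g p.1)) (n := p.2.1)
        (h := by simpa using p.2.2)
      rw [← h]
      simp [r, codeList]
    simp only [e1]
    have h2 : PolyTime (fun p : Σ i, Fin ((l i).map (e i)).length => Data.pair (x p.1)
        (.pair (((l p.1).map (e p.1)).get p.2)
          (.pair (codeList (((l p.1).map (g p.1)).drop p.2))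
            (codeList (((l p.1).map (w p.1)).take p.2).reverse))))
        fun p => .pair (g p.1 (r p)) (codeList (((l p.1).map (g p.1)).drop (p.2 + 1))) := by
      simp only [← e2]
      exact id.snd.snd.fst
    exact h2.snd.pair ((id.snd.fst.pair h2.fst).pair id.snd.snd.snd)
  · have b1 : (codeList (((l i).map (g i)).drop j)).size ≤ G i * (G i + 1) + 1 := by
      refine (size_codeList_le (B := G i) fun d hd => ?_).trans ?_
      · exact size_le_size_codeList (List.mem_of_mem_drop hd)
      · gcongr
        refine le_trans ?_ (length_le_size_codeList _)
        simp
    have b2 : (codeList (((l i).map (w i)).take j).reverse).size ≤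
        E i * ((E i + G i + 1) + 1) + 1 := by
      refine (size_codeList_le (B := E i + G i + 1) fun d hd => ?_).trans ?_
      · obtain ⟨a, ha, rfl⟩ := List.mem_map.1 (List.mem_of_mem_take (List.mem_reverse.1 hd))
        have h1 := size_le_size_codeList (List.mem_map_of_mem (f := e i) ha)
        have h2 := size_le_size_codeList (List.mem_map_of_mem (f := g i) ha)
        simp only [w, Data.size, E, G]; omega
      · gcongr
        refine le_trans ?_ (hlen i)
        simp
    simp only [Data.size]; omega

/-- The tail of a list is taken once for every entry of a second list. -/
theorem drop {l u : ι → List Data} (h : PolyTime x fun i => codeList (l i))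
    (hu : PolyTime x fun i => codeList (u i)) :
    PolyTime x fun i => codeList ((l i).drop (u i).length) := by
  refine fold (x := x) u (fun i j => codeList ((l i).drop j)) hu (by simpa using h) ?_
    (B := fun i => (codeList (l i)).size * ((codeList (l i)).size + 1) + 1)
    ((h.size.mul (h.size.add (.const x 1))).add (.const x 1)) (fun i j _ => ?_)
  · have e : ∀ p : Σ i, Fin (u i).length, codeList ((l p.1).drop (p.2 + 1)) =
        (codeList ((l p.1).drop p.2)).snd := fun p => by
      rw [← List.drop_drop]
      cases (l p.1).drop p.2 <;> rfl
    simp only [e]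
    exact id.snd.snd.snd
  · refine (size_codeList_le (B := (codeList (l i)).size) fun d hd => ?_).trans ?_
    · exact size_le_size_codeList (List.mem_of_mem_drop hd)
    · gcongr
      refine le_trans ?_ (length_le_size_codeList _)
      simp

theorem sum {α : ι → Type} {l : ∀ i, List (α i)} {a : ∀ i, α i → ℕ}
    (h : PolyTime x fun i => codeList ((l i).map fun b => .num (a i b))) :
    PolyTime x fun i => .num ((l i).map (a i)).sum := by
  have := fold (x := x) _ (fun i j => .num (((l i).map (a i)).take j).sum) h
    (by simpa using const (x := x) (.num 0)) ?_ h.size (fun i j _ => ?_)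
  · simpa [List.take_of_length_le] using this
  · have e : ∀ p : Σ i, Fin ((l i).map fun b => Data.num (a i b)).length,
        Data.num (((l p.1).map (a p.1)).take (p.2 + 1)).sum =
        .num ((((l p.1).map (a p.1)).take p.2).sum +
          a p.1 ((l p.1)[p.2.1]'(by simpa using p.2.2))) := fun p => by
      rw [List.sum_take_succ _ _ (by simpa using p.2.2)]
      simp
    simp only [e]
    refine PolyTime.add id.snd.snd ?_
    have e' : ∀ p : Σ i, Fin ((l i).map fun b => Data.num (a i b)).length,
      Data.num (a p.1 ((l p.1)[p.2.1]'(by simpa using p.2.2))) =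
        ((l p.1).map fun b => Data.num (a p.1 b)).get p.2 := fun p => by simp
    simp only [e']
    exact id.snd.fst
  · have h1 := size_sum_lt_size_codeList ((l i).map (a i))
    have h2 : (((l i).map (a i)).take j).sum ≤ ((l i).map (a i)).sum := by
      conv_rhs => rw [← List.take_append_drop j ((l i).map (a i)), List.sum_append]
      omega
    have h3 := Nat.size_le_size h2
    simp only [List.map_map] at h1
    simp only [Data.size]
    exact le_trans (by omega) h1

/-- The numbers of the positions in a list. -/
theorem enumerate {l : ι → List Data} (h : PolyTime x fun i => codeList (l i)) :
    PolyTime x fun i => codeList ((List.range (l i).length).map .num) := by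
  have := fold (x := x) l
    (fun i j => .pair (.num j) (codeList ((List.range j).map Data.num).reverse)) h
    (by simpa [codeList] using const (x := x) (.pair (.num 0) (.num 0))) ?_
    (B := fun i => ((codeList (l i)).size + 1) +
      ((codeList (l i)).size * ((codeList (l i)).size + 1 + 1) + 1) + 1)
    ((((h.size.add (.const x 1))).add ((h.size.mul ((h.size.add (.const x 1)).add
      (.const x 1))).add (.const x 1))).add (.const x 1)) (fun i j hj => ?_)
  · simpa [Data.snd] using this.snd.reverse
  · simp only [List.range_succ, List.map_append, List.reverse_append]
    exact (PolyTime.add id.snd.snd.fst (const (.num 1))).pair id.snd.snd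
  · have hn : ∀ a ≤ j, Nat.size a ≤ (codeList (l i)).size := fun a ha => by
      have h2 := length_le_size_codeList (l i)
      have h3 : Nat.size a ≤ a := Nat.size_le.2 Nat.lt_two_pow_self
      omega
    have h1 : (codeList ((List.range j).map Data.num).reverse).size ≤
        (codeList (l i)).size * ((codeList (l i)).size + 1 + 1) + 1 := by
      refine (size_codeList_le (B := (codeList (l i)).size + 1) fun d hd => ?_).trans ?_
      · obtain ⟨a, ha, rfl⟩ := List.mem_map.1 (List.mem_reverse.1 hd)
        have := hn a (List.mem_range.1 ha).le
        simp only [Data.size]; omega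
      · gcongr
        refine le_trans ?_ (length_le_size_codeList _)
        simpa using hj
    have := hn j le_rfl
    simp only [Data.size]; omega

/-- Access to an entry of a list. -/
theorem get {n : ι → ℕ} {f : ∀ i, Fin (n i) → Data} {q : ∀ i, Fin (n i)}
    (h : PolyTime x fun i => codeList ((List.finRange (n i)).map (f i)))
    (hq : PolyTime x fun i => .num (q i)) : PolyTime x fun i => f i (q i) := by
  let l : ι → List Data := fun i => (List.finRange (n i)).map (f i)
  have hlen : ∀ i, (q i : ℕ) < (l i).length := fun i => by simp [l]
  let S : ι → ℕ → Data := fun i j => .pair (.num (q i - j)) (codeList ((l i).drop j))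
  have hS0 : PolyTime x fun i => S i 0 := by simpa [S] using hq.pair h
  have hl0 : PolyBounded (fun i => S i 0) fun i => (codeList (l i)).size := by
    have : PolyTime (fun i => S i 0) fun i => codeList ((l i).drop 0) := id.snd
    simpa using this.size
  have hloop : PolyTime (fun i => S i 0) fun i => S i (q i) := by
    refine while_loop (fun i => (q i : ℕ)) S (fun i j _ => ?_) ?_ (hl0.mono fun i => ?_)
      (B := fun i => (S i 0).size + ((codeList (l i)).size * ((codeList (l i)).size + 1) + 1))
      ((PolyBounded.size _).add ((hl0.mul (hl0.add (.const _ 1))).add (.const _ 1)))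
      (fun i j hj => ?_)
    · simp only [S, Data.fst, num_isTrue]; omega
    · have e : ∀ p : Σ i, Fin (q i), codeList ((l p.1).drop (p.2 + 1)) =
          (codeList ((l p.1).drop p.2)).snd := fun p => by
        rw [← List.drop_drop]
        cases (l p.1).drop p.2 <;> rfl
      simp only [S, e, ← Nat.sub_sub]
      exact (sub id.fst (const (.num 1))).pair id.snd.snd
    · exact (hlen i).le.trans (length_le_size_codeList _)
    · have h1 : (codeList ((l i).drop j)).size ≤
          (codeList (l i)).size * ((codeList (l i)).size + 1) + 1 := by
        refine (size_codeList_le (B := (codeList (l i)).size) fun d hd => ?_).trans ?_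
        · exact size_le_size_codeList (List.mem_of_mem_drop hd)
        · gcongr
          refine le_trans ?_ (length_le_size_codeList _)
          simp
      have h2 := natSize_sub_le (q i) j
      simp only [S, Data.size, Nat.sub_zero]; omega
  have e : ∀ i, f i (q i) = (S i (q i)).snd.fst := fun i => by
    have h := List.cons_getElem_drop_succ (l := l i) (n := (q i : ℕ)) (h := hlen i)
    simp only [S, Data.snd, ← h, codeList, Data.fst]
    simp [l]
  simp only [e]
  exact (hS0.trans hloop).snd.fst

end PolyTime

/-! ### Unranking in a weighted list -/

/-- `Unrank wt l r a r'`: when the entries of the list `l` are laid out as consecutive intervals of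
lengths given by `wt`, the number `r` falls into the interval of the entry `a`, at offset `r'`. -/
inductive Unrank {α : Type} (wt : α → ℕ) : List α → ℕ → α → ℕ → Prop
  | here {a : α} {l : List α} {r : ℕ} : r < wt a → Unrank wt (a :: l) r a r
  | there {a b : α} {l : List α} {r r' : ℕ} :
      Unrank wt l r b r' → Unrank wt (a :: l) (wt a + r) b r'

namespace Unrank

variable {α β : Type} {wt : α → ℕ} {l : List α} {r r₁ r₂ : ℕ} {a a₁ a₂ : α}

theorem mem (h : Unrank wt l r a r₁) : a ∈ l := by
  induction h with
  | here => simp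
  | there _ ih => simp [ih]

theorem offset_le (h : Unrank wt l r a r₁) : r₁ ≤ r := by
  induction h with
  | here h => exact le_rfl
  | there _ ih => exact ih.trans (Nat.le_add_left _ _)

theorem unique (h : Unrank wt l r a₁ r₁) (h' : Unrank wt l r a₂ r₂) : a₁ = a₂ ∧ r₁ = r₂ := by
  induction h generalizing r₂ with
  | here h =>
    cases h' with
    | here => exact ⟨rfl, rfl⟩
    | there _ => omega
  | @there c b l r r' _ ih =>
    generalize hk : wt c + r = k at h'
    cases h' with
    | here => omega
    | there h' =>
      obtain rfl := Nat.add_left_cancel hk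
      exact ih h'

theorem lt_sum (h : Unrank wt l r a r₁) : r < (l.map wt).sum := by
  induction h with
  | here h => simp only [List.map_cons, List.sum_cons]; omega
  | there _ ih => simp only [List.map_cons, List.sum_cons]; omega

theorem exists_of_lt (l : List α) (h : r < (l.map wt).sum) : ∃ a r', Unrank wt l r a r' := by
  induction l generalizing r with
  | nil => simp at h
  | cons a l ih =>
    by_cases hr : r < wt a
    · exact ⟨a, r, .here hr⟩
    · simp only [List.map_cons, List.sum_cons] at h
      obtain ⟨b, r', hb⟩ := ih (r := r - wt a) (by omega)
      refine ⟨b, r', ?_⟩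
      have := hb.there (a := a)
      rwa [Nat.add_sub_cancel' (by omega)] at this

theorem append_cases {l' : List α} (h : Unrank wt (l ++ l') r a r₁) :
    Unrank wt l r a r₁ ∨ ∃ r₂, r = (l.map wt).sum + r₂ ∧ Unrank wt l' r₂ a r₁ := by
  induction l generalizing r with
  | nil => exact .inr ⟨r, by simp, h⟩
  | cons b l ih =>
    cases h with
    | here h => exact .inl (.here h)
    | there h =>
      rcases ih h with h | ⟨r₂, rfl, h'⟩
      · exact .inl h.there
      · exact .inr ⟨r₂, by simp [add_assoc], h'⟩

/-- Unranking in a concatenation of lists can be done in two rounds: first find the list, by total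
weights, and then the entry of that list. -/
theorem of_flatMap {w : β → ℕ} {f : α → List β} {b : β} (h : Unrank w (l.flatMap f) r b r₁) :
    ∃ a r₂, Unrank (fun a => ((f a).map w).sum) l r a r₂ ∧ Unrank w (f a) r₂ b r₁ := by
  induction l generalizing r with
  | nil => cases h
  | cons c l ih =>
    rw [List.flatMap_cons] at h
    rcases append_cases h with h | ⟨r₂, rfl, h'⟩
    · exact ⟨c, r, .here h.lt_sum, h⟩
    · obtain ⟨a, r₃, ha, hb⟩ := ih h'
      exact ⟨a, r₃, ha.there, hb⟩

theorem of_map {w : β → ℕ} {f : α → β} {b : β} (h : Unrank w (l.map f) r b r₁) :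
    ∃ a, f a = b ∧ Unrank (fun a => w (f a)) l r a r₁ := by
  induction l generalizing r with
  | nil => cases h
  | cons c l ih =>
    cases h with
    | here h => exact ⟨c, rfl, .here h⟩
    | there h =>
      obtain ⟨a, ha, h⟩ := ih h
      exact ⟨a, ha, h.there⟩

open Classical in
/-- An entry is found from exactly as many numbers as its weight says. -/
theorem sum_indicator (l : List α) (hl : l.Nodup) (a : α) :
    (∑ r ∈ Finset.range (l.map wt).sum, if ∃ r', Unrank wt l r a r' then 1 else 0) =
      if a ∈ l then wt a else 0 := by
  induction l with
  | nil => simp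
  | cons b l ih =>
    have hb := (List.nodup_cons.1 hl).1
    rw [List.map_cons, List.sum_cons, Finset.sum_range_add]
    have h1 : ∀ r ∈ Finset.range (wt b),
        (if ∃ r', Unrank wt (b :: l) r a r' then 1 else 0) = if a = b then 1 else 0 := by
      intro r hr
      have hr' := Unrank.here (l := l) (Finset.mem_range.1 hr)
      refine if_congr ⟨fun ⟨r', h⟩ => (h.unique hr').1, ?_⟩ rfl rfl
      rintro rfl
      exact ⟨r, hr'⟩
    have h2 : ∀ r, (∃ r', Unrank wt (b :: l) (wt b + r) a r') ↔ ∃ r', Unrank wt l r a r' := by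
      refine fun r => exists_congr fun r' => ⟨fun h => ?_, .there⟩
      generalize hk : wt b + r = k at h
      cases h with
      | here => omega
      | there h =>
        obtain rfl := Nat.add_left_cancel hk
        exact h
    rw [Finset.sum_congr rfl h1]
    simp only [h2, ih (List.nodup_cons.1 hl).2]
    by_cases hab : a = b
    · subst hab
      simp [hb]
    · simp [hab]

end Unrank

/-- The state of a search through a weighted list: the rest of the rank that has still to be used up,
or the entry found and the offset in its interval. -/
abbrev SearchState (α : Type) : Type := ℕ ⊕ α × ℕ

/-- One step of the search. -/
def searchStep {α : Type} (wt : α → ℕ) (s : SearchState α) (a : α) : SearchState α :=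
  match s with
  | .inl r => if r < wt a then .inr (a, r) else .inl (r - wt a)
  | .inr b => .inr b

theorem Unrank.foldl_searchStep {α : Type} {wt : α → ℕ} {l : List α} {r r' : ℕ} {a : α}
    (h : Unrank wt l r a r') : l.foldl (searchStep wt) (.inl r) = .inr (a, r') := by
  have hr : ∀ (l : List α) b, l.foldl (searchStep wt) (.inr b) = .inr b := by
    intro l b
    induction l with
    | nil => rfl
    | cons a l ih => exact ih
  induction h with
  | here h => rw [List.foldl_cons, searchStep, if_pos h, hr]
  | there _ ih => rw [List.foldl_cons, searchStep, if_neg (by omega), Nat.add_sub_cancel_left, ih]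

/-- What holds throughout a search for the rank `r`: nothing but entries of the list is found, and
ranks never grow. -/
def SearchState.Valid {α : Type} (l : List α) (r : ℕ) : SearchState α → Prop
  | .inl r' => r' ≤ r
  | .inr (a, r') => a ∈ l ∧ r' ≤ r

/-- The rest of the rank that has still to be used up (`0` if an entry has been found). -/
def SearchState.rest {α : Type} : SearchState α → ℕ
  | .inl r => r
  | .inr _ => 0

/-- The code of a state of the search, the entries of the list being represented by the values
`pl`. -/
def codeSearch {α : Type} (pl : α → Data) : SearchState α → Data
  | .inl r => .pair (.num 0) (.num r)
  | .inr (a, r) => .pair (.num 1) (.pair (pl a) (.num r))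

namespace PolyTime

variable {ι : Type} {x : ι → Data}

/-- Unranking in a list of entries `pl a` that are given together with their weights. -/
theorem unrank {α : ι → Type} {l : ∀ i, List (α i)} {wt : ∀ i, α i → ℕ} {pl : ∀ i, α i → Data}
    {r r' : ι → ℕ} {a : ∀ i, α i} (h : ∀ i, Unrank (wt i) (l i) (r i) (a i) (r' i))
    (hl : PolyTime x fun i => codeList ((l i).map fun a => .pair (.num (wt i a)) (pl i a)))
    (hr : PolyTime x fun i => .num (r i)) :
    PolyTime x fun i => .pair (pl i (a i)) (.num (r' i)) := by
  have key := foldl (x := x) l (fun i a => .pair (.num (wt i a)) (pl i a))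
    (fun i => codeSearch (pl i)) (fun i => searchStep (wt i)) (fun i => .inl (r i))
    (fun i => SearchState.Valid (l i) (r i)) hl ((const (.num 0)).pair hr)
    (fun i => le_rfl) ?_ ?_
    (B := fun i => (codeList ((l i).map fun a => .pair (.num (wt i a)) (pl i a))).size +
      (Data.num (r i)).size + 4) ((hl.size.add hr.size).add (.const x 4)) ?_
  · simp only [(h _).foldl_searchStep] at key
    exact key.snd
  · rintro i (r'' | ⟨b, r''⟩) c hc hs
    · simp only [searchStep]
      split_ifs
      · exact ⟨hc, hs⟩
      · exact (Nat.sub_le _ _).trans hs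
    · exact hs
  · refine branch (fun p => p.1.2.2.isRight) (id.snd.snd.fst) ?_ ?_ ?_
    · rintro ⟨⟨i, c, (r'' | ⟨b, r''⟩)⟩, hp⟩ <;> simp [codeSearch, Data.fst, Data.snd, num_isTrue]
    · have e : ∀ p : {p : {p : Σ i, α i × SearchState (α i) // p.2.1 ∈ l p.1 ∧
          p.2.2.Valid (l p.1) (r p.1)} // p.1.2.2.isRight},
          searchStep (wt p.1.1.1) p.1.1.2.2 p.1.1.2.1 = p.1.1.2.2 := by
        rintro ⟨⟨⟨i, c, (r'' | ⟨b, r''⟩)⟩, hp⟩, h⟩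
        · simp at h
        · rfl
      simp only [e]
      exact id.snd.snd
    · have e1 : ∀ p : {p : {p : Σ i, α i × SearchState (α i) // p.2.1 ∈ l p.1 ∧
          p.2.2.Valid (l p.1) (r p.1)} // ¬ p.1.2.2.isRight},
          codeSearch (pl p.1.1.1) p.1.1.2.2 = .pair (.num 0) (.num p.1.1.2.2.rest) := by
        rintro ⟨⟨⟨i, c, (r'' | ⟨b, r''⟩)⟩, hp⟩, h⟩
        · rfl
        · simp at h
      have e2 : ∀ p : {p : {p : Σ i, α i × SearchState (α i) // p.2.1 ∈ l p.1 ∧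
          p.2.2.Valid (l p.1) (r p.1)} // ¬ p.1.2.2.isRight},
          codeSearch (pl p.1.1.1) (searchStep (wt p.1.1.1) p.1.1.2.2 p.1.1.2.1) =
          if p.1.1.2.2.rest < wt p.1.1.1 p.1.1.2.1 then
            .pair (.num 1) (.pair (pl p.1.1.1 p.1.1.2.1) (.num p.1.1.2.2.rest))
          else .pair (.num 0) (.num (p.1.1.2.2.rest - wt p.1.1.1 p.1.1.2.1)) := by
        rintro ⟨⟨⟨i, c, (r'' | ⟨b, r''⟩)⟩, hp⟩, h⟩
        · by_cases hlt : r'' < wt i c <;>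
            simp [searchStep, SearchState.rest, codeSearch, hlt]
        · simp at h
      simp only [e1, e2]
      refine ite (c := fun p => .num (wt p.1.1.1 p.1.1.2.1 - p.1.1.2.2.rest)) _ ?_ ?_ ?_ ?_
      · exact sub id.snd.fst.fst id.snd.snd.snd
      · intro p; rw [num_isTrue]; omega
      · exact (const (.num 1)).pair (id.snd.fst.snd.pair id.snd.snd.snd)
      · exact (const (.num 0)).pair (sub id.snd.snd.snd id.snd.fst.fst)
  · rintro i (r'' | ⟨b, r''⟩) hs
    · have := Nat.size_le_size (show r'' ≤ r i from hs)
      simp only [codeSearch, Data.size, Nat.size_zero]; omega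
    · have h1 := Nat.size_le_size hs.2
      have h2 := size_le_size_codeList
        (List.mem_map_of_mem (f := fun a => Data.pair (.num (wt i a)) (pl i a)) hs.1)
      simp only [Data.size] at h2
      have h3 : Nat.size 1 = 1 := Nat.size_one
      simp only [codeSearch, Data.size, h3]; omega

end PolyTime

/-! ### Words by length -/

/-- All words of length `j` over the alphabet `Fin k`, in lexicographic order. -/
def words (k : ℕ) : ℕ → List (List (Fin k))
  | 0 => [[]]
  | j + 1 => (List.finRange k).flatMap fun y => (words k j).map (y :: ·)

theorem mem_words {k j : ℕ} {w : List (Fin k)} : w ∈ words k j ↔ w.length = j := by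
  induction j generalizing w with
  | zero => simp [words]
  | succ j ih =>
    simp only [words, List.mem_flatMap, List.mem_finRange, true_and, List.mem_map, ih]
    cases w with
    | nil => simp
    | cons y w => simp

theorem nodup_words (k j : ℕ) : (words k j).Nodup := by
  induction j with
  | zero => simp [words]
  | succ j ih =>
    rw [words, List.nodup_flatMap]
    refine ⟨fun y _ => ih.map (List.cons_injective), ?_⟩
    refine (List.nodup_finRange k).imp fun {y z} hyz => ?_
    simp only [Function.onFun, List.disjoint_left, List.mem_map]
    rintro _ ⟨v, _, rfl⟩ ⟨v', _, h⟩
    exact hyz (List.cons.inj h).1.symm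

/-- The numbers `m + u - 1, …, m`. -/
def lengths (m : ℕ) : ℕ → List ℕ
  | 0 => []
  | u + 1 => (m + u) :: lengths m u

theorem mem_lengths {m u j : ℕ} : j ∈ lengths m u ↔ m ≤ j ∧ j < m + u := by
  induction u with
  | zero => simp [lengths]
  | succ u ih => simp only [lengths, List.mem_cons, ih]; omega

theorem length_lengths (m u : ℕ) : (lengths m u).length = u := by
  induction u with
  | zero => rfl
  | succ u ih => simp [lengths, ih]

theorem nodup_lengths (m u : ℕ) : (lengths m u).Nodup := by
  induction u with
  | zero => simp [lengths]
  | succ u ih =>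
    rw [lengths, List.nodup_cons]
    exact ⟨fun h => by have := mem_lengths.1 h; omega, ih⟩

theorem sum_map_flatMap {α β : Type} (l : List α) (f : α → List β) (w : β → ℕ) :
    ((l.flatMap f).map w).sum = (l.map fun a => ((f a).map w).sum).sum := by
  induction l with
  | nil => rfl
  | cons a l ih => simp [List.flatMap_cons, ih]

namespace CI

/-! ### The product automaton and weighted counting of words -/

/-- The automaton of the hard specification, with its number of states. -/
def hardDFA (C : CI dfaClass dfaClass) : Σ a : ℕ, DFA (Fin C.k) (Fin a) := C.hard

/-- The automaton of the soft specification, with its number of states. -/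
def softDFA (C : CI dfaClass dfaClass) : Σ a : ℕ, DFA (Fin C.k) (Fin a) := C.soft

/-- The states of the product of the two automata. -/
abbrev State (C : CI dfaClass dfaClass) : Type := Fin C.hardDFA.1 × Fin C.softDFA.1

variable (C : CI dfaClass dfaClass)

def start : C.State := (C.hardDFA.2.start, C.softDFA.2.start)

def step (q : C.State) (y : Fin C.k) : C.State :=
  (C.hardDFA.2.step q.1 y, C.softDFA.2.step q.2 y)

def run (q : C.State) (w : List (Fin C.k)) : C.State := w.foldl C.step q

theorem run_eq (q : C.State) (w : List (Fin C.k)) :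
    C.run q w = (C.hardDFA.2.evalFrom q.1 w, C.softDFA.2.evalFrom q.2 w) := by
  induction w generalizing q with
  | nil => rfl
  | cons y w ih => exact ih (C.step q y)

open Classical in
/-- The weight of a state of the product: `α` if both components are accepting, `β` if only the first
is, and `0` otherwise. -/
noncomputable def weight (α β : ℕ) (q : C.State) : ℕ :=
  if q.1 ∈ C.hardDFA.2.accept then if q.2 ∈ C.softDFA.2.accept then α else β else 0

/-- The total weight of the states reached from `q` by the words of length `j`. -/
noncomputable def count (α β : ℕ) : ℕ → C.State → ℕ
  | 0, q => C.weight α β q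
  | j + 1, q => ((List.finRange C.k).map fun y => count α β j (C.step q y)).sum

theorem count_eq (α β j : ℕ) (q : C.State) :
    C.count α β j q = ((words C.k j).map fun w => C.weight α β (C.run q w)).sum := by
  induction j generalizing q with
  | zero => simp [count, words, run]
  | succ j ih =>
    rw [words, sum_map_flatMap, count]
    simp only [ih, List.map_map]
    rfl

theorem count_le (α β j : ℕ) (q : C.State) : C.count α β j q ≤ C.k ^ j * (α + β) := by
  induction j generalizing q with
  | zero => simp only [count, weight, pow_zero, one_mul]; split_ifs <;> omega
  | succ j ih =>
    rw [count, pow_succ', mul_assoc]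
    refine (List.sum_le_card_nsmul _ (C.k ^ j * (α + β)) fun v hv => ?_).trans ?_
    · obtain ⟨y, -, rfl⟩ := List.mem_map.1 hv
      exact ih _
    · simp

/-- The words of admitted length. -/
def candidates : List (List (Fin C.k)) := (lengths C.m (C.n + 1 - C.m)).flatMap (words C.k)

theorem mem_candidates {w : List (Fin C.k)} :
    w ∈ C.candidates ↔ C.m ≤ w.length ∧ w.length ≤ C.n := by
  simp only [candidates, List.mem_flatMap, mem_words, mem_lengths]
  constructor
  · rintro ⟨j, hj, rfl⟩; omega
  · intro h; exact ⟨_, by omega, rfl⟩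

theorem nodup_candidates : C.candidates.Nodup := by
  rw [candidates, List.nodup_flatMap]
  refine ⟨fun j _ => nodup_words _ j, (nodup_lengths _ _).imp fun {i j} hij => ?_⟩
  simp only [Function.onFun, List.disjoint_left, mem_words]
  rintro w rfl h
  exact hij h

/-- The total weight of the words of admitted length. The list of lengths is empty if `n < m`, as
the subtraction is truncated. -/
noncomputable def total (α β : ℕ) : ℕ :=
  ((lengths C.m (C.n + 1 - C.m)).map fun j => C.count α β j C.start).sum

theorem total_eq (α β : ℕ) :
    C.total α β = (C.candidates.map fun w => C.weight α β (C.run C.start w)).sum := by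
  rw [total, candidates, sum_map_flatMap]
  simp only [count_eq]

/-- A table of numbers, indexed by the states of the product. -/
def codeTable (f : C.State → ℕ) : Data :=
  codeList ((List.finRange C.hardDFA.1).map fun q =>
    codeList ((List.finRange C.softDFA.1).map fun q' => .num (f (q, q'))))

theorem size_codeTable_le {f : C.State → ℕ} {B : ℕ} (h : ∀ q, Nat.size (f q) ≤ B) :
    (C.codeTable f).size ≤ C.hardDFA.1 * (C.softDFA.1 * (B + 1 + 1) + 1 + 1) + 1 := by
  refine (size_codeList_le (B := C.softDFA.1 * (B + 1 + 1) + 1) fun d hd => ?_).trans (by simp)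
  obtain ⟨q, -, rfl⟩ := List.mem_map.1 hd
  refine (size_codeList_le (B := B + 1) fun d hd => ?_).trans (by simp)
  obtain ⟨q', -, rfl⟩ := List.mem_map.1 hd
  have := h (q, q')
  simp only [Data.size]; omega

/-- The tables for the counts of the words of length `j`, …, `0`. -/
noncomputable def layers (α β : ℕ) : ℕ → List Data
  | 0 => [C.codeTable (C.count α β 0)]
  | j + 1 => C.codeTable (C.count α β (j + 1)) :: layers α β j

theorem length_layers (α β j : ℕ) : (C.layers α β j).length = j + 1 := by
  induction j with
  | zero => rfl
  | succ j ih => simp [layers, ih]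

/-- A bound for the size of the tables for the counts of words of length at most `j`. -/
noncomputable def layerBound (α β j : ℕ) : ℕ :=
  C.hardDFA.1 * (C.softDFA.1 *
    ((C.k * j + (Nat.size α + Nat.size β)) + 1 + 1) + 1 + 1) + 1

theorem size_codeTable_count_le (α β : ℕ) {i j : ℕ} (h : i ≤ j) :
    (C.codeTable (C.count α β i)).size ≤ C.layerBound α β j := by
  refine C.size_codeTable_le fun q => ?_
  rw [Nat.size_le, pow_add]
  refine (C.count_le α β i q).trans_lt ?_
  have h1 : C.k ^ i ≤ 2 ^ (C.k * j) := by
    rw [pow_mul]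
    calc C.k ^ i ≤ (2 ^ C.k) ^ i := Nat.pow_le_pow_left Nat.lt_two_pow_self.le _
      _ ≤ _ := Nat.pow_le_pow_right (by positivity) h
  have h2 : α + β < 2 ^ (Nat.size α + Nat.size β) := Nat.size_le.1 (natSize_add_le α β)
  exact Nat.mul_lt_mul_of_le_of_lt h1 h2 (by positivity)

theorem size_layers_le (α β : ℕ) {i j : ℕ} (h : i ≤ j) :
    (codeList (C.layers α β i)).size ≤ (j + 1) * (C.layerBound α β j + 1) + 1 := by
  refine (size_codeList_le (B := C.layerBound α β j) fun d hd => ?_).trans ?_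
  · induction i with
    | zero =>
      obtain rfl := List.mem_singleton.1 hd
      exact C.size_codeTable_count_le α β h
    | succ i ih =>
      rcases List.mem_cons.1 hd with rfl | hd
      · exact C.size_codeTable_count_le α β h
      · exact ih (by omega) hd
  · rw [length_layers]; gcongr

/-- The choice of the length `j` of a word, with its weight: the tables for the lengths up to `j`. -/
noncomputable def lengthOption (α β j : ℕ) : Data :=
  .pair (.num (C.count α β j C.start)) (codeList (C.layers α β j))

/-- The successors of a state under all the letters, each with a weight. -/
def letterOptions (f : C.State → ℕ) (q : C.State) : Data :=
  codeList ((List.finRange C.k).map fun y => .pair (.num (f (C.step q y)))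
    (.pair (.num y) (.pair (.num (C.step q y).1) (.num (C.step q y).2))))

end CI

namespace PolyTime

variable {ι : Type} {x : ι → Data} {C : ι → CI dfaClass dfaClass}

/-! ### Computing the counts -/

theorem hardCode (h : PolyTime x fun i => (C i).code) :
    PolyTime x fun i => codeDFA (C i).hardDFA.2 :=
  h.fst

theorem softCode (h : PolyTime x fun i => (C i).code) :
    PolyTime x fun i => codeDFA (C i).softDFA.2 :=
  h.snd.fst

theorem minLength (h : PolyTime x fun i => (C i).code) :
    PolyTime x fun i => codeList (List.replicate (C i).m (.num 0)) :=
  h.snd.snd.fst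

theorem maxLength (h : PolyTime x fun i => (C i).code) :
    PolyTime x fun i => codeList (List.replicate (C i).n (.num 0)) :=
  h.snd.snd.snd.fst

section DFA

variable {k a : ι → ℕ} {M : ∀ i, DFA (Fin (k i)) (Fin (a i))}

theorem transitions (h : PolyTime x fun i => codeDFA (M i)) :
    PolyTime x fun i => codeList ((List.finRange (a i)).map fun q =>
      codeList ((List.finRange (k i)).map fun y => .num ((M i).step q y))) := by
  simpa [codeDFA, Data.fst, List.ofFn_eq_map] using h.fst

open Classical in
theorem acceptBits (h : PolyTime x fun i => codeDFA (M i)) :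
    PolyTime x fun i => codeList ((List.finRange (a i)).map fun q =>
      .num (if q ∈ (M i).accept then 1 else 0)) := by
  simpa [codeDFA, Data.snd, List.ofFn_eq_map] using h.snd.snd

theorem startState (h : PolyTime x fun i => codeDFA (M i)) :
    PolyTime x fun i => .num (M i).start :=
  h.snd.fst

theorem states (h : PolyTime x fun i => codeDFA (M i)) :
    PolyTime x fun i => codeList ((List.finRange (a i)).map fun q : Fin (a i) => .num q) := by
  have := h.transitions.enumerate
  simp only [List.length_map, List.length_finRange, ← List.map_coe_finRange_eq_range,
    List.map_map] at this
  exact this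

theorem letters (h : PolyTime x fun i => codeDFA (M i)) :
    PolyTime x fun i => codeList ((List.finRange (k i)).map fun y : Fin (k i) => .num y) := by
  have := (h.transitions.get (q := fun i => (M i).start) h.startState).enumerate
  simp only [List.length_map, List.length_finRange, ← List.map_coe_finRange_eq_range,
    List.map_map] at this
  exact this

end DFA

theorem bounded_length {n : ι → ℕ} {f : ∀ i, Fin (n i) → Data}
    (h : PolyTime x fun i => codeList ((List.finRange (n i)).map (f i))) : PolyBounded x n :=
  h.size.mono fun i => by
    simpa using length_le_size_codeList ((List.finRange (n i)).map (f i))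

theorem table_get {f : ∀ i, (C i).State → ℕ} {q : ∀ i, (C i).State}
    (hf : PolyTime x fun i => (C i).codeTable (f i))
    (h1 : PolyTime x fun i => .num (q i).1) (h2 : PolyTime x fun i => .num (q i).2) :
    PolyTime x fun i => .num (f i (q i)) :=
  get (f := fun i q' => Data.num (f i ((q i).1, q'))) (get hf h1) h2

theorem letterOptions {f : ∀ i, (C i).State → ℕ} {q : ∀ i, (C i).State}
    (h : PolyTime x fun i => (C i).code) (hf : PolyTime x fun i => (C i).codeTable (f i))
    (h1 : PolyTime x fun i => .num (q i).1) (h2 : PolyTime x fun i => .num (q i).2) :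
    PolyTime x fun i => (C i).letterOptions (f i) (q i) := by
  have hs : PolyTime x fun i => codeList ((List.finRange (C i).k).map fun y : Fin (C i).k =>
      .pair (.num y) (.pair (.num ((C i).step (q i) y).1) (.num ((C i).step (q i) y).2))) :=
    zip _ _ _ h.hardCode.letters (zip _ _ _ (get h.hardCode.transitions h1)
      (get h.softCode.transitions h2))
  refine map _ _ _ hs (PolyTime.pair ?_ id.snd)
  exact table_get (C := fun p : Σ i, Fin (C i).k => C p.1) (f := fun p => f p.1)
    (q := fun p => (C p.1).step (q p.1) p.2) hf.weaken id.snd.snd.fst id.snd.snd.snd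

/-- The recursion for the counts: from words of one length to words longer by one letter. -/
theorem nextTable {f : ∀ i, (C i).State → ℕ} (h : PolyTime x fun i => (C i).code)
    (hf : PolyTime x fun i => (C i).codeTable (f i)) :
    PolyTime x fun i => (C i).codeTable fun q =>
      ((List.finRange (C i).k).map fun y => f i ((C i).step q y)).sum := by
  refine map _ _ _ h.hardCode.states (map _ _ _ h.softCode.states.weaken ?_)
  have hl : PolyTime (fun p : Σ p : Σ i, Fin (C i).hardDFA.1, Fin (C p.1).softDFA.1 =>
      Data.pair (.pair (x p.1.1) (.num p.1.2)) (.num p.2))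
      fun p => (C p.1.1).letterOptions (f p.1.1) (p.1.2, p.2) :=
    letterOptions (C := fun p : Σ p : Σ i, Fin (C i).hardDFA.1, Fin (C p.1).softDFA.1 => C p.1.1)
      (f := fun p => f p.1.1) (q := fun p => (p.1.2, p.2))
      h.weaken₂ hf.weaken₂ id.fst.snd id.snd
  refine sum (map _ _ _ hl ?_)
  exact id.snd.fst

theorem weightTable {α β : ι → ℕ} (h : PolyTime x fun i => (C i).code)
    (hα : PolyTime x fun i => .num (α i)) (hβ : PolyTime x fun i => .num (β i)) :
    PolyTime x fun i => (C i).codeTable ((C i).weight (α i) (β i)) := by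
  classical
  refine map _ _ _ h.hardCode.acceptBits (map _ _ _ h.softCode.acceptBits.weaken ?_)
  -- the distinction of cases as arithmetic on the accepting bits
  have e : ∀ p : Σ p : Σ i, Fin (C i).hardDFA.1, Fin (C p.1).softDFA.1,
      (C p.1.1).weight (α p.1.1) (β p.1.1) (p.1.2, p.2) =
      (if p.1.2 ∈ (C p.1.1).hardDFA.2.accept then 1 else 0) *
        ((if p.2 ∈ (C p.1.1).softDFA.2.accept then 1 else 0) * α p.1.1 +
          (1 - if p.2 ∈ (C p.1.1).softDFA.2.accept then 1 else 0) * β p.1.1) := by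
    intro p
    simp only [CI.weight]
    split_ifs <;> simp
  simp only [e]
  refine mul id.fst.snd (add (mul id.snd ?_) (mul (sub (const (.num 1)) id.snd) ?_))
  · exact hα.weaken₂
  · exact hβ.weaken₂

section Counts

variable {α β : ι → ℕ}

theorem bounded_layers (h : PolyTime x fun i => (C i).code)
    (hα : PolyTime x fun i => .num (α i)) (hβ : PolyTime x fun i => .num (β i)) {n : ι → ℕ}
    (hn : PolyBounded x n) :
    PolyBounded x fun i => (n i + 1) * ((C i).layerBound (α i) (β i) (n i) + 1) + 1 := by
  have one : PolyBounded x fun _ => 1 := .const x 1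
  have hα' : PolyBounded x fun i => Nat.size (α i) :=
    hα.size.mono fun i => by simp only [Data.size]; omega
  have hβ' : PolyBounded x fun i => Nat.size (β i) :=
    hβ.size.mono fun i => by simp only [Data.size]; omega
  exact ((hn.add one).mul (((h.hardCode.states.bounded_length.mul
    ((((h.softCode.states.bounded_length.mul (((((h.hardCode.letters.bounded_length).mul hn).add
      (hα'.add hβ')).add one).add one)).add one).add one))).add one).add one)).add one

/-- The tables for the least admitted length. -/
theorem layers (h : PolyTime x fun i => (C i).code)
    (hα : PolyTime x fun i => .num (α i)) (hβ : PolyTime x fun i => .num (β i)) :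
    PolyTime x fun i => codeList ((C i).layers (α i) (β i) (C i).m) := by
  have hm := h.minLength
  have hmb : PolyBounded x fun i => (C i).m := hm.size.mono fun i => by
    simpa using length_le_size_codeList (List.replicate (C i).m (.num 0))
  have := fold (x := x) _ (fun i j => codeList ((C i).layers (α i) (β i) j)) hm
    ((h.weightTable hα hβ).pair (const (.num 0))) ?_ (h.bounded_layers hα hβ hmb)
    fun i j hj => (C i).size_layers_le _ _ (by simpa using hj)
  · simpa using this
  · refine PolyTime.pair ?_ id.snd.snd
    have hhead : ∀ i j, ((codeList ((C i).layers (α i) (β i) j))).fst =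
        (C i).codeTable ((C i).count (α i) (β i) j) := by
      intro i j; cases j <;> rfl
    refine nextTable (C := fun p : Σ i, Fin (List.replicate (C i).m (Data.num 0)).length => C p.1)
      (f := fun p => (C p.1).count (α p.1) (β p.1) p.2) h.weaken ?_
    simp only [← hhead]
    exact id.snd.snd.fst

/-- The choices for the length of a word, with their weights. -/
theorem lengthOptions (h : PolyTime x fun i => (C i).code)
    (hα : PolyTime x fun i => .num (α i)) (hβ : PolyTime x fun i => .num (β i)) :
    PolyTime x fun i => codeList ((lengths (C i).m ((C i).n + 1 - (C i).m)).map
      ((C i).lengthOption (α i) (β i))) := by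
  have hm := h.minLength
  have hn : PolyTime x fun i => codeList (List.replicate ((C i).n + 1) (.num 0)) :=
    (const (.num 0)).pair h.maxLength
  have hu : PolyTime x fun i => codeList (List.replicate ((C i).n + 1 - (C i).m) (.num 0)) := by
    simpa [List.drop_replicate] using hn.drop hm
  have hmb : PolyBounded x fun i => (C i).m := hm.size.mono fun i => by
    simpa using length_le_size_codeList (List.replicate (C i).m (.num 0))
  have hnb : PolyBounded x fun i => (C i).n + 1 := hn.size.mono fun i => by
    simpa using length_le_size_codeList (List.replicate ((C i).n + 1) (.num 0))
  have hB := h.bounded_layers hα hβ (hmb.add hnb)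
  set B : ι → ℕ := fun i => ((C i).m + ((C i).n + 1) + 1) *
    ((C i).layerBound (α i) (β i) ((C i).m + ((C i).n + 1)) + 1) + 1 with hBdef
  have hsize : ∀ i j, j ≤ (C i).m + ((C i).n + 1) →
      (codeList ((C i).layers (α i) (β i) j)).size ≤ B i :=
    fun i j hj => (C i).size_layers_le _ _ hj
  have hfst : ∀ i j, ((codeList ((C i).layers (α i) (β i) j))).fst =
      (C i).codeTable ((C i).count (α i) (β i) j) := by
    intro i j; cases j <;> rfl
  have hcount : ∀ i j, j ≤ (C i).m + ((C i).n + 1) →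
      Nat.size ((C i).count (α i) (β i) j (C i).start) + 1 ≤ B i := fun i j hj => by
    refine le_trans ?_ (hsize i j hj)
    refine le_trans ?_ (Data.size_fst_le _)
    rw [hfst, CI.codeTable]
    refine le_trans ?_ (size_le_size_codeList (List.mem_map_of_mem
      (List.mem_finRange (C i).start.1)))
    exact size_le_size_codeList (List.mem_map_of_mem
      (f := fun q' => Data.num ((C i).count (α i) (β i) j ((C i).start.1, q')))
      (List.mem_finRange (C i).start.2))
  -- the options for the lengths `m`, …, `m + j - 1`, and the tables for the length `m + j`
  have := fold (x := x) _ (fun i j => .pair (codeList ((C i).layers (α i) (β i) ((C i).m + j)))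
      (codeList ((lengths (C i).m j).map ((C i).lengthOption (α i) (β i))))) hu
    ((h.layers hα hβ).pair (const (.num 0))) ?_
    (B := fun i => B i + (((C i).n + 1) * ((B i + B i + 1) + 1) + 1) + 1)
    ((hB.add ((hnb.mul (((hB.add hB).add (.const x 1)).add (.const x 1))).add
      (.const x 1))).add (.const x 1)) fun i j hj => ?_
  · simpa [Data.snd] using this.snd
  · have hcode : PolyTime (fun p : Σ i,
        Fin (List.replicate ((C i).n + 1 - (C i).m) (Data.num 0)).length => Data.pair (x p.1)
        (.pair ((List.replicate ((C p.1).n + 1 - (C p.1).m) (Data.num 0)).get p.2)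
          (.pair (codeList ((C p.1).layers (α p.1) (β p.1) ((C p.1).m + p.2)))
            (codeList ((lengths (C p.1).m p.2).map ((C p.1).lengthOption (α p.1) (β p.1)))))))
        fun p => (C p.1).code := h.weaken
    have htab : PolyTime (fun p : Σ i,
        Fin (List.replicate ((C i).n + 1 - (C i).m) (Data.num 0)).length => Data.pair (x p.1)
        (.pair ((List.replicate ((C p.1).n + 1 - (C p.1).m) (Data.num 0)).get p.2)
          (.pair (codeList ((C p.1).layers (α p.1) (β p.1) ((C p.1).m + p.2)))
            (codeList ((lengths (C p.1).m p.2).map ((C p.1).lengthOption (α p.1) (β p.1)))))))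
        fun p => (C p.1).codeTable ((C p.1).count (α p.1) (β p.1) ((C p.1).m + p.2)) := by
      simp only [← hfst]
      exact id.snd.snd.fst.fst
    refine PolyTime.pair ?_ (PolyTime.pair (PolyTime.pair ?_ id.snd.snd.fst) id.snd.snd.snd)
    · exact (hcode.nextTable htab).pair id.snd.snd.fst
    · exact table_get htab hcode.hardCode.startState hcode.softCode.startState
  · rw [List.length_replicate] at hj
    have h1 := hsize i ((C i).m + j) (by omega)
    have h2 : (codeList ((lengths (C i).m j).map ((C i).lengthOption (α i) (β i)))).size ≤
        ((C i).n + 1) * ((B i + B i + 1) + 1) + 1 := by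
      refine (size_codeList_le (B := B i + B i + 1) fun d hd => ?_).trans ?_
      · obtain ⟨a, ha, rfl⟩ := List.mem_map.1 hd
        have ha := mem_lengths.1 ha
        have h3 := hsize i a (by omega)
        have h4 := hcount i a (by omega)
        simp only [CI.lengthOption, Data.size]; omega
      · rw [List.length_map, length_lengths]
        gcongr
        omega
    simp only [Data.size]; omega

theorem total (h : PolyTime x fun i => (C i).code)
    (hα : PolyTime x fun i => .num (α i)) (hβ : PolyTime x fun i => .num (β i)) :
    PolyTime x fun i => .num ((C i).total (α i) (β i)) :=
  sum (map (fun i => lengths (C i).m ((C i).n + 1 - (C i).m)) _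
    (fun i j => .num ((C i).count (α i) (β i) j (C i).start)) (h.lengthOptions hα hβ) id.snd.fst)

end Counts

end PolyTime

/-! ### Generating the word of a given rank -/

theorem codeWord_eq {k : ℕ} (w : List (Fin k)) :
    codeWord w = codeList (w.map fun y : Fin k => .num y) := by
  have : (do let a ← w; pure (a : ℕ)) = w.map fun y : Fin k => (y : ℕ) := by
    induction w with
    | nil => rfl
    | cons y w ih => simpa using ih
  rw [codeWord, this, List.map_map]
  rfl

theorem codeWord_injective (k : ℕ) : Function.Injective (codeWord (k := k)) := by
  have hl : Function.Injective codeList := by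
    intro l
    induction l with
    | nil => intro l' h; cases l' <;> simp_all [codeList]
    | cons a l ih =>
      intro l' h
      cases l' with
      | nil => simp [codeList] at h
      | cons b l' =>
        simp only [codeList, Data.pair.injEq] at h
        rw [h.1, ih h.2]
  intro v w h
  rw [codeWord_eq, codeWord_eq] at h
  refine List.map_injective_iff.2 (fun y z hyz => ?_) (hl h)
  exact Fin.ext (Data.num.inj hyz)

namespace CI

variable (C : CI dfaClass dfaClass)

theorem unrank_words_succ {α β j r r' : ℕ} {q : C.State} {y : Fin C.k} {w : List (Fin C.k)}
    (h : Unrank (fun w => C.weight α β (C.run q w)) (words C.k (j + 1)) r (y :: w) r') :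
    ∃ r₁, Unrank (fun y => C.count α β j (C.step q y)) (List.finRange C.k) r y r₁ ∧
      Unrank (fun w => C.weight α β (C.run (C.step q y) w)) (words C.k j) r₁ w r' := by
  obtain ⟨z, r₁, hz, h⟩ := h.of_flatMap
  obtain ⟨v, hv, h'⟩ := h.of_map
  obtain ⟨rfl, rfl⟩ := List.cons.inj hv
  refine ⟨r₁, ?_, h'⟩
  convert hz using 2 with z
  rw [count_eq, List.map_map]
  rfl

/-- The letters of a word are found one after the other, each from the offset that the one before
has left. -/
theorem exists_ranks {α β : ℕ} (w : List (Fin C.k)) {q : C.State} {r r' : ℕ}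
    (h : Unrank (fun w => C.weight α β (C.run q w)) (words C.k w.length) r w r') :
    ∃ ρ : ℕ → ℕ, ρ 0 = r ∧ ∀ t (ht : t < w.length),
      Unrank (fun y => C.count α β (w.length - (t + 1)) (C.step (C.run q (w.take t)) y))
        (List.finRange C.k) (ρ t) w[t] (ρ (t + 1)) := by
  induction w generalizing q r with
  | nil => exact ⟨fun _ => r, rfl, fun t ht => by simp at ht⟩
  | cons y w ih =>
    obtain ⟨r₁, h₁, h₂⟩ := C.unrank_words_succ h
    obtain ⟨ρ, hρ, hs⟩ := ih h₂
    refine ⟨fun t => Nat.casesOn t r ρ, rfl, fun t ht => ?_⟩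
    cases t with
    | zero => simpa [run, hρ] using h₁
    | succ t =>
      have := hs t (by simpa using ht)
      simpa [run] using this

theorem unrank_candidates {α β r r' : ℕ} {w : List (Fin C.k)}
    (h : Unrank (fun w => C.weight α β (C.run C.start w)) C.candidates r w r') :
    ∃ r₁, Unrank (fun j => C.count α β j C.start) (lengths C.m (C.n + 1 - C.m)) r w.length r₁ ∧
      Unrank (fun w => C.weight α β (C.run C.start w)) (words C.k w.length) r₁ w r' := by
  obtain ⟨j, r₁, hj, h⟩ := h.of_flatMap
  obtain rfl := mem_words.1 h.mem
  refine ⟨r₁, ?_, h⟩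
  simpa only [count_eq] using hj

theorem getElem_layers (α β : ℕ) {j t : ℕ} (ht : t ≤ j) :
    (C.layers α β j)[t]'(by rw [length_layers]; omega) = C.codeTable (C.count α β (j - t)) := by
  induction j generalizing t with
  | zero =>
    obtain rfl : t = 0 := by omega
    rfl
  | succ j ih =>
    cases t with
    | zero => rfl
    | succ t =>
      simp only [layers, List.getElem_cons_succ, Nat.add_sub_add_right]
      exact ih (by omega)

end CI

namespace PolyTime

variable {ι : Type} {x : ι → Data} {C : ι → CI dfaClass dfaClass}

/-- The word of rank `r` among all words of admitted length is computed letter by letter, in one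
traversal of the tables for the remaining lengths. -/
theorem word {α β r r' : ι → ℕ} {w : ∀ i, List (Fin (C i).k)}
    (hw : ∀ i, Unrank (fun w => (C i).weight (α i) (β i) ((C i).run (C i).start w))
      (C i).candidates (r i) (w i) (r' i))
    (h : PolyTime x fun i => (C i).code)
    (ho : PolyTime x fun i => codeList ((lengths (C i).m ((C i).n + 1 - (C i).m)).map
      ((C i).lengthOption (α i) (β i))))
    (hr : PolyTime x fun i => .num (r i)) : PolyTime x fun i => codeWord (w i) := by
  choose r₁ hlen hwd using fun i => (C i).unrank_candidates (hw i)
  choose ρ hρ0 hρ using fun i => (C i).exists_ranks (w i) (hwd i)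
  have hsel := unrank hlen ho hr
  have hlay : PolyTime x fun i => codeList (((C i).layers (α i) (β i) (w i).length).drop 1) := by
    have e : ∀ i, codeList (((C i).layers (α i) (β i) (w i).length).drop 1) =
        (codeList ((C i).layers (α i) (β i) (w i).length)).snd := fun i => by
      generalize (C i).layers (α i) (β i) (w i).length = l
      cases l <;> rfl
    simp only [e]
    exact hsel.fst.snd
  have hlength : ∀ i, (((C i).layers (α i) (β i) (w i).length).drop 1).length = (w i).length :=
    fun i => by simp [CI.length_layers]
  let Q : ∀ i, ℕ → (C i).State := fun i t => (C i).run (C i).start ((w i).take t)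
  have hq : ∀ i t, (Data.num (Q i t).1).size ≤ (C i).hardDFA.1 + 1 ∧
      (Data.num (Q i t).2).size ≤ (C i).softDFA.1 + 1 := by
    intro i t
    have h1 : Nat.size (Q i t).1 ≤ (Q i t).1 := Nat.size_le.2 Nat.lt_two_pow_self
    have h2 : Nat.size (Q i t).2 ≤ (Q i t).2 := Nat.size_le.2 Nat.lt_two_pow_self
    simp only [Data.size]; omega
  have hρle : ∀ i t, t ≤ (w i).length → ρ i t ≤ r₁ i := by
    intro i t ht
    induction t with
    | zero => rw [hρ0]
    | succ t ih => exact (hρ i t ht).offset_le.trans (ih (by omega))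
  have hwl : PolyBounded x fun i => (w i).length :=
    hlay.size.mono fun i => (hlength i).symm.le.trans (length_le_size_codeList _)
  have one : PolyBounded x fun _ => 1 := .const x 1
  -- after `t` letters: the state reached, the rank still to be used up, and the letters so far in
  -- reverse order
  have := fold (x := x) _ (fun i t => .pair (.pair (.num (Q i t).1) (.num (Q i t).2))
      (.pair (.num (ρ i t)) (codeList (((w i).map fun y : Fin (C i).k => Data.num y).take t).reverse)))
    hlay ?_ ?_
    (B := fun i => (((C i).hardDFA.1 + 1) + ((C i).softDFA.1 + 1) + 1) +
      ((Data.num (r₁ i)).size + ((w i).length * (((C i).k + 1) + 1) + 1) + 1) + 1)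
    (((((h.hardCode.states.bounded_length.add one).add
      (h.softCode.states.bounded_length.add one)).add one).add
      ((hsel.snd.size.add ((hwl.mul ((h.hardCode.letters.bounded_length.add one).add one)).add
        one)).add one)).add one) fun i t ht => ?_
  · have h := this.snd.snd.reverse
    simpa [CI.length_layers, List.take_of_length_le, codeWord_eq] using h
  · simp only [hρ0]
    exact (h.hardCode.startState.pair h.softCode.startState).pair
      (hsel.snd.pair (const (.num 0)))
  · have hlt : ∀ p : Σ i, Fin (((C i).layers (α i) (β i) (w i).length).drop 1).length,
        (p.2 : ℕ) < (w p.1).length := fun p => p.2.2.trans_eq (hlength p.1)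
    have hget : ∀ p : Σ i, Fin (((C i).layers (α i) (β i) (w i).length).drop 1).length,
        (((C p.1).layers (α p.1) (β p.1) (w p.1).length).drop 1).get p.2 =
        (C p.1).codeTable ((C p.1).count (α p.1) (β p.1) ((w p.1).length - (p.2 + 1))) :=
      fun p => by
        have := hlt p
        rw [List.get_eq_getElem, List.getElem_drop]
        simp only [Nat.add_comm 1]
        exact (C p.1).getElem_layers _ _ (by omega)
    have hQ : ∀ p : Σ i, Fin (((C i).layers (α i) (β i) (w i).length).drop 1).length,
        Q p.1 (p.2 + 1) = (C p.1).step (Q p.1 p.2) ((w p.1)[p.2.1]'(hlt p)) := fun p => by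
      simp only [Q, CI.run]
      rw [← List.take_concat_get' (w p.1) p.2.1 (hlt p), List.foldl_append]
      rfl
    have hacc : ∀ p : Σ i, Fin (((C i).layers (α i) (β i) (w i).length).drop 1).length,
        codeList (((w p.1).map fun y : Fin (C p.1).k => Data.num y).take (p.2 + 1)).reverse =
        .pair (.num ((w p.1)[p.2.1]'(hlt p)))
          (codeList (((w p.1).map fun y : Fin (C p.1).k => Data.num y).take p.2).reverse) :=
      fun p => by
        have := List.take_concat_get' ((w p.1).map fun y : Fin (C p.1).k => Data.num y) p.2.1
          (by simpa using hlt p)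
        rw [← this, List.reverse_append]
        simp [codeList]
    simp only [hget, hQ, hacc]
    have hopt : PolyTime (fun p : Σ i, Fin (((C i).layers (α i) (β i) (w i).length).drop 1).length =>
        Data.pair (x p.1) (.pair
          ((C p.1).codeTable ((C p.1).count (α p.1) (β p.1) ((w p.1).length - (p.2 + 1))))
          (.pair (.pair (.num (Q p.1 p.2).1) (.num (Q p.1 p.2).2)) (.pair (.num (ρ p.1 p.2))
            (codeList (((w p.1).map fun y : Fin (C p.1).k => Data.num y).take p.2).reverse)))))
        fun p => (C p.1).letterOptions
          ((C p.1).count (α p.1) (β p.1) ((w p.1).length - (p.2 + 1))) (Q p.1 p.2) :=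
      letterOptions (h.weaken (r := Sigma.fst)) id.snd.fst id.snd.snd.fst.fst id.snd.snd.fst.snd
    have hnext := unrank (fun p => hρ p.1 p.2 (hlt p)) hopt id.snd.snd.snd.fst
    exact (hnext.fst.snd).pair (hnext.snd.pair (hnext.fst.fst.pair id.snd.snd.snd.snd))
  · rw [hlength] at ht
    have h1 := hq i t
    have h2 := Nat.size_le_size (hρle i t ht)
    have h3 : (codeList (((w i).map fun y : Fin (C i).k => Data.num y).take t).reverse).size ≤
        (w i).length * (((C i).k + 1) + 1) + 1 := by
      refine (size_codeList_le (B := (C i).k + 1) fun d hd => ?_).trans ?_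
      · obtain ⟨y, -, rfl⟩ := List.mem_map.1 (List.mem_of_mem_take (List.mem_reverse.1 hd))
        have h1 : Nat.size y ≤ y := Nat.size_le.2 Nat.lt_two_pow_self
        simp only [Data.size]; omega
      · gcongr
        simp
    simp only [Data.size] at *; omega

end PolyTime

/-! ### Rejection sampling: the program -/

/-- The number whose binary expansion is that of `c`, followed by the given bits. -/
def bitVal : ℕ → List Bool → ℕ
  | c, [] => c
  | c, b :: l => bitVal (c + c + b.toNat) l

/-- The program that doubles the number in variable `2` until it reaches the number in the first
component of the second component of variable `0`, and with every doubling appends a random bit to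
the number in variable `1`. -/
def bitLoop : Prog :=
  .loop (.sub (.fst (.snd (.var 0))) (.var 2))
    (.seq (.flip 3) (.seq (.assign 1 (.add (.add (.var 1) (.var 1)) (.var 3)))
      (.assign 2 (.add (.var 2) (.var 2)))))

/-- The program that replaces `(u, d)` in variable `0` by `(d, r)`, where `r` is a random number
below the least power of `2` that is at least the first component of `d`. -/
def draw : Prog :=
  .seq (.assign 1 (.quote (.num 0))) (.seq (.assign 2 (.quote (.num 1)))
    (.seq bitLoop (.assign 0 (.pair (.snd (.var 0)) (.var 1)))))

/-- Random numbers are drawn and treated by the program `P` until the first component of variable `0`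
is `0`; the second component is the output. -/
def sampler (P : Prog) (d : Data) : Prog :=
  .seq (.assign 0 (.quote (.pair (.num 1) d)))
    (.seq (.loop (.fst (.var 0)) (.seq draw P)) (.assign 0 (.snd (.var 0))))

theorem clog_le_size (T : ℕ) : Nat.clog 2 T ≤ Nat.size T :=
  Nat.clog_le_of_le_pow (Nat.lt_size_self T).le

/-- From the start state of `bitLoop`, or after `j` coins, the remaining coins are appended to the
number in variable `1`. The loop ends after `Nat.clog 2 T` coins, since `2 ^ j < T` until then. -/
theorem exec_bitLoop {T : ℕ} {u d : Data} (b : List Bool) {c j : ℕ} {s : Store}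
    (h0 : s 0 = .pair u (.pair (.num T) d)) (h1 : s 1 = .num c) (h2 : s 2 = .num (2 ^ j))
    (hj : j + b.length = Nat.clog 2 T) (hc : c < 2 ^ j) :
    ∃ s' t, Exec bitLoop s b s' t ∧ s' 0 = s 0 ∧ s' 1 = .num (bitVal c b) ∧
      bitVal c b < 2 ^ Nat.clog 2 T ∧
      t ≤ (b.length + 1) * (100 + 100 * Nat.clog 2 T + 10 * (s 0).size) := by
  have hsize : ∀ a i, a < 2 ^ i → i ≤ Nat.clog 2 T + 1 → Nat.size a ≤ Nat.clog 2 T + 1 :=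
    fun a i ha hi => (Nat.size_le.2 ha).trans hi
  have hcost : (Term.sub (.fst (.snd (.var 0))) (.var 2)).cost s ≤
      10 + 10 * Nat.clog 2 T + 10 * (s 0).size := by
    have e1 := hsize (2 ^ j) (j + 1) (Nat.pow_lt_pow_right (by omega) (by omega)) (by omega)
    have e2 := natSize_sub_le T (2 ^ j)
    simp only [Term.cost, Term.eval, h0, h2, Data.snd, Data.fst, Data.size, Data.toNat]
    omega
  induction b generalizing c j s with
  | nil =>
    have hf : ¬ ((Term.sub (.fst (.snd (.var 0))) (.var 2)).eval s).IsTrue := by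
      have : T ≤ 2 ^ j := by
        have := Nat.le_pow_clog (b := 2) (by omega) T
        rwa [← hj, List.length_nil, Nat.add_zero] at this
      simp only [Term.eval, h0, h2, Data.snd, Data.fst, Data.toNat, num_isTrue]
      omega
    refine ⟨s, _, Exec.loop_false hf, rfl, h1, ?_, ?_⟩
    · rw [List.length_nil, Nat.add_zero] at hj
      rw [← hj]; exact hc
    · simp only [List.length_nil]; omega
  | cons b l ih =>
    rw [List.length_cons] at hj
    have ht : ((Term.sub (.fst (.snd (.var 0))) (.var 2)).eval s).IsTrue := by
      have : 2 ^ j < T := Nat.pow_lt_of_lt_clog (by omega)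
      simp only [Term.eval, h0, h2, Data.snd, Data.fst, Data.toNat, num_isTrue]
      omega
    set s₁ := Function.update s 3 (.num b.toNat) with hs₁
    set s₂ := Function.update s₁ 1
      ((Term.add (.add (.var 1) (.var 1)) (.var 3)).eval s₁) with hs₂
    set s₃ := Function.update s₂ 2 ((Term.add (.var 2) (.var 2)).eval s₂) with hs₃
    have h10 : s₁ 1 = .num c := by rw [hs₁, Function.update_of_ne (by omega), h1]
    have h13 : s₁ 3 = .num b.toNat := Function.update_self ..
    have h20 : s₂ 2 = .num (2 ^ j) := by
      rw [hs₂, Function.update_of_ne (by omega), hs₁, Function.update_of_ne (by omega), h2]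
    have h30 : s₃ 0 = s 0 := by
      rw [hs₃, Function.update_of_ne (by omega), hs₂, Function.update_of_ne (by omega), hs₁,
        Function.update_of_ne (by omega)]
    have h31 : s₃ 1 = .num (c + c + b.toNat) := by
      rw [hs₃, Function.update_of_ne (by omega), hs₂, Function.update_self]
      simp only [Term.eval, h10, h13, Data.toNat]
    have h32 : s₃ 2 = .num (2 ^ (j + 1)) := by
      rw [hs₃, Function.update_self]
      simp only [Term.eval, h20, Data.toNat, pow_succ, mul_two]
    have hb : b.toNat ≤ 1 := Bool.toNat_le b
    have hc' : c + c + b.toNat < 2 ^ (j + 1) := by rw [pow_succ]; omega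
    have e1 := hsize (2 ^ j) (j + 1) (Nat.pow_lt_pow_right (by omega) (by omega)) (by omega)
    have e2 := hsize (2 ^ (j + 1)) (j + 1 + 1) (Nat.pow_lt_pow_right (by omega) (by omega))
      (by omega)
    have e3 := hsize c j hc (by omega)
    have e4 := hsize (c + c + b.toNat) (j + 1) hc' (by omega)
    have e5 := hsize (c + c) (j + 1) (by omega) (by omega)
    have e6 := hsize b.toNat 1 (by omega) (by omega)
    obtain ⟨s', t, e, i0, i1, i2, i3⟩ := ih (c := c + c + b.toNat) (j := j + 1) (s := s₃)
      (h30.trans h0) h31 h32 (by omega) hc' (by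
        simp only [Term.cost, Term.eval, h30, h0, h32, Data.snd, Data.fst, Data.size, Data.toNat]
        have := natSize_sub_le T (2 ^ (j + 1))
        omega)
    refine ⟨s', _, Exec.loop_true ht
      (Exec.seq (Exec.flip 3 b s) (Exec.seq_nil (Exec.assign 1 _ s₁) (Exec.assign 2 _ s₂))) e,
      i0.trans h30, i1, i2, ?_⟩
    rw [h30] at i3
    have hm : (l.length + 1 + 1) * (100 + 100 * Nat.clog 2 T + 10 * (s 0).size) =
      (l.length + 1) * (100 + 100 * Nat.clog 2 T + 10 * (s 0).size) +
        (100 + 100 * Nat.clog 2 T + 10 * (s 0).size) := by ring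
    rw [List.length_cons, hm]
    have k1 : (Term.add (.add (.var 1) (.var 1)) (.var 3)).cost s₁ ≤ 5 * Nat.clog 2 T + 20 := by
      simp only [Term.cost, Term.eval, h10, h13, Data.size, Data.toNat]; omega
    have k2 : (Term.add (.var 2) (.var 2)).cost s₂ ≤ 5 * Nat.clog 2 T + 20 := by
      simp only [Term.cost, Term.eval, h20, Data.size, Data.toNat, ← mul_two, ← pow_succ]
      omega
    omega

theorem exec_draw {T : ℕ} {u d : Data} (b : List Bool) {s : Store}
    (h0 : s 0 = .pair u (.pair (.num T) d)) (hb : b.length = Nat.clog 2 T) :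
    ∃ s' t, Exec draw s b s' t ∧ s' 0 = .pair (.pair (.num T) d) (.num (bitVal 0 b)) ∧
      bitVal 0 b < 2 ^ Nat.clog 2 T ∧ t ≤ (((s 0).size + 1) * (200 + 200 * (s 0).size)) := by
  set s₁ := Function.update s 1 ((Term.quote (.num 0)).eval s) with hs₁
  set s₂ := Function.update s₁ 2 ((Term.quote (.num 1)).eval s₁) with hs₂
  have h20 : s₂ 0 = s 0 := by
    rw [hs₂, Function.update_of_ne (by omega), hs₁, Function.update_of_ne (by omega)]
  have h21 : s₂ 1 = .num 0 := by
    rw [hs₂, Function.update_of_ne (by omega), hs₁, Function.update_self]; rfl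
  have h22 : s₂ 2 = .num (2 ^ 0) := by rw [hs₂, Function.update_self]; rfl
  obtain ⟨s₃, t, e, i0, i1, i2, i3⟩ := exec_bitLoop b (h20.trans h0) h21 h22 (by omega) (by simp)
  refine ⟨_, _, (Exec.assign 1 _ s).seq_nil' <| (Exec.assign 2 _ s₁).seq_nil' <|
    e.seq_nil_right <| Exec.assign 0 _ s₃, ?_, i2, ?_⟩
  · simp [Term.eval, i0, i1, h20, h0, Data.snd]
  · have e1 := clog_le_size T
    have e2 := Nat.size_le.2 i2
    have hs : Nat.size T + 1 ≤ (s 0).size := by rw [h0]; simp only [Data.size]; omega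
    have e3 := (s 0).size_snd_le
    have k0 : (Term.pair (.snd (.var 0)) (.var 1)).cost s₃ ≤ 10 + 10 * (s 0).size := by
      simp only [Term.cost, Term.eval, i0, i1, h20, Data.size]; omega
    have k1 : (b.length + 1) * (100 + 100 * Nat.clog 2 T + 10 * (s₂ 0).size) ≤
        ((s 0).size + 1) * (100 + 110 * (s 0).size) := by
      rw [h20]
      gcongr ?_ * ?_ <;> omega
    have k2 : ((s 0).size + 1) * (200 + 200 * (s 0).size) =
        ((s 0).size + 1) * (100 + 110 * (s 0).size) +
        ((s 0).size + 1) * (100 + 90 * (s 0).size) := by ring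
    have k3 : 100 + 90 * (s 0).size ≤ ((s 0).size + 1) * (100 + 90 * (s 0).size) :=
      Nat.le_mul_of_pos_left _ (by omega)
    have k4 : (Term.quote (.num 0)).cost s = 1 := by simp [Term.cost, Data.size]
    have k5 : (Term.quote (.num 1)).cost s₁ = 2 := by simp [Term.cost, Data.size]
    rw [k2]
    omega

/-- `Rounds T r k c`: the coins `r` make `k` blocks, as long as the number `T` requires, that encode
numbers not below `T`, and a final block that encodes the number `c` below `T`. -/
inductive Rounds (T : ℕ) : List Bool → ℕ → ℕ → Prop
  | accept {b : List Bool} : b.length = Nat.clog 2 T → bitVal 0 b < T → Rounds T b 0 (bitVal 0 b)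
  | reject {b r : List Bool} {k c : ℕ} : b.length = Nat.clog 2 T → T ≤ bitVal 0 b →
      Rounds T r k c → Rounds T (b ++ r) (k + 1) c

theorem Rounds.lt {T : ℕ} {r : List Bool} {k c : ℕ} (h : Rounds T r k c) : c < T := by
  induction h with
  | accept _ h => exact h
  | reject _ _ _ ih => exact ih

theorem rounds_zero_iff {T : ℕ} {r : List Bool} {c : ℕ} :
    Rounds T r 0 c ↔ r.length = Nat.clog 2 T ∧ bitVal 0 r = c ∧ c < T := by
  constructor
  · intro h; cases h with
    | accept h h' => exact ⟨h, rfl, h'⟩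
  · rintro ⟨h, rfl, h'⟩; exact .accept h h'

theorem rounds_succ_iff {T : ℕ} {r : List Bool} {k c : ℕ} :
    Rounds T r (k + 1) c ↔ Nat.clog 2 T ≤ r.length ∧ T ≤ bitVal 0 (r.take (Nat.clog 2 T)) ∧
      Rounds T (r.drop (Nat.clog 2 T)) k c := by
  constructor
  · intro h; cases h with
    | reject h h' hr =>
      rw [← h, List.take_left, List.drop_left]
      exact ⟨by simp, h', hr⟩
  · rintro ⟨h, h', hr⟩
    have := Rounds.reject (by simpa using h) h' hr
    rwa [List.take_append_drop] at this

theorem Rounds.unique {T : ℕ} {r : List Bool} {k k' c c' : ℕ} (h : Rounds T r k c)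
    (h' : Rounds T r k' c') : k = k' ∧ c = c' := by
  induction k generalizing r k' with
  | zero =>
    obtain ⟨h1, h2, h3⟩ := rounds_zero_iff.1 h
    cases k' with
    | zero => exact ⟨rfl, h2.symm.trans (rounds_zero_iff.1 h').2.1⟩
    | succ k' =>
      have := (rounds_succ_iff.1 h').2.1
      rw [← h1, List.take_length] at this
      omega
  | succ k ih =>
    obtain ⟨h1, h2, h3⟩ := rounds_succ_iff.1 h
    cases k' with
    | zero =>
      obtain ⟨h4, h5, h6⟩ := rounds_zero_iff.1 h'
      rw [← h4, List.take_length] at h2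
      omega
    | succ k' =>
      obtain ⟨rfl, rfl⟩ := ih h3 (rounds_succ_iff.1 h').2.2
      exact ⟨rfl, rfl⟩

section Sampler

variable {P : Prog} {T τ : ℕ} {d : Data} {out : ℕ → Data}

/-- The program `P` treats the random numbers as rejection sampling requires: a number `r` below `T`
leads to the output `out r`, and any other number to a new attempt. -/
def Handles (P : Prog) (T τ : ℕ) (d : Data) (out : ℕ → Data) : Prop :=
  ∀ r s, r < 2 ^ Nat.clog 2 T → s 0 = .pair (.pair (.num T) d) (.num r) →
    ∃ s' t, Exec P s [] s' t ∧ t ≤ τ ∧ s' 0 =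
      if r < T then .pair (.num 0) (out r) else .pair (.num 1) (.pair (.num T) d)

/-- A bound for the time of a round of the sampler. -/
def roundTime (T τ : ℕ) (d : Data) : ℕ :=
  ((Data.pair (.num 1) (.pair (.num T) d)).size + 1) *
    (200 + 200 * (Data.pair (.num 1) (.pair (.num T) d)).size) + τ + 1

theorem exec_round (hP : Handles P T τ d out) {b : List Bool} (hb : b.length = Nat.clog 2 T)
    {s : Store} (h0 : s 0 = .pair (.num 1) (.pair (.num T) d)) :
    ∃ s' t, Exec (.seq draw P) s b s' t ∧ t ≤ roundTime T τ d ∧ s' 0 =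
      if bitVal 0 b < T then .pair (.num 0) (out (bitVal 0 b))
      else .pair (.num 1) (.pair (.num T) d) := by
  obtain ⟨s₁, t₁, e₁, a₁, b₁, c₁⟩ := exec_draw b h0 hb
  obtain ⟨s₂, t₂, e₂, a₂, b₂⟩ := hP _ s₁ b₁ a₁
  refine ⟨s₂, _, e₁.seq_nil_right e₂, ?_, b₂⟩
  rw [h0] at c₁
  simp only [roundTime]
  omega

theorem exec_rounds (hP : Handles P T τ d out) {r : List Bool} {k c : ℕ} (h : Rounds T r k c)
    {s : Store} (h0 : s 0 = .pair (.num 1) (.pair (.num T) d)) :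
    ∃ s' t, Exec (.loop (.fst (.var 0)) (.seq draw P)) s r s' t := by
  induction h generalizing s with
  | accept hb hlt =>
    obtain ⟨s₁, t₁, e₁, -, a₁⟩ := exec_round hP hb h0
    rw [if_pos hlt] at a₁
    have := Exec.loop_true (e := .fst (.var 0)) (by simp [Term.eval, h0, Data.fst, num_isTrue]) e₁
      (Exec.loop_false (by simp [Term.eval, a₁, Data.fst, num_isTrue]))
    rw [List.append_nil] at this
    exact ⟨_, _, this⟩
  | reject hb hle _ ih =>
    obtain ⟨s₁, t₁, e₁, -, a₁⟩ := exec_round hP hb h0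
    rw [if_neg (by omega)] at a₁
    obtain ⟨s₂, t₂, e₂⟩ := ih a₁
    exact ⟨_, _, Exec.loop_true (by simp [Term.eval, h0, Data.fst, num_isTrue]) e₁ e₂⟩

/-- Conversely to `exec_rounds`, every halting run of the loop consists of rounds. -/
theorem rounds_of_exec (hP : Handles P T τ d out) {r : List Bool} {s s' : Store} {t : ℕ}
    (h : Exec (.loop (.fst (.var 0)) (.seq draw P)) s r s' t)
    (h0 : s 0 = .pair (.num 1) (.pair (.num T) d)) :
    ∃ k c, Rounds T r k c ∧ s' 0 = .pair (.num 0) (out c) ∧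
      t ≤ (k + 1) * (roundTime T τ d + 2 * (s 0).size + 1) + 2 * (s' 0).size + 1 := by
  have hcost : ∀ s : Store, (Term.fst (.var 0)).cost s ≤ 2 * (s 0).size := fun s => by
    have := (s 0).size_fst_le
    simp only [Term.cost, Term.eval]; omega
  generalize hp : Prog.loop (.fst (.var 0)) (.seq draw P) = p at h
  induction h with
  | assign | flip | seq | branch_true | branch_false => cases hp
  | loop_false hf =>
    cases hp
    simp [Term.eval, h0, Data.fst, num_isTrue] at hf
  | @loop_true _ _ s s₁ s₂ r₁ r₂ t₁ t₂ _ e₁ e₂ _ ih =>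
    cases hp
    -- a full block of coins for the first round, from the coins that it has consumed
    obtain ⟨s₁', t₁', e₁', ht, a₁⟩ := exec_round hP
      (b := (r₁ ++ List.replicate (Nat.clog 2 T) false).take (Nat.clog 2 T)) (by simp) h0
    obtain ⟨hr, rfl, rfl⟩ := e₁.unique e₁'
      (z₁ := List.replicate (Nat.clog 2 T) false) (List.take_append_drop _ _).symm
    have hlen : r₁.length = Nat.clog 2 T := by rw [hr]; simp
    rw [← hr] at a₁
    have hc := hcost s
    by_cases hlt : bitVal 0 r₁ < T
    · rw [if_pos hlt] at a₁
      cases e₂ with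
      | loop_true hn => simp [Term.eval, a₁, Data.fst, num_isTrue] at hn
      | loop_false =>
        rw [List.append_nil]
        refine ⟨0, _, .accept hlen hlt, a₁, ?_⟩
        have := hcost s₁
        omega
    · rw [if_neg hlt] at a₁
      obtain ⟨k, c, hk, hs, hb⟩ := ih a₁ rfl
      refine ⟨k + 1, c, .reject hlen (by omega) hk, hs, ?_⟩
      rw [a₁, ← h0] at hb
      have hm : (k + 1 + 1) * (roundTime T τ d + 2 * (s 0).size + 1) =
        (k + 1) * (roundTime T τ d + 2 * (s 0).size + 1) +
          (roundTime T τ d + 2 * (s 0).size + 1) := by ring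
      rw [hm]
      omega

/-- A bound for the running time of the sampler per round, if the outputs are of size at most `B`. -/
def samplerTime (T τ B : ℕ) (d : Data) : ℕ :=
  roundTime T τ d + 10 * (Data.pair (.num 1) (.pair (.num T) d)).size + 10 * B + 100

theorem run_sampler (hP : Handles P T τ d out) {r : List Bool} {k c : ℕ} (h : Rounds T r k c) :
    ∃ t, Run (sampler P (.pair (.num T) d)) (.num 0) r (out c) t := by
  set s₁ := Function.update (initStore (.num 0)) 0 (.pair (.num 1) (.pair (.num T) d)) with hs₁
  have h0 : s₁ 0 = .pair (.num 1) (.pair (.num T) d) := by rw [hs₁, Function.update_self]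
  obtain ⟨s₂, t₂, e₂⟩ := exec_rounds hP h h0
  obtain ⟨k', c', h', hs, -⟩ := rounds_of_exec hP e₂ h0
  obtain ⟨rfl, rfl⟩ := h.unique h'
  refine ⟨_, _, (Exec.assign 0 (.quote _) _).seq_nil' <| e₂.seq_nil_right <| Exec.assign 0 _ s₂, ?_⟩
  simp [Term.eval, hs, Data.snd]

theorem rounds_of_run (hP : Handles P T τ d out) {B : ℕ} (hB : ∀ c < T, (out c).size ≤ B)
    {r : List Bool} {o : Data} {t : ℕ}
    (h : Run (sampler P (.pair (.num T) d)) (.num 0) r o t) :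
    ∃ k c, Rounds T r k c ∧ o = out c ∧ t ≤ samplerTime T τ B d * (k + 1) := by
  obtain ⟨s, h, rfl⟩ := h
  cases h with
  | seq h h' =>
    cases h
    cases h' with
    | seq h h' =>
      cases h'
      obtain ⟨k, c, hk, hs, ht⟩ := rounds_of_exec hP h (by simp [Term.eval])
      refine ⟨k, c, by simpa using hk, by simp [Term.eval, hs, Data.snd], ?_⟩
      have hc := hB c hk.lt
      have h1 : Nat.size 0 = 0 := Nat.size_zero
      simp only [hs, Term.cost, Term.eval, Function.update_self, Data.size, Data.snd, h1,
        samplerTime] at ht ⊢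
      have hm : (roundTime T τ d + 10 * ((Nat.size 1 + 1) + ((Nat.size T + 1) + d.size + 1) + 1) +
          10 * B + 100) * (k + 1) =
        (k + 1) * (roundTime T τ d + 2 * ((Nat.size 1 + 1) + ((Nat.size T + 1) + d.size + 1) + 1)
          + 1) + (k + 1) * (8 * ((Nat.size 1 + 1) + ((Nat.size T + 1) + d.size + 1) + 1) +
          10 * B + 99) := by ring
      have hk : 8 * ((Nat.size 1 + 1) + ((Nat.size T + 1) + d.size + 1) + 1) + 10 * B + 99 ≤
          (k + 1) * (8 * ((Nat.size 1 + 1) + ((Nat.size T + 1) + d.size + 1) + 1) +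
          10 * B + 99) := Nat.le_mul_of_pos_left _ (by omega)
      rw [hm]
      omega

end Sampler

/-! ### Rejection sampling: the probabilities -/

open scoped ENNReal

theorem tsum_list_bool (h : List Bool → ℝ≥0∞) :
    ∑' r, h r = h [] + (∑' r, h (false :: r) + ∑' r, h (true :: r)) := by
  rw [ENNReal.tsum_eq_add_tsum_ite ([] : List Bool)]
  congr 1
  have hinj : Function.Injective fun p : Bool × List Bool => p.1 :: p.2 := by
    rintro ⟨b, l⟩ ⟨b', l'⟩ h
    simpa using h
  refine (hinj.tsum_eq fun r hr => ?_).symm.trans ?_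
  · cases r with
    | nil => simp at hr
    | cons b l => exact ⟨(b, l), rfl⟩
  · rw [ENNReal.tsum_prod', tsum_bool]
    simp

/-- The first `ℓ` of a sequence of coins encode a uniformly distributed number, independent of the
remaining coins. -/
theorem tsum_block (ℓ c : ℕ) (F : ℕ → List Bool → ℝ≥0∞) :
    ∑' r : List Bool, (if ℓ ≤ r.length then
      2⁻¹ ^ r.length * F (bitVal c (r.take ℓ)) (r.drop ℓ) else 0) =
    2⁻¹ ^ ℓ * ∑ v ∈ Finset.range (2 ^ ℓ), ∑' r : List Bool, 2⁻¹ ^ r.length * F (c * 2 ^ ℓ + v) r := by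
  induction ℓ generalizing c with
  | zero => simp [bitVal]
  | succ ℓ ih =>
    rw [tsum_list_bool]
    have key : ∀ b : Bool, ∑' r : List Bool, (if ℓ + 1 ≤ (b :: r).length then
        2⁻¹ ^ (b :: r).length * F (bitVal c ((b :: r).take (ℓ + 1))) ((b :: r).drop (ℓ + 1))
        else 0) = 2⁻¹ * (2⁻¹ ^ ℓ * ∑ v ∈ Finset.range (2 ^ ℓ),
          ∑' r : List Bool, 2⁻¹ ^ r.length * F ((c + c + b.toNat) * 2 ^ ℓ + v) r) := by
      intro b
      rw [← ih, ← ENNReal.tsum_mul_left]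
      refine tsum_congr fun r => ?_
      simp only [List.length_cons, add_le_add_iff_right, List.take_succ_cons, List.drop_succ_cons,
        bitVal, mul_ite, mul_zero, pow_succ', mul_assoc]
    rw [key, key, pow_succ 2 ℓ, mul_two, Finset.sum_range_add, if_neg (by simp), zero_add,
      ← mul_add, ← mul_add, ← mul_assoc, ← pow_succ']
    congr 2
    · refine Finset.sum_congr rfl fun v _ => ?_
      congr! 4
      simp; ring
    · refine Finset.sum_congr rfl fun v _ => ?_
      congr! 4
      simp; ring

open Classical in
/-- The probability that the sampler ends after `k` rejections, with a number that satisfies `X`. -/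
noncomputable def roundsProb (T : ℕ) (X : ℕ → Prop) (k : ℕ) : ℝ≥0∞ :=
  ∑' r : List Bool, if ∃ c, X c ∧ Rounds T r k c then 2⁻¹ ^ r.length else 0

open Classical in
/-- How many numbers below `T` satisfy `X`. -/
noncomputable def countBelow (T : ℕ) (X : ℕ → Prop) : ℕ :=
  ∑ v ∈ Finset.range T, if X v then 1 else 0

theorem roundsProb_zero (T : ℕ) (X : ℕ → Prop) :
    roundsProb T X 0 = 2⁻¹ ^ Nat.clog 2 T * (countBelow T X : ℝ≥0∞) := by
  classical
  have h := tsum_block (Nat.clog 2 T) 0 fun v r => if r = [] ∧ v < T ∧ X v then 1 else 0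
  have e : roundsProb T X 0 = ∑' r : List Bool, (if Nat.clog 2 T ≤ r.length then
      2⁻¹ ^ r.length * (if r.drop (Nat.clog 2 T) = [] ∧ bitVal 0 (r.take (Nat.clog 2 T)) < T ∧
        X (bitVal 0 (r.take (Nat.clog 2 T))) then 1 else 0) else 0) := by
    refine tsum_congr fun r => ?_
    rw [mul_ite, mul_one, mul_zero, ← ite_and]
    refine if_congr ?_ rfl rfl
    simp only [rounds_zero_iff, List.drop_eq_nil_iff]
    constructor
    · rintro ⟨c, hX, h1, rfl, h2⟩
      rw [← h1, List.take_length]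
      exact ⟨le_rfl, le_rfl, h2, hX⟩
    · rintro ⟨h1, h2, h3, h4⟩
      have hl : r.length = Nat.clog 2 T := le_antisymm h2 h1
      rw [← hl, List.take_length] at h3 h4
      exact ⟨_, h4, hl, rfl, h3⟩
  rw [e, h]
  congr 1
  have hr : ∀ v, ∑' r : List Bool, (2⁻¹ : ℝ≥0∞) ^ r.length *
      (if r = [] ∧ 0 * 2 ^ Nat.clog 2 T + v < T ∧ X (0 * 2 ^ Nat.clog 2 T + v) then 1 else 0) =
      if v < T ∧ X v then 1 else 0 := fun v => by
    rw [tsum_eq_single []]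
    · simp
    · intro r hr; simp [hr]
  simp only [hr]
  rw [countBelow, Nat.cast_sum]
  have hsub : Finset.range T ⊆ Finset.range (2 ^ Nat.clog 2 T) :=
    Finset.range_subset_range.2 (Nat.le_pow_clog (by omega) T)
  rw [← Finset.sum_subset hsub fun v _ hv => if_neg fun h => hv (Finset.mem_range.2 h.1)]
  refine Finset.sum_congr rfl fun v hv => ?_
  simp [Finset.mem_range.1 hv]

theorem roundsProb_succ (T : ℕ) (X : ℕ → Prop) (k : ℕ) :
    roundsProb T X (k + 1) =
      2⁻¹ ^ Nat.clog 2 T * ((2 ^ Nat.clog 2 T - T : ℕ) : ℝ≥0∞) * roundsProb T X k := by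
  classical
  have h := tsum_block (Nat.clog 2 T) 0
    fun v r => if T ≤ v ∧ ∃ c, X c ∧ Rounds T r k c then 1 else 0
  have e : roundsProb T X (k + 1) = ∑' r : List Bool, (if Nat.clog 2 T ≤ r.length then
      2⁻¹ ^ r.length * (if T ≤ bitVal 0 (r.take (Nat.clog 2 T)) ∧
        ∃ c, X c ∧ Rounds T (r.drop (Nat.clog 2 T)) k c then 1 else 0) else 0) := by
    refine tsum_congr fun r => ?_
    rw [mul_ite, mul_one, mul_zero, ← ite_and]
    refine if_congr ?_ rfl rfl
    simp only [rounds_succ_iff]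
    constructor
    · rintro ⟨c, hX, h1, h2, h3⟩
      exact ⟨h1, h2, c, hX, h3⟩
    · rintro ⟨h1, h2, c, hX, h3⟩
      exact ⟨c, hX, h1, h2, h3⟩
  rw [e, h, mul_assoc]
  congr 1
  have hr : ∀ v, ∑' r : List Bool, (2⁻¹ : ℝ≥0∞) ^ r.length *
      (if T ≤ 0 * 2 ^ Nat.clog 2 T + v ∧ ∃ c, X c ∧ Rounds T r k c then 1 else 0) =
      if T ≤ v then roundsProb T X k else 0 := fun v => by
    by_cases hv : T ≤ v <;> simp [hv, roundsProb]
  simp only [hr]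
  rw [← Finset.sum_filter, Finset.sum_const, nsmul_eq_mul]
  congr 2
  have hT : T ≤ 2 ^ Nat.clog 2 T := Nat.le_pow_clog (by omega) T
  rw [← Nat.card_Ico]
  congr 1
  ext v
  simp only [Finset.mem_filter, Finset.mem_range, Finset.mem_Ico]
  omega

theorem roundsProb_eq (T : ℕ) (X : ℕ → Prop) (k : ℕ) :
    roundsProb T X k = (2⁻¹ ^ Nat.clog 2 T * ((2 ^ Nat.clog 2 T - T : ℕ) : ℝ≥0∞)) ^ k *
      (2⁻¹ ^ Nat.clog 2 T * (countBelow T X : ℝ≥0∞)) := by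
  induction k with
  | zero => rw [roundsProb_zero, pow_zero, one_mul]
  | succ k ih => rw [roundsProb_succ, ih, pow_succ']; simp only [mul_assoc]

/-- The numbers below `T` come out with equal probability. -/
theorem tsum_roundsProb {T : ℕ} (hT : 0 < T) (X : ℕ → Prop) :
    ∑' k, roundsProb T X k = (countBelow T X : ℝ≥0∞) / T := by
  simp only [roundsProb_eq]
  rw [ENNReal.tsum_mul_right, ENNReal.tsum_geometric]
  set N := 2 ^ Nat.clog 2 T with hN
  have hTN : T ≤ N := Nat.le_pow_clog (by omega) T
  have hN0 : (N : ℝ≥0∞) ≠ 0 := by simp [hN]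
  have hNt : (N : ℝ≥0∞) ≠ ⊤ := ENNReal.natCast_ne_top N
  have hT0 : (T : ℝ≥0∞) ≠ 0 := by exact_mod_cast hT.ne'
  have hinv : (2⁻¹ : ℝ≥0∞) ^ Nat.clog 2 T = (N : ℝ≥0∞)⁻¹ := by
    rw [hN, ← ENNReal.inv_pow]; push_cast; rfl
  rw [hinv]
  have h1 : (1 : ℝ≥0∞) - (N : ℝ≥0∞)⁻¹ * ((N - T : ℕ) : ℝ≥0∞) = (N : ℝ≥0∞)⁻¹ * T := by
    refine ENNReal.sub_eq_of_eq_add (ENNReal.mul_ne_top (ENNReal.inv_ne_top.2 hN0)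
      (ENNReal.natCast_ne_top _)) ?_
    rw [← mul_add, ← Nat.cast_add, Nat.add_sub_cancel' hTN, ENNReal.inv_mul_cancel hN0 hNt]
  rw [h1, ENNReal.mul_inv (.inl (ENNReal.inv_ne_zero.2 hNt)) (.inr hT0), inv_inv,
    mul_comm (N : ℝ≥0∞), mul_assoc, ← mul_assoc (N : ℝ≥0∞), ENNReal.mul_inv_cancel hN0 hNt, one_mul,
    mul_comm, div_eq_mul_inv]

/-- A round is accepted with probability more than `1 / 2`. -/
theorem roundsProb_le {T : ℕ} (hT : 0 < T) (X : ℕ → Prop) (k : ℕ) :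
    roundsProb T X k ≤ 2⁻¹ ^ k := by
  classical
  rw [roundsProb_eq]
  set N := 2 ^ Nat.clog 2 T with hN
  have hTN : T ≤ N := Nat.le_pow_clog (by omega) T
  have hN0 : (N : ℝ≥0∞) ≠ 0 := by simp [hN]
  have hNt : (N : ℝ≥0∞) ≠ ⊤ := ENNReal.natCast_ne_top N
  have hinv : (2⁻¹ : ℝ≥0∞) ^ Nat.clog 2 T = (N : ℝ≥0∞)⁻¹ := by
    rw [hN, ← ENNReal.inv_pow]; push_cast; rfl
  have h2T : N ≤ 2 * T := by
    rcases Nat.lt_or_ge 1 T with h | h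
    · have h1 := Nat.pow_pred_clog_lt_self (b := 2) (by omega) h
      have h2 := Nat.clog_pos (b := 2) (by omega) h
      obtain ⟨j, hj⟩ := Nat.exists_eq_succ_of_ne_zero h2.ne'
      rw [hj] at h1 hN
      rw [Nat.pred_succ] at h1
      rw [hN, Nat.succ_eq_add_one, pow_succ]; omega
    · obtain rfl : T = 1 := by omega
      simp [hN]
  have hX : countBelow T X ≤ N := by
    refine le_trans (Finset.sum_le_card_nsmul _ _ 1 fun v _ => ?_) (by simpa using hTN)
    split_ifs <;> omega
  rw [hinv]
  have h1 : (N : ℝ≥0∞)⁻¹ * (countBelow T X : ℝ≥0∞) ≤ 1 := by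
    rw [← ENNReal.inv_mul_cancel hN0 hNt]
    gcongr
  have h2 : (N : ℝ≥0∞)⁻¹ * ((N - T : ℕ) : ℝ≥0∞) ≤ 2⁻¹ := by
    rw [← ENNReal.div_eq_inv_mul]
    refine ENNReal.div_le_of_le_mul ?_
    rw [← ENNReal.div_eq_inv_mul, ENNReal.le_div_iff_mul_le (by simp) (by simp)]
    have : (N - T) * 2 ≤ N := by omega
    exact_mod_cast this
  calc _ ≤ (2⁻¹ : ℝ≥0∞) ^ k * 1 := by gcongr
    _ = _ := mul_one _

theorem tsum_succ_mul_le : ∑' k : ℕ, ((k : ℝ≥0∞) + 1) * 2⁻¹ ^ k ≤ 8 := by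
  have h : ∀ k : ℕ, ((k : ℝ≥0∞) + 1) * 2⁻¹ ^ k ≤ 2 * (3 / 4) ^ k := by
    intro k
    have h1 : ((k : ℝ) + 1) * 2⁻¹ ^ k ≤ 2 * (3 / 4) ^ k := by
      -- Bernoulli's inequality: `1 + k / 2 ≤ (3 / 2) ^ k`
      have hb := one_add_mul_le_pow (a := (1 / 2 : ℝ)) (by norm_num) k
      have e : ((3 : ℝ) / 4) ^ k = (1 + 1 / 2) ^ k * 2⁻¹ ^ k := by
        rw [← mul_pow]; norm_num
      rw [e, ← mul_assoc]
      gcongr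
      linarith
    have h2 := ENNReal.ofReal_le_ofReal h1
    rw [ENNReal.ofReal_mul (by positivity), ENNReal.ofReal_mul (by positivity),
      ENNReal.ofReal_pow (by positivity), ENNReal.ofReal_pow (by positivity),
      ENNReal.ofReal_add (by positivity) (by positivity),
      ENNReal.ofReal_inv_of_pos (by positivity), ENNReal.ofReal_div_of_pos (by positivity)] at h2
    simpa using h2
  refine (ENNReal.tsum_le_tsum h).trans ?_
  rw [ENNReal.tsum_mul_left, ENNReal.tsum_geometric]
  have h4 : (1 : ℝ≥0∞) - 3 / 4 = 4⁻¹ := by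
    refine ENNReal.sub_eq_of_eq_add (ENNReal.div_ne_top (by simp) (by simp)) ?_
    rw [← one_div, ENNReal.div_add_div_same]
    norm_num
    rw [ENNReal.div_self (by simp) (by simp)]
  rw [h4, inv_inv]
  norm_num

section Sampler

variable {P : Prog} {T τ : ℕ} {d : Data} {out : ℕ → Data}

open Classical in
/-- A sequence of coins determines the number of rounds, so the probabilities for the numbers of
rejections add up. -/
theorem tsum_rounds (T : ℕ) (X : ℕ → Prop) :
    (∑' r : List Bool, if ∃ k c, X c ∧ Rounds T r k c then (2⁻¹ : ℝ≥0∞) ^ r.length else 0) =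
      ∑' k, roundsProb T X k := by
  simp only [roundsProb]
  rw [ENNReal.tsum_comm]
  refine tsum_congr fun r => ?_
  by_cases h : ∃ k c, X c ∧ Rounds T r k c
  · rw [if_pos h]
    obtain ⟨k, c, hX, hr⟩ := h
    rw [tsum_eq_single k, if_pos ⟨c, hX, hr⟩]
    rintro k' hk'
    exact if_neg fun ⟨c', _, hr'⟩ => hk' (hr'.unique hr).1
  · rw [if_neg h]
    refine (ENNReal.tsum_eq_zero.2 fun k => if_neg fun hk => h ⟨k, hk⟩).symm

theorem outputProb_sampler (hT : 0 < T) (hP : Handles P T τ d out) (o : Data) :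
    outputProb (sampler P (.pair (.num T) d)) o = (countBelow T fun c => out c = o) / T := by
  classical
  rw [← tsum_roundsProb hT, ← tsum_rounds, outputProb]
  refine tsum_congr fun r => if_congr ⟨?_, ?_⟩ rfl rfl
  · rintro ⟨t, h⟩
    obtain ⟨k, c, hk, rfl, -⟩ := rounds_of_run hP (B := ∑ c ∈ Finset.range T, (out c).size)
      (fun c hc => Finset.single_le_sum (f := fun c => (out c).size) (fun _ _ => Nat.zero_le _)
        (Finset.mem_range.2 hc)) h
    exact ⟨k, c, rfl, hk⟩
  · rintro ⟨k, c, rfl, hk⟩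
    exact run_sampler hP hk

theorem haltProb_sampler (hT : 0 < T) (hP : Handles P T τ d out) :
    haltProb (sampler P (.pair (.num T) d)) = 1 := by
  classical
  have h : (1 : ℝ≥0∞) = (countBelow T fun _ => True) / T := by
    have : countBelow T (fun _ => True) = T := by simp [countBelow]
    rw [this, ENNReal.div_self (by exact_mod_cast hT.ne') (ENNReal.natCast_ne_top T)]
  rw [h, ← tsum_roundsProb hT, ← tsum_rounds, haltProb]
  refine tsum_congr fun r => if_congr ⟨?_, ?_⟩ rfl rfl
  · rintro ⟨o, t, h⟩
    obtain ⟨k, c, hk, -, -⟩ := rounds_of_run hP (B := ∑ c ∈ Finset.range T, (out c).size)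
      (fun c hc => Finset.single_le_sum (f := fun c => (out c).size) (fun _ _ => Nat.zero_le _)
        (Finset.mem_range.2 hc)) h
    exact ⟨k, c, trivial, hk⟩
  · rintro ⟨k, c, -, hk⟩
    obtain ⟨t, h⟩ := run_sampler hP hk
    exact ⟨_, t, h⟩

theorem expectedTime_sampler_le (hT : 0 < T) (hP : Handles P T τ d out) {B : ℕ}
    (hB : ∀ c < T, (out c).size ≤ B) :
    expectedTime (sampler P (.pair (.num T) d)) ≤ (8 * samplerTime T τ B d : ℕ) := by
  classical
  set K := samplerTime T τ B d
  rw [expectedTime, if_pos (haltProb_sampler hT hP)]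
  have hle : ∀ r : List Bool, (∑' t : ℕ, if ∃ o, Run (sampler P (.pair (.num T) d)) (.num 0) r o t
      then (2⁻¹ : ℝ≥0∞) ^ r.length * (t : ℝ≥0∞) else 0) ≤
      ∑' k : ℕ, (K * (k + 1 : ℝ≥0∞)) *
        if ∃ c, True ∧ Rounds T r k c then 2⁻¹ ^ r.length else 0 := by
    intro r
    by_cases h : ∃ t o, Run (sampler P (.pair (.num T) d)) (.num 0) r o t
    · obtain ⟨t, o, h⟩ := h
      rw [tsum_eq_single t]
      · obtain ⟨k, c, hk, -, ht⟩ := rounds_of_run hP hB h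
        rw [if_pos ⟨o, h⟩]
        refine le_trans ?_ (ENNReal.le_tsum k)
        rw [if_pos ⟨c, trivial, hk⟩, mul_comm]
        gcongr
        exact_mod_cast ht
      · intro t' ht'
        refine if_neg fun ⟨o', h'⟩ => ht' ?_
        obtain ⟨s, e, -⟩ := h
        obtain ⟨s', e', -⟩ := h'
        exact (e'.unique e (z₁ := []) (z₂ := []) rfl).2.2
    · rw [ENNReal.tsum_eq_zero.2 fun t => if_neg fun ⟨o, ho⟩ => h ⟨t, o, ho⟩]
      exact zero_le
  refine (ENNReal.tsum_le_tsum hle).trans ?_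
  rw [ENNReal.tsum_comm]
  simp only [ENNReal.tsum_mul_left]
  have h2 : ∀ k : ℕ, (K * (k + 1 : ℝ≥0∞)) * (∑' r : List Bool,
      if ∃ c, True ∧ Rounds T r k c then 2⁻¹ ^ r.length else 0) ≤
      K * ((k + 1 : ℝ≥0∞) * 2⁻¹ ^ k) := fun k => by
    rw [mul_assoc]
    gcongr
    exact roundsProb_le hT (fun _ => True) k
  refine (ENNReal.tsum_le_tsum h2).trans ?_
  rw [ENNReal.tsum_mul_left, Nat.cast_mul, mul_comm (((8 : ℕ) : ℝ≥0∞))]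
  gcongr
  exact_mod_cast tsum_succ_mul_le

end Sampler

namespace CI

variable (C : CI dfaClass dfaClass)

/-! ### Feasibility and the weights of the words -/

open Classical in
/-- The admissible improvisations, as a finite set. -/
noncomputable def admissibleWords : Finset (List (Fin C.k)) :=
  C.candidates.toFinset.filter (· ∈ C.admissible)

open Classical in
/-- The improvisations that are not admissible, as a finite set. -/
noncomputable def inadmissibleWords : Finset (List (Fin C.k)) :=
  C.candidates.toFinset.filter fun w => w ∈ C.improvisations ∧ w ∉ C.admissible

theorem mem_improvisations {w : List (Fin C.k)} : w ∈ C.improvisations ↔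
    w ∈ C.candidates ∧ (C.run C.start w).1 ∈ C.hardDFA.2.accept := by
  rw [mem_candidates, run_eq, and_comm]
  rfl

theorem mem_admissible {w : List (Fin C.k)} : w ∈ C.admissible ↔
    w ∈ C.improvisations ∧ (C.run C.start w).2 ∈ C.softDFA.2.accept := by
  rw [run_eq]
  rfl

theorem mem_admissibleWords {w : List (Fin C.k)} :
    w ∈ C.admissibleWords ↔ w ∈ C.admissible := by
  simp only [admissibleWords, Finset.mem_filter, List.mem_toFinset, and_iff_right_iff_imp]
  exact fun h => ((C.mem_improvisations).1 h.1).1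

theorem mem_inadmissibleWords {w : List (Fin C.k)} :
    w ∈ C.inadmissibleWords ↔ w ∈ C.improvisations ∧ w ∉ C.admissible := by
  simp only [inadmissibleWords, Finset.mem_filter, List.mem_toFinset, and_iff_right_iff_imp]
  exact fun h => ((C.mem_improvisations).1 h.1).1

open Classical in
theorem weight_run {α β : ℕ} {w : List (Fin C.k)} (hw : w ∈ C.candidates) :
    C.weight α β (C.run C.start w) =
      if w ∈ C.admissibleWords then α else if w ∈ C.inadmissibleWords then β else 0 := by
  simp only [mem_admissibleWords, mem_inadmissibleWords, mem_admissible, mem_improvisations, hw,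
    true_and, weight]
  by_cases h1 : (C.run C.start w).1 ∈ C.hardDFA.2.accept <;>
    by_cases h2 : (C.run C.start w).2 ∈ C.softDFA.2.accept <;> simp [h1, h2]

theorem disjoint_words : Disjoint C.admissibleWords C.inadmissibleWords := by
  rw [Finset.disjoint_left]
  intro w h h'
  exact ((C.mem_inadmissibleWords).1 h').2 ((C.mem_admissibleWords).1 h)

theorem total_eq_card (α β : ℕ) :
    C.total α β = α * C.admissibleWords.card + β * C.inadmissibleWords.card := by
  classical
  rw [total_eq, ← List.sum_toFinset _ C.nodup_candidates,
    Finset.sum_congr rfl fun w hw => C.weight_run (List.mem_toFinset.1 hw)]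
  have h : ∀ w, (if w ∈ C.admissibleWords then α else if w ∈ C.inadmissibleWords then β else 0) =
      (if w ∈ C.admissibleWords then α else 0) + if w ∈ C.inadmissibleWords then β else 0 := by
    intro w
    by_cases h1 : w ∈ C.admissibleWords
    · simp [h1, Finset.disjoint_left.1 C.disjoint_words h1]
    · simp [h1]
  have hA : C.candidates.toFinset ∩ C.admissibleWords = C.admissibleWords :=
    Finset.inter_eq_right.2 (Finset.filter_subset _ _)
  have hB : C.candidates.toFinset ∩ C.inadmissibleWords = C.inadmissibleWords :=
    Finset.inter_eq_right.2 (Finset.filter_subset _ _)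
  simp only [h, Finset.sum_add_distrib, Finset.sum_ite_mem, hA, hB, Finset.sum_const, smul_eq_mul,
    mul_comm]

/-- The sum of the amounts by which the conditions for feasibility fail. The first two conditions are
`lam * N ≤ 1 ≤ rho * N`, where `N` is the number of improvisations; the others say that the admissible
improvisations can have probability `1 - ε`, and that the inadmissible ones need not have more than
`ε`. -/
noncomputable def violation : ℕ :=
  (C.lam.num.toNat * (C.total 1 0 + C.total 0 1) - C.lam.den) +
  (C.rho.den - C.rho.num.toNat * (C.total 1 0 + C.total 0 1)) +
  (C.ε.den * C.rho.den - (C.rho.num.toNat * C.total 1 0 * C.ε.den + C.ε.num.toNat * C.rho.den)) +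
  (C.lam.num.toNat * C.total 0 1 * C.ε.den - C.ε.num.toNat * C.lam.den)

/-- What is missing to total probability `1` when the admissible improvisations have the greatest
probability allowed and the inadmissible ones the least, times a common denominator. -/
noncomputable def slack : ℕ :=
  C.rho.den * C.lam.den - (C.rho.num.toNat * C.total 1 0 * C.lam.den +
    C.lam.num.toNat * C.total 0 1 * C.rho.den)

/-- The weight of the admissible improvisations. -/
noncomputable def goodWeight : ℕ :=
  if C.slack ≠ 0 then C.rho.num.toNat * C.total 0 1 else C.lam.den - C.lam.num.toNat * C.total 0 1

/-- The weight of the inadmissible improvisations. The summand `1 - C.total 1 0` makes it positive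
when there are no admissible improvisations. -/
noncomputable def badWeight : ℕ :=
  if C.slack ≠ 0 then C.rho.den - C.rho.num.toNat * C.total 1 0
  else C.lam.num.toNat * C.total 1 0 + (1 - C.total 1 0)

/-- The total weight of the improvisations. -/
noncomputable def mass : ℕ := C.total C.goodWeight C.badWeight

theorem toNat_num_eq {q : ℚ} (h : q ∈ Set.Icc (0 : ℚ) 1) :
    ((q.num.toNat : ℕ) : ℝ) = (q : ℝ) * (q.den : ℝ) := by
  have h1 : ((q.num.toNat : ℕ) : ℤ) = q.num := Int.toNat_of_nonneg (Rat.num_nonneg.2 h.1)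
  have h2 : (q.den : ℝ) ≠ 0 := by exact_mod_cast q.den_nz
  rw [← Int.cast_natCast, h1, Rat.cast_def, div_mul_cancel₀ _ h2]

theorem violation_eq_zero_iff : C.violation = 0 ↔
    (C.lam : ℝ) * (C.total 1 0 + C.total 0 1) ≤ 1 ∧
    1 ≤ (C.rho : ℝ) * (C.total 1 0 + C.total 0 1) ∧
    1 - (C.ε : ℝ) ≤ C.rho * C.total 1 0 ∧ (C.lam : ℝ) * C.total 0 1 ≤ C.ε := by
  have hl := toNat_num_eq C.lam_mem
  have hr := toNat_num_eq C.rho_mem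
  have he := toNat_num_eq C.ε_mem
  have hl0 : (0 : ℝ) < C.lam.den := by exact_mod_cast C.lam.den_pos
  have hr0 : (0 : ℝ) < C.rho.den := by exact_mod_cast C.rho.den_pos
  have he0 : (0 : ℝ) < C.ε.den := by exact_mod_cast C.ε.den_pos
  have h1 : C.lam.num.toNat * (C.total 1 0 + C.total 0 1) ≤ C.lam.den ↔
      (C.lam : ℝ) * (C.total 1 0 + C.total 0 1) ≤ 1 := by
    rw [← Nat.cast_le (α := ℝ)]
    push_cast
    rw [hl]
    refine Iff.trans ?_ (mul_le_mul_iff_left₀ hl0)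
    ring_nf
  have h2 : C.rho.den ≤ C.rho.num.toNat * (C.total 1 0 + C.total 0 1) ↔
      1 ≤ (C.rho : ℝ) * (C.total 1 0 + C.total 0 1) := by
    rw [← Nat.cast_le (α := ℝ)]
    push_cast
    rw [hr]
    refine Iff.trans ?_ (mul_le_mul_iff_left₀ hr0)
    ring_nf
  have h3 : C.ε.den * C.rho.den ≤
      C.rho.num.toNat * C.total 1 0 * C.ε.den + C.ε.num.toNat * C.rho.den ↔
      1 - (C.ε : ℝ) ≤ C.rho * C.total 1 0 := by
    rw [← Nat.cast_le (α := ℝ), sub_le_iff_le_add]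
    push_cast
    rw [hr, he]
    refine Iff.trans ?_ (mul_le_mul_iff_left₀ (mul_pos he0 hr0))
    ring_nf
  have h4 : C.lam.num.toNat * C.total 0 1 * C.ε.den ≤ C.ε.num.toNat * C.lam.den ↔
      (C.lam : ℝ) * C.total 0 1 ≤ C.ε := by
    rw [← Nat.cast_le (α := ℝ)]
    push_cast
    rw [hl, he]
    refine Iff.trans ?_ (mul_le_mul_iff_left₀ (mul_pos he0 hl0))
    ring_nf
  rw [← h1, ← h2, ← h3, ← h4, violation]
  omega

theorem slack_ne_zero_iff : C.slack ≠ 0 ↔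
    (C.rho : ℝ) * C.total 1 0 + C.lam * C.total 0 1 < 1 := by
  have hl := toNat_num_eq C.lam_mem
  have hr := toNat_num_eq C.rho_mem
  have hl0 : (0 : ℝ) < C.lam.den := by exact_mod_cast C.lam.den_pos
  have hr0 : (0 : ℝ) < C.rho.den := by exact_mod_cast C.rho.den_pos
  rw [slack, Nat.sub_ne_zero_iff_lt, ← Nat.cast_lt (α := ℝ)]
  push_cast
  rw [hl, hr]
  refine Iff.trans ?_ (mul_lt_mul_iff_left₀ (mul_pos hr0 hl0))
  ring_nf

theorem cast_mass : (C.mass : ℝ) = C.goodWeight * C.total 1 0 + C.badWeight * C.total 0 1 := by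
  rw [mass, total_eq_card, total_eq_card, total_eq_card]
  push_cast
  ring

/-- The weights, divided by their total, satisfy all requirements if the instance passes the test. The
admissible improvisations get as much probability as possible: each of them `rho`, unless that leaves
the others less than `lam` each. -/
theorem weights_spec (h : C.violation = 0) : 0 < C.mass ∧
    (0 < C.total 1 0 → (C.lam : ℝ) * C.mass ≤ C.goodWeight ∧
      (C.goodWeight : ℝ) ≤ C.rho * C.mass) ∧
    (0 < C.total 0 1 → (C.lam : ℝ) * C.mass ≤ C.badWeight ∧ (C.badWeight : ℝ) ≤ C.rho * C.mass) ∧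
    (1 - (C.ε : ℝ)) * C.mass ≤ C.goodWeight * C.total 1 0 := by
  obtain ⟨h1, h2, h3, h4⟩ := C.violation_eq_zero_iff.1 h
  have hl := toNat_num_eq C.lam_mem
  have hr := toNat_num_eq C.rho_mem
  have hl0 : (0 : ℝ) < C.lam.den := by exact_mod_cast C.lam.den_pos
  have hr0 : (0 : ℝ) < C.rho.den := by exact_mod_cast C.rho.den_pos
  have hlam : (0 : ℝ) ≤ C.lam := by exact_mod_cast C.lam_mem.1
  have hrho : (0 : ℝ) ≤ C.rho := by exact_mod_cast C.rho_mem.1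
  have hA : (0 : ℝ) ≤ C.total 1 0 := Nat.cast_nonneg _
  have hB : (0 : ℝ) ≤ C.total 0 1 := Nat.cast_nonneg _
  have hm := C.cast_mass
  suffices H : 0 < (C.mass : ℝ) ∧
      (0 < (C.total 1 0 : ℝ) → (C.lam : ℝ) * C.mass ≤ C.goodWeight ∧
        (C.goodWeight : ℝ) ≤ C.rho * C.mass) ∧
      (0 < (C.total 0 1 : ℝ) → (C.lam : ℝ) * C.mass ≤ C.badWeight ∧
        (C.badWeight : ℝ) ≤ C.rho * C.mass) ∧
      (1 - (C.ε : ℝ)) * C.mass ≤ C.goodWeight * C.total 1 0 by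
    simpa only [Nat.cast_pos] using H
  by_cases hs : C.slack ≠ 0
  · have hs' := C.slack_ne_zero_iff.1 hs
    have hg : (C.goodWeight : ℝ) = C.rho * C.rho.den * C.total 0 1 := by
      rw [goodWeight, if_pos hs]; push_cast; rw [hr]
    have hb : (C.badWeight : ℝ) = C.rho.den - C.rho * C.rho.den * C.total 1 0 := by
      have hle : C.rho.num.toNat * C.total 1 0 ≤ C.rho.den := by
        rw [← Nat.cast_le (α := ℝ)]
        push_cast
        rw [hr]
        have : (C.rho : ℝ) * C.total 1 0 ≤ 1 := by nlinarith
        nlinarith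
      rw [badWeight, if_pos hs, Nat.cast_sub hle]; push_cast; rw [hr]
    generalize (C.goodWeight : ℝ) = g at *
    generalize (C.badWeight : ℝ) = b at *
    generalize (C.mass : ℝ) = M at *
    generalize (C.total 1 0 : ℝ) = A at *
    generalize (C.total 0 1 : ℝ) = B at *
    generalize (C.rho.den : ℝ) = d at *
    have hM : M = d * B := by rw [hm, hg, hb]; ring
    have hB0 : 0 < B := by
      rcases hB.eq_or_lt with hB | hB
      · rw [← hB] at h2 hs'; linarith
      · exact hB
    have hlr : (C.lam : ℝ) ≤ C.rho := by nlinarith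
    refine ⟨hM ▸ mul_pos hr0 hB0, fun _ => ⟨?_, ?_⟩, fun _ => ⟨?_, ?_⟩, ?_⟩
    · rw [hg, hM]; nlinarith [mul_pos hr0 hB0]
    · rw [hg, hM]; linarith
    · rw [hb, hM]; nlinarith
    · rw [hb, hM]; nlinarith
    · rw [hg, hM]; nlinarith [mul_pos hr0 hB0]
  · have hs' : ¬ (C.rho : ℝ) * C.total 1 0 + C.lam * C.total 0 1 < 1 :=
      fun h => hs (C.slack_ne_zero_iff.2 h)
    have hg : (C.goodWeight : ℝ) = C.lam.den - C.lam * C.lam.den * C.total 0 1 := by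
      have hle : C.lam.num.toNat * C.total 0 1 ≤ C.lam.den := by
        rw [← Nat.cast_le (α := ℝ)]
        push_cast
        rw [hl]
        have : (C.lam : ℝ) * C.total 0 1 ≤ 1 := by nlinarith
        nlinarith
      rw [goodWeight, if_neg hs, Nat.cast_sub hle]; push_cast; rw [hl]
    rcases Nat.eq_zero_or_pos (C.total 1 0) with h0 | h0
    · have hb : (C.badWeight : ℝ) = 1 := by rw [badWeight, if_neg hs, h0]; simp
      simp only [h0, Nat.cast_zero, zero_add, mul_zero, not_lt, sub_nonpos] at h1 h2 h3 hs' hm ⊢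
      rw [hb, one_mul] at hm
      rw [hm, hb]
      have hB0 : (0 : ℝ) < C.total 0 1 := by
        rcases hB.eq_or_lt with hB | hB
        · rw [← hB] at h2; linarith
        · exact hB
      exact ⟨hB0, fun h => absurd h (lt_irrefl _), fun _ => ⟨h1, h2⟩, by nlinarith⟩
    · have hb : (C.badWeight : ℝ) = C.lam * C.lam.den * C.total 1 0 := by
        rw [badWeight, if_neg hs, Nat.sub_eq_zero_of_le h0]; push_cast; rw [hl]; ring
      have hA0 : (0 : ℝ) < C.total 1 0 := by exact_mod_cast h0
      generalize (C.goodWeight : ℝ) = g at *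
      generalize (C.badWeight : ℝ) = b at *
      generalize (C.mass : ℝ) = M at *
      generalize (C.total 1 0 : ℝ) = A at *
      generalize (C.total 0 1 : ℝ) = B at *
      generalize (C.lam.den : ℝ) = d at *
      have hM : M = d * A := by rw [hm, hg, hb]; ring
      refine ⟨hM ▸ mul_pos hl0 hA0, fun _ => ⟨?_, ?_⟩, fun hB0 => ⟨?_, ?_⟩, ?_⟩
      · rw [hg, hM]; nlinarith
      · rw [hg, hM]; nlinarith
      · rw [hb, hM]; linarith
      · have hlr : (C.lam : ℝ) ≤ C.rho := by nlinarith
        rw [hb, hM]; nlinarith [mul_pos hl0 hA0]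
      · rw [hg, hM]; nlinarith [mul_pos hl0 hA0]

theorem improvisations_eq :
    C.improvisations = ↑(C.admissibleWords ∪ C.inadmissibleWords) := by
  classical
  ext w
  simp only [Finset.coe_union, Set.mem_union, Finset.mem_coe, mem_admissibleWords,
    mem_inadmissibleWords]
  by_cases h : w ∈ C.admissible
  · simp [h, h.1]
  · simp [h]

theorem admissible_eq : C.admissible = ↑C.admissibleWords := by
  ext w
  simp [mem_admissibleWords]

theorem total_one_zero : C.total 1 0 = C.admissibleWords.card := by
  simp [total_eq_card]

theorem total_zero_one : C.total 0 1 = C.inadmissibleWords.card := by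
  simp [total_eq_card]

/-- The probabilities of the admissible and of the inadmissible improvisations witness the four
inequalities. -/
theorem Feasible.violation_eq_zero {C : CI dfaClass dfaClass} (h : C.Feasible) :
    C.violation = 0 := by
  classical
  obtain ⟨D, h1, h2, h3⟩ := h
  rw [improvisations_eq, PMF.toOuterMeasure_apply_finset, Finset.sum_union C.disjoint_words] at h1
  rw [admissible_eq, PMF.toOuterMeasure_apply_finset] at h2
  have hne : ∀ s : Finset (List (Fin C.k)), ∑ w ∈ s, D w ≠ ⊤ :=
    fun s => ENNReal.sum_ne_top.2 fun w _ => D.apply_ne_top w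
  have h1' := congrArg ENNReal.toReal h1
  rw [ENNReal.toReal_add (hne _) (hne _), ENNReal.toReal_one,
    ENNReal.toReal_sum fun w _ => D.apply_ne_top w,
    ENNReal.toReal_sum fun w _ => D.apply_ne_top w] at h1'
  rw [ENNReal.toReal_sum fun w _ => D.apply_ne_top w] at h2
  have hA : ∀ w ∈ C.admissibleWords, w ∈ C.improvisations :=
    fun w hw => ((C.mem_admissibleWords).1 hw).1
  have hB : ∀ w ∈ C.inadmissibleWords, w ∈ C.improvisations :=
    fun w hw => ((C.mem_inadmissibleWords).1 hw).1
  have a1 := Finset.card_nsmul_le_sum _ _ _ fun w hw => (h3 w (hA w hw)).1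
  have a2 := Finset.sum_le_card_nsmul _ _ _ fun w hw => (h3 w (hA w hw)).2
  have b1 := Finset.card_nsmul_le_sum _ _ _ fun w hw => (h3 w (hB w hw)).1
  have b2 := Finset.sum_le_card_nsmul _ _ _ fun w hw => (h3 w (hB w hw)).2
  rw [nsmul_eq_mul] at a1 a2 b1 b2
  rw [violation_eq_zero_iff, total_one_zero, total_zero_one]
  refine ⟨?_, ?_, ?_, ?_⟩ <;> linarith

open Classical in
/-- Every improvisation has its weight as probability, up to normalization. -/
noncomputable def distribution (h : 0 < C.mass) : PMF (List (Fin C.k)) :=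
  PMF.ofFinset (fun w => (if w ∈ C.candidates then
      C.weight C.goodWeight C.badWeight (C.run C.start w) else 0 : ℕ) / (C.mass : ENNReal))
    C.candidates.toFinset (by
      have h0 : (C.mass : ENNReal) ≠ 0 := by exact_mod_cast h.ne'
      simp only [div_eq_mul_inv]
      rw [← Finset.sum_mul, ← Nat.cast_sum,
        Finset.sum_congr rfl fun w hw => if_pos (List.mem_toFinset.1 hw),
        List.sum_toFinset _ C.nodup_candidates, ← total_eq]
      exact ENNReal.mul_inv_cancel h0 (ENNReal.natCast_ne_top _))
    (fun w hw => by
      rw [if_neg fun h => hw (List.mem_toFinset.2 h)]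
      simp)

open Classical in
theorem distribution_apply (h : 0 < C.mass) (w : List (Fin C.k)) : C.distribution h w =
    (if w ∈ C.admissibleWords then C.goodWeight else
      if w ∈ C.inadmissibleWords then C.badWeight else 0 : ℕ) / (C.mass : ENNReal) := by
  rw [distribution, PMF.ofFinset_apply]
  by_cases hw : w ∈ C.candidates
  · rw [if_pos hw, weight_run C hw]
  · have hI : w ∉ C.improvisations := fun h => hw ((C.mem_improvisations).1 h).1
    have hA : w ∉ C.admissibleWords := fun h => hI ((C.mem_admissibleWords).1 h).1
    have hB : w ∉ C.inadmissibleWords := fun h => hI ((C.mem_inadmissibleWords).1 h).1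
    rw [if_neg hw, if_neg hA, if_neg hB]

theorem isImprovisingDistribution (h : C.violation = 0) :
    C.IsImprovisingDistribution (C.distribution (C.weights_spec h).1) := by
  classical
  obtain ⟨hM, hA, hB, hε⟩ := C.weights_spec h
  have hM' : (0 : ℝ) < C.mass := by exact_mod_cast hM
  refine ⟨?_, ?_, fun w hw => ?_⟩
  · rw [PMF.toOuterMeasure_apply_eq_one_iff]
    intro w hw
    rw [PMF.mem_support_iff, distribution_apply] at hw
    rw [improvisations_eq, Finset.mem_coe, Finset.mem_union]
    by_contra hn
    rw [not_or] at hn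
    rw [if_neg hn.1, if_neg hn.2] at hw
    simp at hw
  · rw [admissible_eq, PMF.toOuterMeasure_apply_finset,
      Finset.sum_congr rfl fun w hw => by rw [distribution_apply, if_pos hw], Finset.sum_const,
      nsmul_eq_mul, ENNReal.toReal_mul, ENNReal.toReal_div]
    simp only [ENNReal.toReal_natCast]
    rw [mul_div_assoc', le_div_iff₀ hM', mul_comm _ (C.goodWeight : ℝ), ← total_one_zero]
    exact hε
  · rw [improvisations_eq, Finset.mem_coe, Finset.mem_union] at hw
    rw [distribution_apply, ENNReal.toReal_div, ENNReal.toReal_natCast, ENNReal.toReal_natCast,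
      le_div_iff₀ hM', div_le_iff₀ hM']
    rcases hw with hw | hw
    · rw [if_pos hw]
      exact hA (by rw [total_one_zero]; exact Finset.card_pos.2 ⟨w, hw⟩)
    · rw [if_neg fun h => Finset.disjoint_left.1 C.disjoint_words h hw, if_pos hw]
      exact hB (by rw [total_zero_one]; exact Finset.card_pos.2 ⟨w, hw⟩)

end CI

/-! ### The scheme -/

namespace CI

variable (C : CI dfaClass dfaClass)

/-- What a random number is turned into a word with: the choices for the length of the word, and the
instance. -/
noncomputable def samplerData : Data :=
  .pair (codeList ((lengths C.m (C.n + 1 - C.m)).map (C.lengthOption C.goodWeight C.badWeight)))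
    C.code

open Classical in
/-- The code of the word of rank `r` (`num 0` if there is none). -/
noncomputable def wordOfRank (r : ℕ) : Data :=
  if h : r < C.mass then
    codeWord (Unrank.exists_of_lt (r := r)
      (wt := fun w => C.weight C.goodWeight C.badWeight (C.run C.start w)) C.candidates
      (by rwa [← total_eq])).choose
  else .num 0

theorem exists_wordOfRank {r : ℕ} (h : r < C.mass) : ∃ w r',
    Unrank (fun w => C.weight C.goodWeight C.badWeight (C.run C.start w)) C.candidates r w r' ∧
      C.wordOfRank r = codeWord w := by
  have hex := Unrank.exists_of_lt (r := r)
    (wt := fun w => C.weight C.goodWeight C.badWeight (C.run C.start w)) C.candidates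
    (by rwa [← total_eq])
  exact ⟨hex.choose, hex.choose_spec.choose, hex.choose_spec.choose_spec, by
    rw [wordOfRank, dif_pos h]⟩

theorem countBelow_wordOfRank (w : List (Fin C.k)) :
    countBelow C.mass (fun r => C.wordOfRank r = codeWord w) =
      if w ∈ C.candidates then C.weight C.goodWeight C.badWeight (C.run C.start w) else 0 := by
  classical
  refine Eq.trans ?_ ((Unrank.sum_indicator
    (wt := fun w => C.weight C.goodWeight C.badWeight (C.run C.start w)) C.candidates
    C.nodup_candidates w).trans (by by_cases h : w ∈ C.candidates <;> simp [h]))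
  rw [← total_eq, countBelow, ← mass]
  refine Finset.sum_congr rfl fun r hr => if_congr ?_ rfl rfl
  obtain ⟨v, r', hv, he⟩ := C.exists_wordOfRank (Finset.mem_range.1 hr)
  rw [he]
  constructor
  · intro h
    obtain rfl := codeWord_injective _ h
    exact ⟨r', hv⟩
  · rintro ⟨r'', hw⟩
    rw [(hv.unique hw).1]

end CI

namespace PolyTime

variable {ι : Type} {x : ι → Data} {C : ι → CI dfaClass dfaClass}

theorem ratNum {q : ι → ℚ} (h : PolyTime x fun i => codeRat (q i)) :
    PolyTime x fun i => .num (q i).num.toNat :=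
  h.fst

theorem ratDen {q : ι → ℚ} (h : PolyTime x fun i => codeRat (q i)) :
    PolyTime x fun i => .num (q i).den :=
  h.snd

theorem errorBound (h : PolyTime x fun i => (C i).code) : PolyTime x fun i => codeRat (C i).ε :=
  h.snd.snd.snd.snd.fst

theorem lowerBound (h : PolyTime x fun i => (C i).code) : PolyTime x fun i => codeRat (C i).lam :=
  h.snd.snd.snd.snd.snd.fst

theorem upperBound (h : PolyTime x fun i => (C i).code) : PolyTime x fun i => codeRat (C i).rho :=
  h.snd.snd.snd.snd.snd.snd.fst

theorem violation (h : PolyTime x fun i => (C i).code) :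
    PolyTime x fun i => .num (C i).violation := by
  have hA := h.total (const (.num 1)) (const (.num 0))
  have hB := h.total (const (.num 0)) (const (.num 1))
  have ln := h.lowerBound.ratNum
  have ld := h.lowerBound.ratDen
  have rn := h.upperBound.ratNum
  have rd := h.upperBound.ratDen
  have en := h.errorBound.ratNum
  have ed := h.errorBound.ratDen
  exact add (add (add (sub (mul ln (add hA hB)) ld) (sub rd (mul rn (add hA hB))))
    (sub (mul ed rd) (add (mul (mul rn hA) ed) (mul en rd))))
    (sub (mul (mul ln hB) ed) (mul en ld))

theorem slack (h : PolyTime x fun i => (C i).code) : PolyTime x fun i => .num (C i).slack := by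
  have hA := h.total (const (.num 1)) (const (.num 0))
  have hB := h.total (const (.num 0)) (const (.num 1))
  have ln := h.lowerBound.ratNum
  have ld := h.lowerBound.ratDen
  have rn := h.upperBound.ratNum
  have rd := h.upperBound.ratDen
  exact sub (mul rd ld) (add (mul (mul rn hA) ld) (mul (mul ln hB) rd))

theorem goodWeight (h : PolyTime x fun i => (C i).code) :
    PolyTime x fun i => .num (C i).goodWeight := by
  have := ite (fun i => (C i).slack ≠ 0) h.slack (fun i => num_isTrue _)
    (mul h.upperBound.ratNum (h.total (const (.num 0)) (const (.num 1))))
    (sub h.lowerBound.ratDen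
      (mul h.lowerBound.ratNum (h.total (const (.num 0)) (const (.num 1)))))
  simpa only [CI.goodWeight, apply_ite Data.num] using this

theorem badWeight (h : PolyTime x fun i => (C i).code) :
    PolyTime x fun i => .num (C i).badWeight := by
  have hA := h.total (const (.num 1)) (const (.num 0))
  have := ite (fun i => (C i).slack ≠ 0) h.slack (fun i => num_isTrue _)
    (sub h.upperBound.ratDen (mul h.upperBound.ratNum hA))
    (add (mul h.lowerBound.ratNum hA) (sub (const (.num 1)) hA))
  simpa only [CI.badWeight, apply_ite Data.num] using this

theorem mass (h : PolyTime x fun i => (C i).code) : PolyTime x fun i => .num (C i).mass :=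
  h.total h.goodWeight h.badWeight

theorem samplerData (h : PolyTime x fun i => (C i).code) :
    PolyTime x fun i => (C i).samplerData :=
  (h.lengthOptions h.goodWeight h.badWeight).pair h

/-- One round of the sampler: the treatment of the random number. -/
theorem samplerRound : PolyTime
    (fun p : CI dfaClass dfaClass × ℕ => .pair (.pair (.num p.1.mass) p.1.samplerData) (.num p.2))
    fun p => if p.2 < p.1.mass then .pair (.num 0) (p.1.wordOfRank p.2)
      else .pair (.num 1) (.pair (.num p.1.mass) p.1.samplerData) := by
  refine branch (c := fun p => .num (p.1.mass - p.2)) (fun p => p.2 < p.1.mass)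
    (sub id.fst.fst id.snd) (fun p => ?_) ?_ ?_
  · rw [num_isTrue]; omega
  · choose w r' hw he using fun p : {p : CI dfaClass dfaClass × ℕ // p.2 < p.1.mass} =>
      p.1.1.exists_wordOfRank p.2
    have e : ∀ p : {p : CI dfaClass dfaClass × ℕ // p.2 < p.1.mass},
        (if p.1.2 < p.1.1.mass then Data.pair (.num 0) (p.1.1.wordOfRank p.1.2)
          else .pair (.num 1) (.pair (.num p.1.1.mass) p.1.1.samplerData)) =
        .pair (.num 0) (codeWord (w p)) := fun p => by rw [if_pos p.2, he]
    simp only [e]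
    exact (const (.num 0)).pair (word hw id.fst.snd.snd id.fst.snd.fst id.snd)
  · have e : ∀ p : {p : CI dfaClass dfaClass × ℕ // ¬ p.2 < p.1.mass},
        (if p.1.2 < p.1.1.mass then Data.pair (.num 0) (p.1.1.wordOfRank p.1.2)
          else .pair (.num 1) (.pair (.num p.1.1.mass) p.1.1.samplerData)) =
        .pair (.num 1) (.pair (.num p.1.1.mass) p.1.1.samplerData) := fun p => if_neg p.2
    simp only [e]
    exact (const (.num 1)).pair id.fst

end PolyTime

/-- The treatment of the random numbers by a fixed program, in a time polynomial in the size of the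
instance. -/
theorem exists_handler : ∃ (Q : Prog) (τ : CI dfaClass dfaClass → ℕ),
    PolyBounded (fun C : CI dfaClass dfaClass => C.code) τ ∧ ∀ C : CI dfaClass dfaClass,
      Handles Q C.mass (τ C) C.samplerData C.wordOfRank ∧
      ∀ r < C.mass, (C.wordOfRank r).size ≤ τ C := by
  obtain ⟨Q, N, T, ⟨π, hπ⟩, hQ⟩ := PolyTime.samplerRound
  have hD : PolyTime (fun C : CI dfaClass dfaClass => C.code)
      fun C => .pair (.num C.mass) C.samplerData :=
    (PolyTime.mass PolyTime.id).pair (PolyTime.samplerData PolyTime.id)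
  have hT : ∀ (C : CI dfaClass dfaClass) (r : ℕ), r < 2 ^ Nat.clog 2 C.mass → T (C, r) ≤
      π.eval (2 * (Data.pair (.num C.mass) C.samplerData).size) := by
    intro C r hr
    refine (hπ (C, r)).trans (polynomial_eval_mono π ?_)
    have h1 := (Nat.size_le.2 hr).trans (clog_le_size C.mass)
    have h2 := C.samplerData.size_pos
    simp only [Data.size]; omega
  refine ⟨Q, fun C => π.eval (2 * (Data.pair (.num C.mass) C.samplerData).size),
    ((PolyBounded.const _ 2).mul hD.size).eval π, fun C => ⟨fun r s hr hs => ?_, fun r hr => ?_⟩⟩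
  · obtain ⟨s', t, e, a, -, c, -⟩ := hQ (C, r) s hs
    exact ⟨s', t, e, c.trans (hT C r hr), a⟩
  · have hr' : r < 2 ^ Nat.clog 2 C.mass := hr.trans_le (Nat.le_pow_clog (by omega) _)
    obtain ⟨-, -, -, -, -, -, h⟩ := hQ (C, r)
      (fun _ => .pair (.pair (.num C.mass) C.samplerData) (.num r)) rfl
    refine le_trans ?_ (h.trans (hT C r hr'))
    simp only [if_pos hr, Data.size]; omega

namespace CI

/-- The improviser: a sampler with the data of the instance written into its text. -/
noncomputable def improviser (Q : Prog) (C : CI dfaClass dfaClass) : Prog :=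
  sampler Q (.pair (.num C.mass) C.samplerData)

open Classical in
/-- The answer of the scheme. -/
noncomputable def answer (Q : Prog) (C : CI dfaClass dfaClass) : Option Prog :=
  if C.violation ≠ 0 then none else some (C.improviser Q)

theorem isImproviser {Q : Prog} {τ : ℕ} {C : CI dfaClass dfaClass} (h : C.violation = 0)
    (hQ : Handles Q C.mass τ C.samplerData C.wordOfRank)
    (hτ : ∀ r < C.mass, (C.wordOfRank r).size ≤ τ) : C.IsImproviser (C.improviser Q) := by
  classical
  have hM := (C.weights_spec h).1
  refine ⟨(expectedTime_sampler_le hM hQ hτ).trans_lt (ENNReal.natCast_lt_top _),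
    C.distribution hM, fun w => ?_, C.isImprovisingDistribution h⟩
  rw [improviser, outputProb_sampler hM hQ, countBelow_wordOfRank, distribution,
    PMF.ofFinset_apply]

end CI

/-- The scheme writes the data of the sampler into the otherwise fixed text of the improviser. -/
theorem polyTime_answer (Q : Prog) :
    PolyTime (fun C : CI dfaClass dfaClass => C.code) fun C => codeAnswer (C.answer Q) := by
  classical
  have hD : PolyTime (fun C : CI dfaClass dfaClass => C.code)
      fun C => .pair (.num C.mass) C.samplerData :=
    (PolyTime.mass PolyTime.id).pair (PolyTime.samplerData PolyTime.id)
  have hsome : PolyTime (fun C : CI dfaClass dfaClass => C.code)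
      fun C => codeAnswer (some (C.improviser Q)) :=
    (PolyTime.const (.num 1)).pair ((PolyTime.const (.num 2)).pair
      (((PolyTime.const (.num 0)).pair ((PolyTime.const (.num 0)).pair
        ((PolyTime.const (.num 1)).pair ((PolyTime.const (.num 1)).pair hD)))).pair
        (PolyTime.const (Prog.code (.seq (.loop (.fst (.var 0)) (.seq draw Q))
          (.assign 0 (.snd (.var 0))))))))
  have := PolyTime.ite (fun C : CI dfaClass dfaClass => C.violation ≠ 0)
    (PolyTime.violation PolyTime.id) (fun C => num_isTrue _) (PolyTime.const (codeAnswer none)) hsome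
  simpa only [CI.answer, apply_ite codeAnswer] using this

theorem codeAnswer_injective : Function.Injective codeAnswer := by
  intro p q h
  cases p <;> cases q <;> simp_all [codeAnswer, Prog.code_injective.eq_iff]

theorem Run.unique {p : Prog} {input o o' : Data} {r : List Bool} {t t' : ℕ}
    (h : Run p input r o t) (h' : Run p input r o' t') : o = o' := by
  obtain ⟨s, e, rfl⟩ := h
  obtain ⟨s', e', rfl⟩ := h'
  rw [(e.unique e' (z₁ := []) (z₂ := []) rfl).2.1]

theorem natCast_eval_eq (p : Polynomial ℕ) (n : ℕ) :
    ((p.eval n : ℕ) : ℝ) = (p.map (Nat.castRingHom ℝ)).eval (n : ℝ) := by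
  rw [Polynomial.eval_natCast_map]
  rfl

end CtrlImprov

theorem theorem4p3 :
    ∃ S : CtrlImprov.Prog,
      CtrlImprov.IsPolyTimeImprovisationScheme CtrlImprov.dfaClass CtrlImprov.dfaClass S := by
  open CtrlImprov in
  classical
  obtain ⟨Q, τ, hτ, hQ⟩ := exists_handler
  obtain ⟨S, N, T, ⟨π, hπ⟩, hS⟩ := polyTime_answer Q
  have hrun : ∀ C : CI dfaClass dfaClass, ∃ t, Run S C.code [] (codeAnswer (C.answer Q)) t ∧
      t ≤ π.eval C.size := fun C => by
    obtain ⟨s, t, e, a, -, c, -⟩ := hS C (initStore C.code) (Function.update_self ..)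
    exact ⟨t, ⟨s, e, a⟩, c.trans (hπ C)⟩
  have hsome : ∀ C : CI dfaClass dfaClass, C.violation = 0 →
      C.answer Q = some (C.improviser Q) := fun C h => by simp [CI.answer, h]
  have himp : ∀ C : CI dfaClass dfaClass, C.violation = 0 → C.IsImproviser (C.improviser Q) :=
    fun C h => CI.isImproviser h (hQ C).1 (hQ C).2
  refine ⟨S, fun C => ⟨fun hC => ?_, fun hC => ?_⟩, ?_, ?_⟩
  · have h := hC.violation_eq_zero
    obtain ⟨t, ht, -⟩ := hrun C
    rw [hsome C h] at ht
    exact ⟨_, t, ht, himp C h⟩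
  · have h : C.violation ≠ 0 := fun h => hC ⟨_, C.isImprovisingDistribution h⟩
    obtain ⟨t, ht, -⟩ := hrun C
    rw [CI.answer, if_pos h] at ht
    exact ⟨t, ht⟩
  · refine ⟨π.map (Nat.castRingHom ℝ), fun C => ?_⟩
    obtain ⟨t, ht, hle⟩ := hrun C
    refine ⟨_, t, ht, ?_⟩
    rw [← natCast_eval_eq]
    exact_mod_cast hle
  · have hD : PolyTime (fun C : CI dfaClass dfaClass => C.code)
        fun C => .pair (.num 1) (.pair (.num C.mass) C.samplerData) :=
      (PolyTime.const _).pair ((PolyTime.mass PolyTime.id).pair (PolyTime.samplerData PolyTime.id))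
    have htime : PolyBounded (fun C : CI dfaClass dfaClass => C.code)
        fun C => 8 * samplerTime C.mass (τ C) (τ C) C.samplerData :=
      (PolyBounded.const _ 8).mul (((((((hD.size.add (.const _ 1)).mul
        ((PolyBounded.const _ 200).add ((PolyBounded.const _ 200).mul hD.size))).add hτ).add
        (.const _ 1)).add ((PolyBounded.const _ 10).mul hD.size)).add
        ((PolyBounded.const _ 10).mul hτ)).add (.const _ 100))
    obtain ⟨q, hq⟩ := htime
    refine ⟨q.map (Nat.castRingHom ℝ), fun C G t hG => ?_⟩
    obtain ⟨t', ht', -⟩ := hrun C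
    have hans := codeAnswer_injective (hG.unique ht')
    by_cases h : C.violation = 0
    · rw [hsome C h, Option.some.injEq] at hans
      subst hans
      refine (expectedTime_sampler_le (C.weights_spec h).1 (hQ C).1 (hQ C).2).trans ?_
      rw [← natCast_eval_eq, ENNReal.ofReal_natCast]
      exact_mod_cast hq C
    · rw [CI.answer, if_pos h] at hans
      cases hans
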